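/- **Setting.** Let $\mathcal X$ be a measurable space, $\mathcal Y=\{+1,-1\}$, and let $\mathcal F$ be a class of functions $\mathcal X\to[0,1]$. In square losses the label $+1$ has the value $1$ and the label $-1$ has the value $0$. There is an (unknown) $f^\star\in\mathcal F$ with $\mathbb P(y=+1\mid x)=f^\star(x)$. Where $|\mathcal F|$ appears, $\mathcal F$ is finite and its elements are measurable. A *regression oracle* for $\mathcal F$ takes finitely many weighted examples $(w,x,y)$, $w\ge 0$, $y\in\mathcal Y$, and returns some minimizer over $\mathcal F$ of $\sum w\,(f(x)-y)^2$ (ties broken measurably). Let $0<\gamma<\frac12$, $0<\delta<1$, $\epsilon>0$. For $f^\star\in\mathcal F$ and $\zeta>0$ let $\check{\mathfrak e}_{f^\star}(\mathcal F,\zeta)$ be the largest $m$ for which there are $x^1,\dots,x^m\in\mathcal X$ and $f^1,\dots,f^m\in\mathcal F$ with $|f^i(x^i)-f^\star(x^i)|>\zeta$ and $\sum_{j<i}(f^i(x^j)-f^\star(x^j))^2\le\zeta^2$ for all $i$. Put $\mathfrak e_{f^\star}=\sup_{\zeta\ge\gamma/4}\check{\mathfrak e}_{f^\star}(\mathcal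 F,\zeta)$ and $\mathfrak e=\sup_{f^\star\in\mathcal F}\mathfrak e_{f^\star}$. **Algorithm.** Let $\beta=\frac12\log(2|\mathcal F|/\delta)$. In round $t=1,2,\dots$ let $\widehat f_t$ be the output of the oracle on the labelled examples queried so far (all weights $1$), and for $b>0$ let $\mathcal F_t(b)$ be the set of $f\in\mathcal F$ whose square loss on these examples exceeds that of $\widehat f_t$ by at most $b$. From confidence bounds $\widehat{\mathsf{lcb}}_t(x)$, $\widehat{\mathsf{ucb}}_t(x)$ construct the classifier $$\widehat h_t(x)=\begin{cases}\bot,&[\widehat{\mathsf{lcb}}_t(x),\widehat{\mathsf{ucb}}_t(x)]\subseteq[\tfrac12-\gamma,\tfrac12+\gamma],\\ \operatorname{sgn}(2\widehat f_t(x)-1),&\text{otherwise}\end{cases}$$ (with $\operatorname{sgn}(0)=+1$). Observe $x_t$, take the action $a_t=\widehat h_t(x_t)$, and query the label $y_t$ if and only if $\frac12\in(\widehat{\mathsf{lcb}}_t(x_t),\widehat{\mathsf{ucb}}_t(x_t))$ and $\widehat h_t(x_t)\ne\bot$. After $T$ rounds return a uniformly random $\widehat h\in\{\widehat h_1,\dots,\widehat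 h_T\}$. **Theorem.** There are universal constants $C_0,C>0$ and, on every $\mathcal X$, two routines that compute confidence bounds and access the class only through the regression oracle, one for general $\mathcal F$ and one for $\mathcal F$ that are convex and closed under pointwise convergence, with the following properties. Put $\kappa(\gamma)=\frac1{\gamma^2}\log\frac1\gamma$ in the general case and $\kappa(\gamma)=\log\frac1\gamma$ in the convex case. 1. *(Implementation; $\mathcal F$ may be infinite, and $\beta>0$ and the labelled examples are arbitrary.)* The bounds satisfy $$\inf_{f\in\mathcal F_t(2\beta)}f(x)-\tfrac\gamma4\le\widehat{\mathsf{lcb}}_t(x)\le\inf_{f\in\mathcal F_t(\beta)}f(x),\qquad \sup_{f\in\mathcal F_t(\beta)}f(x)\le\widehat{\mathsf{ucb}}_t(x)\le\sup_{f\in\mathcal F_t(2\beta)}f(x)+\tfrac\gamma4 .$$ An evaluation of a classifier $\widehat h_t$ at a point takes at most $C\kappa(\gamma)$ oracle calls, and $T$ rounds of the algorithm take at most $C\,T\,\kappa(\gamma)$ oracle calls. 2. *(Independent data, $\mathcal F$ finite.)* Suppose that the $(x_t,y_t)$ are i.i.d. from $\mathcal D$, and let $T=\max\{1,\lceil C_0\frac{\mathfrak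 e}{\epsilon\gamma}\log\frac{|\mathcal F|}{\delta}\rceil\}$. With probability at least $1-2\delta$, simultaneously $$\frac1T\sum_{t=1}^T\big(\mathrm{err}_\gamma(\widehat h_t)-\mathrm{err}(h^\star)\big)\le\epsilon\qquad\text{and}\qquad \#\{\text{labels queried}\}\le C\,\frac{\mathfrak e\,\log(|\mathcal F|/\delta)}{\gamma^2},$$ where $\mathrm{err}_\gamma(h)=\mathbb P(h(x)\ne y,h(x)\ne\bot)+(\frac12-\gamma)\mathbb P(h(x)=\bot)$ and $\mathrm{err}(h^\star)$ is the error of $h^\star=\operatorname{sgn}(2f^\star-1)$; the left-hand average is the expected Chow's excess error of the returned classifier. The total number of oracle calls is always at most $$C\,\max\Big\{1,\frac{\mathfrak e}{\epsilon\gamma}\log\frac{|\mathcal F|}{\delta}\Big\}\,\kappa(\gamma),$$ that is, $O(\frac{\mathfrak e}{\epsilon\gamma^3}\log\frac{|\mathcal F|}\delta\log\frac1\gamma)$ in general and $O(\frac{\mathfrak e}{\epsilon\gamma}\log\frac{|\mathcal F|}\delta\log\frac1\gamma)$ in the convex case when the maximum is not $1$. 3. *(Adversarial data, $\mathcal F$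 finite.)* Suppose that the $x_t$ are chosen by an adaptive adversary and that $\mathbb P(y_t=+1\mid\overline{\mathfrak F}_{t-1})=f^\star(x_t)$, where $\overline{\mathfrak F}_{t-1}=\sigma(x_1,y_1,\dots,x_{t-1},y_{t-1},x_t)$. For every $T$, with probability at least $1-\delta$, simultaneously $$\sum_{t=1}^T\mathbb E\big[\ell_t(a_t)-\ell_t(a_t^\star)\mid\overline{\mathfrak F}_{t-1}\big]\le C\,\frac{\mathfrak e_{f^\star}\log(|\mathcal F|/\delta)}{\gamma}\qquad\text{and}\qquad \#\{\text{labels queried}\}\le C\,\frac{\mathfrak e_{f^\star}\log(|\mathcal F|/\delta)}{\gamma^2},$$ where $\ell_t(a)=\mathbb 1(a\ne y_t,a\ne\bot)+(\frac12-\gamma)\mathbb 1(a=\bot)$ and $a_t^\star=\operatorname{sgn}(2f^\star(x_t)-1)$. -/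

import Mathlib

open MeasureTheory ProbabilityTheory
open scoped NNReal

universe u v w

namespace ActiveLearning

/-! ### Regression oracle and programs with oracle access

Labels are Booleans: `true` is the label `+1` and `false` is the label `-1`. A classifier that may
abstain takes values in `Option Bool`, and `none` is the abstention `⊥`. -/

/-- The value that a label takes in a square loss: `1` for `+1` and `0` for `-1`, so that the
conditional mean of the label is the conditional probability of `+1`. -/
def labelValue (y : Bool) : ℝ := if y then 1 else 0

/-- A finite family of weighted examples `(w, x, y)` with `w ≥ 0`. -/
abbrev WeightedSample (X : Type u) : Type u := List (ℝ≥0 × X × Bool)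

/-- The queried points together with their labels. -/
abbrev Sample (X : Type u) : Type u := List (X × Bool)

/-- `∑ w (f x - y) ^ 2` over the weighted examples. -/
def weightedLoss {X : Type u} (f : X → ℝ) (S : WeightedSample X) : ℝ :=
  (S.map fun e => (e.1 : ℝ) * (f e.2.1 - labelValue e.2.2) ^ 2).sum

/-- All examples with weight one. -/
def unitWeights {X : Type u} (B : Sample X) : WeightedSample X :=
  B.map fun p => (1, p.1, p.2)

/-- `∑ (f x - y) ^ 2` over the queried points. -/
def sqLoss {X : Type u} (f : X → ℝ) (B : Sample X) : ℝ := weightedLoss f (unitWeights B)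

/-- `o` is a regression oracle over `F`: on each weighted sample it returns some minimizer over `F`
of the weighted square loss (ties are broken in any way). -/
def IsRegressionOracle {X : Type u} (F : Set (X → ℝ)) (o : WeightedSample X → X → ℝ) : Prop :=
  ∀ S, o S ∈ F ∧ ∀ f ∈ F, weightedLoss (o S) S ≤ weightedLoss f S

/-- Ties are broken measurably: for each size `n`, the set of samples of size `n` on which the
oracle returns a given function is measurable. -/
def IsMeasurableOracle {X : Type u} [MeasurableSpace X] (F : Set (X → ℝ))
    (o : WeightedSample X → X → ℝ) : Prop :=
  ∀ (n : ℕ), ∀ f ∈ F, MeasurableSet {s : Fin n → ℝ≥0 × X × Bool | o (List.ofFn s) = f}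

/-- A program that knows nothing about the class of regression functions, except through calls of
the regression oracle: it either returns a value, or submits a weighted sample to the oracle and
continues according to the function that it receives. -/
inductive OracleProg (X : Type u) (α : Type v) : Type (max u v)
  | pure (a : α) : OracleProg X α
  | call (S : WeightedSample X) (k : (X → ℝ) → OracleProg X α) : OracleProg X α

namespace OracleProg

/-- The value that the program returns when its calls are answered by `o`. -/
def run {X : Type u} {α : Type v} (o : WeightedSample X → X → ℝ) : OracleProg X α → α
  | pure a => a
  | call S k => run o (k (o S))

/-- The number of oracle calls that the program makes when they are answered by `o`. -/
def calls {X : Type u} {α : Type v} (o : WeightedSample X → X → ℝ) : OracleProg X α → ℕ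
  | pure _ => 0
  | call S k => calls o (k (o S)) + 1

/-- Sequential composition. -/
def bind {X : Type u} {α : Type v} {α' : Type w} :
    OracleProg X α → (α → OracleProg X α') → OracleProg X α'
  | pure a, g => g a
  | call S k, g => call S fun f => bind (k f) g

end OracleProg

/-! ### Active sets and confidence bounds -/

/-- The regression functions in `F` whose square loss on the queried points exceeds that of the
empirical minimizer `fhat` by at most `β`. -/
def activeSet {X : Type u} (F : Set (X → ℝ)) (fhat : X → ℝ) (B : Sample X) (β : ℝ) :
    Set (X → ℝ) :=
  {f | f ∈ F ∧ sqLoss f B ≤ sqLoss fhat B + β}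

/-- `inf_{f ∈ G} f x`. -/
noncomputable def lcb {X : Type u} (G : Set (X → ℝ)) (x : X) : ℝ := sInf ((fun f => f x) '' G)

/-- `sup_{f ∈ G} f x`. -/
noncomputable def ucb {X : Type u} (G : Set (X → ℝ)) (x : X) : ℝ := sSup ((fun f => f x) '' G)

/-! ### The algorithm -/

/-- `sgn (2 p - 1)`, as a label. -/
noncomputable def signLabel (p : ℝ) : Bool := decide (1 / 2 ≤ p)

open Classical in
/-- The prediction at a point with confidence interval `[l, r]` at which the empirical minimizer has
the value `p`. -/
noncomputable def predict (γ p l r : ℝ) : Option Bool :=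
  if Set.Icc l r ⊆ Set.Icc (1 / 2 - γ) (1 / 2 + γ) then none else some (signLabel p)

open Classical in
/-- The query rule at such a point. -/
noncomputable def queryRule (γ p l r : ℝ) : Bool :=
  decide (1 / 2 ∈ Set.Ioo l r ∧ predict γ p l r ≠ none)

/-- A routine for confidence bounds: from the radius `β`, the parameter `γ`, the queried points and
a new point it computes, with oracle access, a lower and an upper confidence bound. -/
abbrev BoundRoutine (X : Type u) : Type u :=
  ℝ → ℝ → Sample X → X → OracleProg X (ℝ × ℝ)

/-- One round, at the queried points `B` and the new point `x`: call the oracle for the empirical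
minimizer, compute the confidence bounds at `x`, and return the prediction at `x` and whether the
label of `x` is queried. -/
noncomputable def round {X : Type u} (ci : BoundRoutine X) (β γ : ℝ) (B : Sample X) (x : X) :
    OracleProg X (Option Bool × Bool) :=
  OracleProg.call (unitWeights B) fun fhat =>
    (ci β γ B x).bind fun b =>
      OracleProg.pure (predict γ (fhat x) b.1 b.2, queryRule γ (fhat x) b.1 b.2)

/-- The points queried before round `t` and their labels, on the stream `x 0, y 0, x 1, y 1, …`. -/
noncomputable def queriedSample {X : Type u} (ci : BoundRoutine X) (o : WeightedSample X → X → ℝ)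
    (β γ : ℝ) (x : ℕ → X) (y : ℕ → Bool) : ℕ → Sample X
  | 0 => []
  | t + 1 =>
    if ((round ci β γ (queriedSample ci o β γ x y t) (x t)).run o).2 then
      queriedSample ci o β γ x y t ++ [(x t, y t)]
    else queriedSample ci o β γ x y t

/-- The classifier that is constructed in round `t`. -/
noncomputable def classifier {X : Type u} (ci : BoundRoutine X) (o : WeightedSample X → X → ℝ)
    (β γ : ℝ) (x : ℕ → X) (y : ℕ → Bool) (t : ℕ) (z : X) : Option Bool :=
  ((round ci β γ (queriedSample ci o β γ x y t) z).run o).1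

/-- The number of labels queried in the first `T` rounds. -/
noncomputable def numQueries {X : Type u} (ci : BoundRoutine X) (o : WeightedSample X → X → ℝ)
    (β γ : ℝ) (x : ℕ → X) (y : ℕ → Bool) (T : ℕ) : ℕ :=
  ∑ t ∈ Finset.range T,
    if ((round ci β γ (queriedSample ci o β γ x y t) (x t)).run o).2 then 1 else 0

/-- The number of oracle calls made in the first `T` rounds. -/
noncomputable def numCalls {X : Type u} (ci : BoundRoutine X) (o : WeightedSample X → X → ℝ)
    (β γ : ℝ) (x : ℕ → X) (y : ℕ → Bool) (T : ℕ) : ℕ :=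
  ∑ t ∈ Finset.range T, (round ci β γ (queriedSample ci o β γ x y t) (x t)).calls o

/-- The radius of the active sets for a class of `N` functions and confidence level `δ`. -/
noncomputable def radius (N : ℕ) (δ : ℝ) : ℝ := 1 / 2 * Real.log (2 * N / δ)

/-! ### Value function eluder dimension -/

/-- Each point of the sequence is `ζ`-independent of its predecessors, relative to `fs`. -/
def IsEluderSeq {X : Type u} (F : Set (X → ℝ)) (fs : X → ℝ) (ζ : ℝ) {m : ℕ} (z : Fin m → X) :
    Prop :=
  ∀ i, ∃ f ∈ F, ζ < |f (z i) - fs (z i)| ∧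
    ∑ j ∈ Finset.univ.filter (fun j => j < i), (f (z j) - fs (z j)) ^ 2 ≤ ζ ^ 2

/-- The largest length of such a sequence at the scale `ζ`. -/
noncomputable def eluderAt {X : Type u} (F : Set (X → ℝ)) (fs : X → ℝ) (ζ : ℝ) : ℕ∞ :=
  ⨆ (m : ℕ) (_ : ∃ z : Fin m → X, IsEluderSeq F fs ζ z), (m : ℕ∞)

/-- The value function eluder dimension relative to `fs`: the supremum over the scales `ζ ≥ ζ₀`. -/
noncomputable def eluderDim {X : Type u} (F : Set (X → ℝ)) (fs : X → ℝ) (ζ₀ : ℝ) : ℕ∞ :=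
  ⨆ (ζ : ℝ) (_ : ζ₀ ≤ ζ), eluderAt F fs ζ

/-- The supremum over `fs ∈ F`. -/
noncomputable def eluderSup {X : Type u} (F : Set (X → ℝ)) (ζ₀ : ℝ) : ℕ∞ :=
  ⨆ fs ∈ F, eluderDim F fs ζ₀

theorem eluderAt_le {X : Type u} (F : Set (X → ℝ)) (fs : X → ℝ) {ζ : ℝ} (hζ : 0 < ζ) :
    eluderAt F fs ζ ≤ F.encard := by
  refine iSup_le fun m => iSup_le ?_
  rintro ⟨z, hz⟩
  choose f hF hlt hsum using hz
  have hne : ∀ i j, i < j → f i ≠ f j := by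
    intro i j hij h
    have h1 : (f j (z i) - fs (z i)) ^ 2 ≤ ζ ^ 2 :=
      le_trans (Finset.single_le_sum (f := fun k => (f j (z k) - fs (z k)) ^ 2)
        (fun k _ => sq_nonneg _) (by simp [hij])) (hsum j)
    have h2 := hlt i
    rw [h] at h2
    have h3 := abs_le_of_sq_le_sq h1 hζ.le
    linarith
  have hinj : Function.Injective f := by
    intro i j h
    rcases lt_trichotomy i j with hij | hij | hij
    · exact absurd h (hne i j hij)
    · exact hij
    · exact absurd h.symm (hne j i hij)
  calc (m : ℕ∞) = (Set.range f).encard := by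
        rw [← Set.image_univ, hinj.encard_image, Set.encard_univ]; simp
    _ ≤ F.encard := Set.encard_le_encard (by rintro _ ⟨i, rfl⟩; exact hF i)

/-- For a finite class the eluder dimension is finite, so that passing to `ℕ` loses nothing. -/
theorem eluderSup_ne_top {X : Type u} {F : Set (X → ℝ)} (hF : F.Finite) {ζ₀ : ℝ} (h : 0 < ζ₀) :
    eluderSup F ζ₀ ≠ ⊤ := by
  have : eluderSup F ζ₀ ≤ F.encard :=
    iSup₂_le fun fs _ => iSup₂_le fun ζ hζ => eluderAt_le F fs (lt_of_lt_of_le h hζ)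
  exact ne_top_of_le_ne_top (Set.encard_ne_top_iff.2 hF) this

/-! ### Errors, losses and the two data models -/

/-- Chow's error of a classifier that may abstain. -/
noncomputable def chowError {X : Type u} [MeasurableSpace X] (γ : ℝ) (D : Measure (X × Bool))
    (h : X → Option Bool) : ℝ :=
  D.real {p | h p.1 ≠ some p.2 ∧ h p.1 ≠ none} + (1 / 2 - γ) * D.real {p | h p.1 = none}

/-- The standard error of a classifier. -/
noncomputable def stdError {X : Type u} [MeasurableSpace X] (D : Measure (X × Bool))
    (h : X → Bool) : ℝ :=
  D.real {p | h p.1 ≠ p.2}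

/-- The loss of the action `a` when the label is `y`. -/
noncomputable def chowLoss (γ : ℝ) (a : Option Bool) (y : Bool) : ℝ :=
  match a with
  | none => 1 / 2 - γ
  | some b => if b = y then 0 else 1

/-- `fs x` is the conditional probability of the label `+1` given `x` under `D`. -/
def IsConditionalProb {X : Type u} [MeasurableSpace X] (D : Measure (X × Bool)) (fs : X → ℝ) :
    Prop :=
  ∀ A : Set X, MeasurableSet A →
    D (A ×ˢ {true}) = ∫⁻ x in A, ENNReal.ofReal (fs x) ∂(D.map Prod.fst)

/-- The information `σ(x 0, y 0, …, x (t - 1), y (t - 1), x t)` before the label of round `t`. -/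
abbrev history {Ω : Type w} {X : Type u} [MeasurableSpace X] (x : ℕ → Ω → X) (y : ℕ → Ω → Bool)
    (t : ℕ) : MeasurableSpace Ω :=
  (⨆ i : Fin t, (MeasurableSpace.comap (x i) inferInstance ⊔
    MeasurableSpace.comap (y i) inferInstance)) ⊔ MeasurableSpace.comap (x t) inferInstance

/-- The points are chosen by an adaptive adversary, and given everything before it, the label in
each round is `+1` with probability `fs (x t)`. -/
structure IsAdversarialStream {Ω : Type w} {X : Type u} [MeasurableSpace Ω] [MeasurableSpace X]
    (P : Measure Ω) (fs : X → ℝ) (x : ℕ → Ω → X) (y : ℕ → Ω → Bool) : Prop where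
  measurable_point : ∀ t, Measurable (x t)
  measurable_label : ∀ t, Measurable (y t)
  condExp_label : ∀ t, P[fun ω => labelValue (y t ω) | history x y t] =ᵐ[P] fun ω => fs (x t ω)

/-- The labelled points are independent with distribution `D`. -/
structure IsIIDStream {Ω : Type w} {X : Type u} [MeasurableSpace Ω] [MeasurableSpace X]
    (P : Measure Ω) (D : Measure (X × Bool)) (x : ℕ → Ω → X) (y : ℕ → Ω → Bool) : Prop where
  measurable_point : ∀ t, Measurable (x t)
  measurable_label : ∀ t, Measurable (y t)
  indep : iIndepFun (fun t ω => (x t ω, y t ω)) P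
  law : ∀ t, P.map (fun ω => (x t ω, y t ω)) = D

/-! ### The guarantees -/

/-- The routine implements the confidence bounds of the algorithm for the class `F`. For every
radius and every sample, its interval contains the exact interval `[lcb, ucb]` of the active set,
and it is larger than the interval of the active set of twice the radius by at most `γ / 4` on
either side. -/
def ApproximatesBounds {X : Type u} (F : Set (X → ℝ)) (ci : BoundRoutine X) : Prop :=
  ∀ o, IsRegressionOracle F o → ∀ β γ : ℝ, 0 < β → 0 < γ → γ < 1 / 2 →
    ∀ (B : Sample X) (x : X),
      lcb (activeSet F (o (unitWeights B)) B (2 * β)) x - γ / 4 ≤ ((ci β γ B x).run o).1 ∧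
      ((ci β γ B x).run o).1 ≤ lcb (activeSet F (o (unitWeights B)) B β) x ∧
      ucb (activeSet F (o (unitWeights B)) B β) x ≤ ((ci β γ B x).run o).2 ∧
      ((ci β γ B x).run o).2 ≤ ucb (activeSet F (o (unitWeights B)) B (2 * β)) x + γ / 4

/-- The number of oracle calls is at most `K γ` for each evaluation of a constructed classifier
(and of the query rule) at a point, and at most `T * K γ` for `T` rounds on any data. -/
def CallsBounded {X : Type u} (K : ℝ → ℝ) (F : Set (X → ℝ)) (ci : BoundRoutine X) : Prop :=
  ∀ o, IsRegressionOracle F o → ∀ β γ : ℝ, 0 < β → 0 < γ → γ < 1 / 2 →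
    (∀ (B : Sample X) (z : X), ((round ci β γ B z).calls o : ℝ) ≤ K γ) ∧
    ∀ (x : ℕ → X) (y : ℕ → Bool) (T : ℕ), (numCalls ci o β γ x y T : ℝ) ≤ T * K γ

/-- The number of rounds for accuracy `ε`, for a class of `N` functions with eluder
dimension `e`. -/
noncomputable def horizon (C₀ ε γ δ : ℝ) (N e : ℕ) : ℕ :=
  max 1 ⌈C₀ * (e / (ε * γ) * Real.log (N / δ))⌉₊

/-- Independent data. With probability at least `1 - 2 δ`, a classifier chosen uniformly among those
of the `T` rounds has expected Chow's excess error at most `ε`, and the number of queries is at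
most `C e log (|F| / δ) / γ ^ 2`. Surely, the number of oracle calls is at most
`C max(1, e log (|F| / δ) / (ε γ)) K γ`. -/
def IIDGuarantee {X : Type u} [MeasurableSpace X] (C₀ C : ℝ) (K : ℝ → ℝ) (F : Set (X → ℝ))
    (ci : BoundRoutine X) : Prop :=
  ∀ o, IsRegressionOracle F o → IsMeasurableOracle F o →
  ∀ (Ω : Type w) [MeasurableSpace Ω] (P : Measure Ω) [IsProbabilityMeasure P]
    (D : Measure (X × Bool)) [IsProbabilityMeasure D] (fs : X → ℝ),
    fs ∈ F → IsConditionalProb D fs →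
  ∀ (x : ℕ → Ω → X) (y : ℕ → Ω → Bool), IsIIDStream P D x y →
  ∀ ε γ δ : ℝ, 0 < ε → 0 < γ → γ < 1 / 2 → 0 < δ → δ < 1 →
  ∀ (e β : ℝ) (T : ℕ), e = ((eluderSup F (γ / 4)).toNat : ℝ) → β = radius F.ncard δ →
    T = horizon C₀ ε γ δ F.ncard (eluderSup F (γ / 4)).toNat →
    1 - 2 * δ ≤ P.real {ω |
      (∑ t ∈ Finset.range T,
        (chowError γ D (classifier ci o β γ (fun i => x i ω) (fun i => y i ω) t)
          - stdError D (fun z => signLabel (fs z)))) / T ≤ ε ∧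
      (numQueries ci o β γ (fun i => x i ω) (fun i => y i ω) T : ℝ)
        ≤ C * (e * Real.log (F.ncard / δ) / γ ^ 2)} ∧
    ∀ ω, (numCalls ci o β γ (fun i => x i ω) (fun i => y i ω) T : ℝ)
      ≤ C * max 1 (e / (ε * γ) * Real.log (F.ncard / δ)) * K γ

/-- Adversarial data. For every number `T` of rounds, with probability at least `1 - δ`, the sum of
the conditionally expected regrets is at most `C e log (|F| / δ) / γ` and the number of queries is
at most `C e log (|F| / δ) / γ ^ 2`, where `e` is the eluder dimension relative to `fs`. -/
def AdversarialGuarantee {X : Type u} [MeasurableSpace X] (C : ℝ) (F : Set (X → ℝ))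
    (ci : BoundRoutine X) : Prop :=
  ∀ o, IsRegressionOracle F o → IsMeasurableOracle F o →
  ∀ (Ω : Type w) [MeasurableSpace Ω] (P : Measure Ω) [IsProbabilityMeasure P] (fs : X → ℝ),
    fs ∈ F →
  ∀ (x : ℕ → Ω → X) (y : ℕ → Ω → Bool), IsAdversarialStream P fs x y →
  ∀ γ δ : ℝ, 0 < γ → γ < 1 / 2 → 0 < δ → δ < 1 →
  ∀ (e β : ℝ) (T : ℕ), e = ((eluderDim F fs (γ / 4)).toNat : ℝ) → β = radius F.ncard δ →
    1 - δ ≤ P.real {ω |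
      ∑ t ∈ Finset.range T,
        (P[fun ω' =>
          chowLoss γ (classifier ci o β γ (fun i => x i ω') (fun i => y i ω') t (x t ω')) (y t ω')
            - chowLoss γ (some (signLabel (fs (x t ω')))) (y t ω') | history x y t]) ω
        ≤ C * (e * Real.log (F.ncard / δ) / γ) ∧
      (numQueries ci o β γ (fun i => x i ω) (fun i => y i ω) T : ℝ)
        ≤ C * (e * Real.log (F.ncard / δ) / γ ^ 2)}

end ActiveLearning

/-! The oracle yields confidence bounds because adding a pair of oppositely labelled copies of `x`,
with weights `w * c` and `w * (1 - c)`, adds `w * (f x - c) ^ 2` to the loss up to a constant. With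
`η = γ / 20` and `w = β / η ^ 2`, a probe of `c` succeeds whenever the active set of radius `β` has
a value within `η` of `c`; success exhibits a function in the active set of radius `2 * β` with
value within `2 * η` of `c` (`probeAccepts_of_near`, `ProbeAccepts.exists_near`). A general class is
probed on a grid. For a convex class the values at `x` form an interval, so each end is found by
bisection. Both routines satisfy `SharpBounds`.

Statistically, everything rests on one event, `AccurateSets`: `fs` stays in the active set, and
every function in the active set of radius `2 * β` has squared deviation from `fs` at most `8 * β`
in total over the queried points. An exponential supermartingale, stopped when it reaches the level
`2 * β`, and a union bound over the class give this event probability at least `1 - δ`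
(`measureReal_not_accurateSets_le`).

On that event the argument is deterministic. A round without a query has no positive regret, and a
queried round has a function in the active set of radius `2 * β` whose deviation `d` from `fs`
exceeds `γ / 4`, with regret at most `8 * d` (`regret_round`). The deviating points are distributed
among about `8 * β / ζ ^ 2` eluder sequences, so at most `(8 * β / ζ ^ 2 + 1) * e` deviations exceed
`ζ`. The scale `γ / 4` bounds the queries, and summing over dyadic scales bounds the regret without
a logarithm of the horizon.

For adversarial data the conditional expectation of the loss difference is this regret. Independent
data form a special case, and a second supermartingale bounds the sum of the population regrets by
twice the observed sum plus `2 * log (1 / δ)`. -/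

namespace ActiveLearning

/-! ### Probing a value with the oracle -/

section Probe

variable {X : Type u} {α : Type v}

theorem weightedLoss_cons (f : X → ℝ) (e : ℝ≥0 × X × Bool) (S : WeightedSample X) :
    weightedLoss f (e :: S) = (e.1 : ℝ) * (f e.2.1 - labelValue e.2.2) ^ 2 + weightedLoss f S := by
  simp [weightedLoss]

theorem sqLoss_nil (f : X → ℝ) : sqLoss f [] = 0 := by
  simp [sqLoss, unitWeights, weightedLoss]

theorem sqLoss_eq (f : X → ℝ) (B : Sample X) :
    sqLoss f B = (B.map fun p => (f p.1 - labelValue p.2) ^ 2).sum := by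
  simp [sqLoss, unitWeights, weightedLoss, Function.comp_def]

theorem sqLoss_append (f : X → ℝ) (B B' : Sample X) :
    sqLoss f (B ++ B') = sqLoss f B + sqLoss f B' := by
  simp [sqLoss_eq]

theorem sqLoss_singleton (f : X → ℝ) (p : X × Bool) :
    sqLoss f [p] = (f p.1 - labelValue p.2) ^ 2 := by
  simp [sqLoss_eq]

/-- The sample `B` together with two copies of `x`, weighted so that they penalize the deviation of
`f x` from `c`. -/
noncomputable def probeSample (w : ℝ) (B : Sample X) (x : X) (c : ℝ) : WeightedSample X :=
  (Real.toNNReal (w * c), x, true) :: (Real.toNNReal (w * (1 - c)), x, false) :: unitWeights B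

/-- A label with mean `c` has variance `c * (1 - c)`, so two Boolean labels simulate the fractional
target `c` up to a term that does not depend on `f`. -/
theorem weightedLoss_probeSample {w c : ℝ} (hw : 0 ≤ w) (hc : c ∈ Set.Icc (0 : ℝ) 1)
    (f : X → ℝ) (B : Sample X) (x : X) :
    weightedLoss f (probeSample w B x c) =
      sqLoss f B + w * (f x - c) ^ 2 + w * (c * (1 - c)) := by
  have h1 : 0 ≤ w * c := mul_nonneg hw hc.1
  have h2 : 0 ≤ w * (1 - c) := mul_nonneg hw (by linarith [hc.2])
  simp only [probeSample, weightedLoss_cons, Real.coe_toNNReal _ h1, Real.coe_toNNReal _ h2,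
    labelValue, sqLoss]
  simp
  ring

/-- The answer `g` of the oracle to a probe of the value `c` certifies that `c` is nearly attained
by the active set of radius `2 * β`. -/
def Accepts (β w : ℝ) (B : Sample X) (x : X) (fhat g : X → ℝ) (c : ℝ) : Prop :=
  sqLoss g B + w * (g x - c) ^ 2 ≤ sqLoss fhat B + 2 * β

/-- The value `c` is accepted when the oracle is probed. -/
def ProbeAccepts (o : WeightedSample X → X → ℝ) (β w : ℝ) (B : Sample X) (x : X) (fhat : X → ℝ)
    (c : ℝ) : Prop :=
  Accepts β w B x fhat (o (probeSample w B x c)) c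

theorem IsRegressionOracle.sqLoss_le {F : Set (X → ℝ)} {o : WeightedSample X → X → ℝ}
    (ho : IsRegressionOracle F o) (B : Sample X) {f : X → ℝ} (hf : f ∈ F) :
    sqLoss (o (unitWeights B)) B ≤ sqLoss f B :=
  (ho (unitWeights B)).2 f hf

theorem IsRegressionOracle.mem_activeSet {F : Set (X → ℝ)} {o : WeightedSample X → X → ℝ}
    (ho : IsRegressionOracle F o) (B : Sample X) {β : ℝ} (hβ : 0 ≤ β) :
    o (unitWeights B) ∈ activeSet F (o (unitWeights B)) B β :=
  ⟨(ho _).1, by linarith⟩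

theorem activeSet_mono {F : Set (X → ℝ)} {fhat : X → ℝ} {B : Sample X} {β β' : ℝ} (h : β ≤ β') :
    activeSet F fhat B β ⊆ activeSet F fhat B β' :=
  fun _ hf => ⟨hf.1, by linarith [hf.2]⟩

/-- The answer `g` has loss at least that of the minimizer, so the excess loss and the penalty are
each at most `2 * β`. The penalty then gives a distance of at most `√2 * η`, rounded up to `2 * η`.
-/
theorem ProbeAccepts.exists_near {F : Set (X → ℝ)} {o : WeightedSample X → X → ℝ}
    (ho : IsRegressionOracle F o) {β η : ℝ} (hβ : 0 < β) (hη : 0 < η) {B : Sample X} {x : X} {c : ℝ}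
    (h : ProbeAccepts o β (β / η ^ 2) B x (o (unitWeights B)) c) :
    ∃ g ∈ activeSet F (o (unitWeights B)) B (2 * β), |g x - c| ≤ 2 * η := by
  unfold ProbeAccepts Accepts at h
  set g := o (probeSample (β / η ^ 2) B x c)
  have hg : g ∈ F := (ho _).1
  have hw : 0 < β / η ^ 2 := by positivity
  have h0 := ho.sqLoss_le B hg
  refine ⟨g, ⟨hg, by nlinarith [mul_nonneg hw.le (sq_nonneg (g x - c))]⟩, ?_⟩
  have h1 : β / η ^ 2 * (g x - c) ^ 2 ≤ 2 * β := by linarith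
  have h2 : (g x - c) ^ 2 ≤ 2 * η ^ 2 := by
    rw [div_mul_eq_mul_div, div_le_iff₀ (by positivity)] at h1
    nlinarith
  refine abs_le_of_sq_le_sq ?_ (by positivity)
  nlinarith [sq_nonneg η]

/-- The function `f` spends at most `β` on excess loss and at most `β` on the penalty, and the
oracle's answer to the probe costs no more than `f`. -/
theorem probeAccepts_of_near {F : Set (X → ℝ)} {o : WeightedSample X → X → ℝ}
    (ho : IsRegressionOracle F o) {β η : ℝ} (hβ : 0 < β) (hη : 0 < η) {B : Sample X} {x : X} {c : ℝ}
    (hc : c ∈ Set.Icc (0 : ℝ) 1) {f : X → ℝ} (hf : f ∈ activeSet F (o (unitWeights B)) B β)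
    (hfc : |f x - c| ≤ η) :
    ProbeAccepts o β (β / η ^ 2) B x (o (unitWeights B)) c := by
  unfold ProbeAccepts Accepts
  have hw : 0 < β / η ^ 2 := by positivity
  have h1 := (ho (probeSample (β / η ^ 2) B x c)).2 f hf.1
  rw [weightedLoss_probeSample hw.le hc, weightedLoss_probeSample hw.le hc] at h1
  have h2 : (f x - c) ^ 2 ≤ η ^ 2 := sq_le_sq' (by linarith [neg_abs_le (f x - c)])
    (le_trans (le_abs_self _) hfc)
  have h3 : β / η ^ 2 * (f x - c) ^ 2 ≤ β := by
    calc β / η ^ 2 * (f x - c) ^ 2 ≤ β / η ^ 2 * η ^ 2 := by gcongr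
      _ = β := by field_simp
  linarith [hf.2]

/-! ### Two routines for confidence bounds -/

open Classical in
/-- Probe every value of a list, and enlarge the interval so that it contains the `ρ`-neighbourhood
of each accepted value. -/
noncomputable def scan (β w ρ : ℝ) (B : Sample X) (x : X) (fhat : X → ℝ) :
    List ℝ → ℝ × ℝ → OracleProg X (ℝ × ℝ)
  | [], I => .pure I
  | c :: cs, I => .call (probeSample w B x c) fun g =>
      scan β w ρ B x fhat cs
        (if Accepts β w B x fhat g c then (min I.1 (c - ρ), max I.2 (c + ρ)) else I)

open Classical in
/-- The interval that `scan` computes when the accepted values are those with the property `t`. -/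
noncomputable def scanVal (t : ℝ → Prop) (ρ : ℝ) : List ℝ → ℝ × ℝ → ℝ × ℝ
  | [], I => I
  | c :: cs, I => scanVal t ρ cs (if t c then (min I.1 (c - ρ), max I.2 (c + ρ)) else I)

theorem run_scan (o : WeightedSample X → X → ℝ) (β w ρ : ℝ) (B : Sample X) (x : X) (fhat : X → ℝ)
    (cs : List ℝ) (I : ℝ × ℝ) :
    (scan β w ρ B x fhat cs I).run o = scanVal (ProbeAccepts o β w B x fhat) ρ cs I := by
  induction cs generalizing I with
  | nil => rfl
  | cons c cs ih => simp only [scan, scanVal, OracleProg.run, ih]; rfl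

theorem calls_scan (o : WeightedSample X → X → ℝ) (β w ρ : ℝ) (B : Sample X) (x : X) (fhat : X → ℝ)
    (cs : List ℝ) (I : ℝ × ℝ) :
    (scan β w ρ B x fhat cs I).calls o = cs.length := by
  induction cs generalizing I with
  | nil => rfl
  | cons c cs ih => simp only [scan, OracleProg.calls, ih, List.length_cons]

theorem scanVal_subset (t : ℝ → Prop) (ρ : ℝ) (cs : List ℝ) (I : ℝ × ℝ) :
    (scanVal t ρ cs I).1 ≤ I.1 ∧ I.2 ≤ (scanVal t ρ cs I).2 := by
  induction cs generalizing I with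
  | nil => exact ⟨le_rfl, le_rfl⟩
  | cons c cs ih =>
    simp only [scanVal]
    split_ifs
    · have h := ih (min I.1 (c - ρ), max I.2 (c + ρ))
      exact ⟨h.1.trans (min_le_left _ _), (le_max_left _ _).trans h.2⟩
    · exact ih _

theorem scanVal_contains {t : ℝ → Prop} (ρ : ℝ) {cs : List ℝ} (I : ℝ × ℝ) {c : ℝ} (hc : c ∈ cs)
    (ht : t c) : (scanVal t ρ cs I).1 ≤ c - ρ ∧ c + ρ ≤ (scanVal t ρ cs I).2 := by
  induction cs generalizing I with
  | nil => simp at hc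
  | cons d cs ih =>
    rcases List.mem_cons.1 hc with rfl | hc
    · simp only [scanVal, if_pos ht]
      have := scanVal_subset t ρ cs (min I.1 (c - ρ), max I.2 (c + ρ))
      exact ⟨this.1.trans (min_le_right _ _), (le_max_right _ _).trans this.2⟩
    · exact ih _ hc

/-- A minimum or maximum is one of its arguments, so each end of the interval stems either from the
initial interval or from a single accepted value. -/
theorem scanVal_induction {t : ℝ → Prop} {ρ : ℝ} {p q : ℝ → Prop} {cs : List ℝ} {I : ℝ × ℝ}
    (hp : p I.1) (hq : q I.2) (h : ∀ c, t c → p (c - ρ) ∧ q (c + ρ)) :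
    p (scanVal t ρ cs I).1 ∧ q (scanVal t ρ cs I).2 := by
  induction cs generalizing I with
  | nil => exact ⟨hp, hq⟩
  | cons c cs ih =>
    simp only [scanVal]
    split_ifs with hc
    · refine ih ?_ ?_
      · rcases min_choice I.1 (c - ρ) with h' | h' <;> rw [h']
        exacts [hp, (h c hc).1]
      · rcases max_choice I.2 (c + ρ) with h' | h' <;> rw [h']
        exacts [hq, (h c hc).2]
    · exact ih hp hq

open Classical in
/-- Bisection between an accepted value `a` and a value `b`, followed by `k`. -/
noncomputable def bisect (β w : ℝ) (B : Sample X) (x : X) (fhat : X → ℝ) :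
    ℕ → ℝ → ℝ → (ℝ → OracleProg X α) → OracleProg X α
  | 0, _, b, k => k b
  | n + 1, a, b, k => .call (probeSample w B x ((a + b) / 2)) fun g =>
      if Accepts β w B x fhat g ((a + b) / 2) then bisect β w B x fhat n ((a + b) / 2) b k
      else bisect β w B x fhat n a ((a + b) / 2) k

open Classical in
/-- The result of `n` steps of bisection when the accepted values are those with the
property `t`. -/
noncomputable def bisectVal (t : ℝ → Prop) : ℕ → ℝ → ℝ → ℝ
  | 0, _, b => b
  | n + 1, a, b =>
      if t ((a + b) / 2) then bisectVal t n ((a + b) / 2) b else bisectVal t n a ((a + b) / 2)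

theorem run_bisect (o : WeightedSample X → X → ℝ) (β w : ℝ) (B : Sample X) (x : X) (fhat : X → ℝ)
    (n : ℕ) (a b : ℝ) (k : ℝ → OracleProg X α) :
    (bisect β w B x fhat n a b k).run o =
      (k (bisectVal (ProbeAccepts o β w B x fhat) n a b)).run o := by
  induction n generalizing a b with
  | zero => rfl
  | succ n ih =>
    by_cases h : ProbeAccepts o β w B x fhat ((a + b) / 2)
    · have h' := h
      unfold ProbeAccepts at h'
      simp only [bisect, bisectVal, OracleProg.run, if_pos h, if_pos h', ih]
    · have h' := h
      unfold ProbeAccepts at h'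
      simp only [bisect, bisectVal, OracleProg.run, if_neg h, if_neg h', ih]

theorem calls_bisect (o : WeightedSample X → X → ℝ) (β w : ℝ) (B : Sample X) (x : X)
    (fhat : X → ℝ) (n : ℕ) (a b : ℝ) (k : ℝ → OracleProg X α) :
    (bisect β w B x fhat n a b k).calls o =
      n + (k (bisectVal (ProbeAccepts o β w B x fhat) n a b)).calls o := by
  induction n generalizing a b with
  | zero => simp [bisect, bisectVal]
  | succ n ih =>
    by_cases h : ProbeAccepts o β w B x fhat ((a + b) / 2)
    · have h' := h
      unfold ProbeAccepts at h'
      simp only [bisect, bisectVal, OracleProg.calls, if_pos h, if_pos h', ih]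
      omega
    · have h' := h
      unfold ProbeAccepts at h'
      simp only [bisect, bisectVal, OracleProg.calls, if_neg h, if_neg h', ih]
      omega

/-- The result of a bisection between `a` and `b` is close to a value with the property `r`, if `a`
and all accepted values have it, and it keeps each property of `b` that rejected values
beyond `a` have. The sign `σ` is that of `b - a`. -/
theorem bisectVal_spec {t : ℝ → Prop} {σ : ℝ} {r s : ℝ → Prop} {a₀ b₀ : ℝ}
    (hr : ∀ c, t c → r c)
    (hs : ∀ c, σ * a₀ ≤ σ * c → σ * c ≤ σ * b₀ → ¬ t c → s c)
    (n : ℕ) {a b : ℝ} (ha₀ : σ * a₀ ≤ σ * a) (hb₀ : σ * b ≤ σ * b₀) (hab : σ * a ≤ σ * b)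
    (ha : r a) (hb : s b) :
    s (bisectVal t n a b) ∧
      ∃ c, r c ∧ σ * (bisectVal t n a b - c) ≤ σ * (b - a) / 2 ^ n := by
  induction n generalizing a b with
  | zero => exact ⟨hb, a, ha, by simp [bisectVal]⟩
  | succ n ih =>
    simp only [bisectVal]
    split_ifs with h
    · obtain ⟨h1, c, hc, h2⟩ := ih (a := (a + b) / 2) (b := b) (by linarith) hb₀ (by linarith)
        (hr _ h) hb
      refine ⟨h1, c, hc, h2.trans (le_of_eq ?_)⟩
      rw [pow_succ]; field_simp; ring
    · obtain ⟨h1, c, hc, h2⟩ := ih (a := a) (b := (a + b) / 2) ha₀ (by linarith) (by linarith)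
        ha (hs _ (by linarith) (by linarith) h)
      refine ⟨h1, c, hc, h2.trans (le_of_eq ?_)⟩
      rw [pow_succ]; field_simp; ring

/-- Confidence bounds for a general class: scan an equidistant grid of `[0, 1]`. -/
noncomputable def gridRoutine (X : Type u) : BoundRoutine X := fun β γ B x =>
  .call (unitWeights B) fun fhat =>
    -- With `η = γ / 20`, the grid spacing is at most `η` and the enlargement is `2 * η`. The
    -- minimizer's own neighbourhood initializes the interval.
    scan β (β / (γ / 20) ^ 2) (γ / 10) B x fhat
      ((List.range (⌈20 / γ⌉₊ + 1)).map fun i : ℕ => (i : ℝ) / ⌈20 / γ⌉₊)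
      (fhat x - γ / 10, fhat x + γ / 10)

/-- The number of bisection steps that reach the precision `γ / 20`. -/
noncomputable def bisectionSteps (γ : ℝ) : ℕ := ⌈Real.log (20 / γ) / Real.log 2⌉₊

/-- Confidence bounds for a convex class: bisect above and below the empirical minimizer. -/
noncomputable def bisectionRoutine (X : Type u) : BoundRoutine X := fun β γ B x =>
  .call (unitWeights B) fun fhat =>
    bisect β (β / (γ / 20) ^ 2) B x fhat (bisectionSteps γ) (fhat x) 0 fun l =>
      bisect β (β / (γ / 20) ^ 2) B x fhat (bisectionSteps γ) (fhat x) 1 fun u =>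
        -- Bisection gives non-strict bounds; the margin makes them strict.
        .pure (l - γ / 20, u + γ / 20)

/-- The computed interval contains the values of the active set in its interior, and each of its
ends is within `γ / 4` of a value of the active set of twice the radius, or inside its range. -/
def SharpBounds (F : Set (X → ℝ)) (ci : BoundRoutine X) : Prop :=
  ∀ o, IsRegressionOracle F o → ∀ β γ : ℝ, 0 < β → 0 < γ → γ < 1 / 2 →
    ∀ (B : Sample X) (x : X),
      (∀ f ∈ activeSet F (o (unitWeights B)) B β,
        ((ci β γ B x).run o).1 < f x ∧ f x < ((ci β γ B x).run o).2) ∧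
      (∃ g ∈ activeSet F (o (unitWeights B)) B (2 * β), g x - γ / 4 ≤ ((ci β γ B x).run o).1) ∧
      ∃ g ∈ activeSet F (o (unitWeights B)) B (2 * β), ((ci β γ B x).run o).2 ≤ g x + γ / 4

/-- `SharpBounds` carries more than this conclusion: strict containment decides signs when `1 / 2`
is an end of the interval, and the witnesses supply actual functions for the eluder argument even
when an infimum or supremum is not attained. -/
theorem SharpBounds.approximatesBounds {F : Set (X → ℝ)} {ci : BoundRoutine X}
    (hF : ∀ f ∈ F, ∀ x, f x ∈ Set.Icc (0 : ℝ) 1) (h : SharpBounds F ci) :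
    ApproximatesBounds F ci := by
  intro o ho β γ hβ hγ hγ' B x
  obtain ⟨h1, ⟨g, hg, h2⟩, g', hg', h3⟩ := h o ho β γ hβ hγ hγ' B x
  have hne : ((fun f : X → ℝ => f x) '' activeSet F (o (unitWeights B)) B β).Nonempty :=
    ⟨_, _, ho.mem_activeSet B hβ.le, rfl⟩
  have hbb : BddBelow ((fun f : X → ℝ => f x) '' activeSet F (o (unitWeights B)) B (2 * β)) :=
    ⟨0, by rintro _ ⟨f, hf, rfl⟩; exact (hF f hf.1 x).1⟩
  have hba : BddAbove ((fun f : X → ℝ => f x) '' activeSet F (o (unitWeights B)) B (2 * β)) :=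
    ⟨1, by rintro _ ⟨f, hf, rfl⟩; exact (hF f hf.1 x).2⟩
  refine ⟨?_, le_csInf hne ?_, csSup_le hne ?_, ?_⟩
  · have := csInf_le hbb ⟨g, hg, rfl⟩
    unfold lcb
    linarith
  · rintro _ ⟨f, hf, rfl⟩
    exact (h1 f hf).1.le
  · rintro _ ⟨f, hf, rfl⟩
    exact (h1 f hf).2.le
  · have := le_csSup hba ⟨g', hg', rfl⟩
    unfold ucb
    linarith

theorem run_gridRoutine (o : WeightedSample X → X → ℝ) (β γ : ℝ) (B : Sample X) (x : X) :
    (gridRoutine X β γ B x).run o =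
      scanVal (ProbeAccepts o β (β / (γ / 20) ^ 2) B x (o (unitWeights B))) (γ / 10)
        ((List.range (⌈20 / γ⌉₊ + 1)).map fun i : ℕ => (i : ℝ) / ⌈20 / γ⌉₊)
        (o (unitWeights B) x - γ / 10, o (unitWeights B) x + γ / 10) := by
  simp only [gridRoutine, OracleProg.run, run_scan]

theorem sharpBounds_gridRoutine {F : Set (X → ℝ)} (hF : ∀ f ∈ F, ∀ x, f x ∈ Set.Icc (0 : ℝ) 1) :
    SharpBounds F (gridRoutine X) := by
  intro o ho β γ hβ hγ hγ' B x
  rw [run_gridRoutine]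
  have hfhat := ho.mem_activeSet B (β := 2 * β) (by positivity)
  refine ⟨fun f hf => ?_, ?_⟩
  · set n := ⌈20 / γ⌉₊ with hn
    have hnγ : 20 / γ ≤ n := Nat.le_ceil _
    have hn0 : (0 : ℝ) < n := lt_of_lt_of_le (by positivity) hnγ
    have hf0 := (hF f hf.1 x).1
    have hf1 := (hF f hf.1 x).2
    -- The grid point just below `f x` is within `γ / 20`, so it is accepted, and its `γ /
    -- 10`-neighbourhood contains `f x` strictly.
    have hi1 : (⌊f x * n⌋₊ : ℝ) ≤ f x * n := Nat.floor_le (by positivity)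
    have hi2 : f x * n < ⌊f x * n⌋₊ + 1 := Nat.lt_floor_add_one _
    have hin : (⌊f x * n⌋₊ : ℝ) ≤ n := by nlinarith
    have hc1 : (⌊f x * n⌋₊ : ℝ) / n ≤ f x := by rwa [div_le_iff₀ hn0]
    have hc2 : f x ≤ (⌊f x * n⌋₊ : ℝ) / n + γ / 20 := by
      have h1 : f x * n / n ≤ (⌊f x * n⌋₊ + 1) / n := by gcongr
      have h2 : 1 / (n : ℝ) ≤ γ / 20 := by
        rw [div_le_iff₀ hγ] at hnγ
        rw [div_le_div_iff₀ hn0 (by norm_num)]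
        linarith
      rw [mul_div_cancel_right₀ _ hn0.ne', add_div] at h1
      linarith
    have ht := probeAccepts_of_near ho hβ (η := γ / 20) (by positivity) (x := x)
      (c := (⌊f x * n⌋₊ : ℝ) / n) ⟨by positivity, by linarith⟩ hf
      (abs_le.2 ⟨by linarith, by linarith⟩)
    have hmem : (⌊f x * n⌋₊ : ℝ) / n ∈ (List.range (n + 1)).map fun i : ℕ => (i : ℝ) / n :=
      List.mem_map.2 ⟨⌊f x * n⌋₊, List.mem_range.2 (Nat.lt_succ_of_le (by exact_mod_cast hin)), rfl⟩
    have h := scanVal_contains (γ / 10)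
      (o (unitWeights B) x - γ / 10, o (unitWeights B) x + γ / 10) hmem ht
    exact ⟨by linarith [h.1], by linarith [h.2]⟩
  · refine scanVal_induction
      (p := fun l => ∃ g ∈ activeSet F (o (unitWeights B)) B (2 * β), g x - γ / 4 ≤ l)
      (q := fun u => ∃ g ∈ activeSet F (o (unitWeights B)) B (2 * β), u ≤ g x + γ / 4)
      ⟨_, hfhat, by dsimp only; linarith⟩ ⟨_, hfhat, by dsimp only; linarith⟩ fun c hc => ?_
    -- The value `g x` is within `2 * (γ / 20)` of `c`, and the end is `γ / 10` beyond `c`: together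
    -- `γ / 5`, below the tolerance `γ / 4`.
    obtain ⟨g, hg, hgc⟩ := hc.exists_near ho hβ (by positivity)
    rw [abs_le] at hgc
    exact ⟨⟨g, hg, by linarith⟩, ⟨g, hg, by linarith⟩⟩

theorem run_bisectionRoutine (o : WeightedSample X → X → ℝ) (β γ : ℝ) (B : Sample X) (x : X) :
    (bisectionRoutine X β γ B x).run o =
      (bisectVal (ProbeAccepts o β (β / (γ / 20) ^ 2) B x (o (unitWeights B))) (bisectionSteps γ)
          (o (unitWeights B) x) 0 - γ / 20,
        bisectVal (ProbeAccepts o β (β / (γ / 20) ^ 2) B x (o (unitWeights B))) (bisectionSteps γ)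
          (o (unitWeights B) x) 1 + γ / 20) := by
  simp only [bisectionRoutine, OracleProg.run, run_bisect]

theorem inv_two_pow_bisectionSteps_le {γ : ℝ} (hγ : 0 < γ) :
    1 / 2 ^ bisectionSteps γ ≤ γ / 20 := by
  have h1 : Real.log (20 / γ) / Real.log 2 ≤ bisectionSteps γ := Nat.le_ceil _
  have h2 : (0 : ℝ) < Real.log 2 := Real.log_pos one_lt_two
  rw [div_le_iff₀ h2, ← Real.log_pow] at h1
  have h3 := (Real.log_le_log_iff (by positivity) (by positivity)).1 h1
  rw [div_le_iff₀ hγ] at h3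
  rw [div_le_div_iff₀ (by positivity) (by norm_num)]
  linarith

theorem sqLoss_convex (B : Sample X) (f g : X → ℝ) {a b : ℝ} (ha : 0 ≤ a) (hb : 0 ≤ b)
    (hab : a + b = 1) : sqLoss (a • f + b • g) B ≤ a * sqLoss f B + b * sqLoss g B := by
  induction B with
  | nil => simp [sqLoss_nil]
  | cons p B ih =>
    have hcons : ∀ h : X → ℝ, sqLoss h (p :: B) = (h p.1 - labelValue p.2) ^ 2 + sqLoss h B := by
      intro h; simp [sqLoss_eq]
    rw [hcons, hcons, hcons]
    have h1 : ((a • f + b • g) p.1 - labelValue p.2) ^ 2 ≤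
        a * (f p.1 - labelValue p.2) ^ 2 + b * (g p.1 - labelValue p.2) ^ 2 := by
      obtain rfl : b = 1 - a := by linarith
      simp only [Pi.add_apply, Pi.smul_apply, smul_eq_mul]
      nlinarith [mul_nonneg (mul_nonneg ha hb) (sq_nonneg (f p.1 - g p.1))]
    linarith

theorem convex_activeSet {F : Set (X → ℝ)} (hF : Convex ℝ F) (fhat : X → ℝ) (B : Sample X)
    (β : ℝ) : Convex ℝ (activeSet F fhat B β) := by
  intro f hf g hg a b ha hb hab
  refine ⟨hF hf.1 hg.1 ha hb hab, (sqLoss_convex B f g ha hb hab).trans ?_⟩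
  calc a * sqLoss f B + b * sqLoss g B
      ≤ a * (sqLoss fhat B + β) + b * (sqLoss fhat B + β) := by
        gcongr
        exacts [hf.2, hg.2]
    _ = sqLoss fhat B + β := by rw [← add_mul, hab, one_mul]

/-- One end of the interval computed by bisection, the upper one for `σ = 1` and the lower one
for `σ = -1`. -/
theorem bisectVal_probe {F : Set (X → ℝ)} (hF : ∀ f ∈ F, ∀ x, f x ∈ Set.Icc (0 : ℝ) 1)
    (hconv : Convex ℝ F) {o : WeightedSample X → X → ℝ} (ho : IsRegressionOracle F o) {β γ : ℝ}
    (hβ : 0 < β) (hγ : 0 < γ) (B : Sample X) (x : X) {σ b : ℝ} (hσ : σ = 1 ∨ σ = -1)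
    (hb : b ∈ Set.Icc (0 : ℝ) 1) (hσb : ∀ v ∈ Set.Icc (0 : ℝ) 1, σ * v ≤ σ * b) :
    (∀ f ∈ activeSet F (o (unitWeights B)) B β,
      σ * f x ≤ σ * bisectVal (ProbeAccepts o β (β / (γ / 20) ^ 2) B x (o (unitWeights B)))
        (bisectionSteps γ) (o (unitWeights B) x) b) ∧
    ∃ g ∈ activeSet F (o (unitWeights B)) B (2 * β),
      σ * (bisectVal (ProbeAccepts o β (β / (γ / 20) ^ 2) B x (o (unitWeights B)))
        (bisectionSteps γ) (o (unitWeights B) x) b - g x) ≤ 3 * (γ / 20) := by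
  have hη : 0 < γ / 20 := by positivity
  have hσσ : σ * σ = 1 := by rcases hσ with rfl | rfl <;> norm_num
  have hv := hF _ (ho (unitWeights B)).1 x
  have hfhat := ho.mem_activeSet B hβ.le
  obtain ⟨h1, c, ⟨g, hg, hgc⟩, h2⟩ := bisectVal_spec (σ := σ)
    (t := ProbeAccepts o β (β / (γ / 20) ^ 2) B x (o (unitWeights B)))
    (r := fun c => ∃ g ∈ activeSet F (o (unitWeights B)) B (2 * β), |g x - c| ≤ 2 * (γ / 20))
    (s := fun c => ∀ f ∈ activeSet F (o (unitWeights B)) B β, σ * f x ≤ σ * c)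
    (a₀ := o (unitWeights B) x) (b₀ := b) (fun c hc => hc.exists_near ho hβ hη) (by
      intro c hc hc' ht f hf
      -- A rejected `c` that fails to bound some `f x` would lie between the values of the minimizer
      -- and of `f`. By convexity it would be the value of an active function, and its probe would
      -- succeed. Acceptance itself need not be monotone in `c`.
      by_contra! hlt
      apply ht
      have hmem : c ∈ (fun h : X → ℝ => h x) '' activeSet F (o (unitWeights B)) B β := by
        have hcv : Convex ℝ ((fun h : X → ℝ => h x) '' activeSet F (o (unitWeights B)) B β) :=
          (convex_activeSet hconv _ B β).linear_image (LinearMap.proj (R := ℝ) x)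
        have hord := hcv.ordConnected
        rcases hσ with rfl | rfl
        · exact hord.out ⟨_, hfhat, rfl⟩ ⟨f, hf, rfl⟩ ⟨by dsimp only; linarith, by dsimp only; linarith⟩
        · exact hord.out ⟨f, hf, rfl⟩ ⟨_, hfhat, rfl⟩ ⟨by dsimp only; linarith, by dsimp only; linarith⟩
      obtain ⟨h, hh, rfl⟩ := hmem
      exact probeAccepts_of_near ho hβ hη (hF h hh.1 x) hh (by simpa using hη.le))
    (bisectionSteps γ) le_rfl le_rfl (hσb _ hv)
    ⟨_, activeSet_mono (by linarith) hfhat, by simpa using hη.le⟩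
    (fun f hf => hσb _ (hF f hf.1 x))
  refine ⟨h1, g, hg, ?_⟩
  have h3 : σ * (b - o (unitWeights B) x) / 2 ^ bisectionSteps γ ≤ γ / 20 := by
    refine le_trans ?_ (inv_two_pow_bisectionSteps_le hγ)
    gcongr
    rcases hσ with rfl | rfl
    · linarith [hv.1, hb.2]
    · linarith [hv.2, hb.1]
  -- The end is within `γ / 20` of a value `c` that is itself within `2 * (γ / 20)` of `g x`, which
  -- explains the factor `3`.
  rw [abs_le] at hgc
  rcases hσ with rfl | rfl <;> linarith

theorem sharpBounds_bisectionRoutine {F : Set (X → ℝ)}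
    (hF : ∀ f ∈ F, ∀ x, f x ∈ Set.Icc (0 : ℝ) 1) (hconv : Convex ℝ F) :
    SharpBounds F (bisectionRoutine X) := by
  intro o ho β γ hβ hγ hγ' B x
  rw [run_bisectionRoutine]
  obtain ⟨hl, g, hg, hgl⟩ := bisectVal_probe hF hconv ho hβ hγ B x (σ := -1) (b := 0) (Or.inr rfl)
    (by simp) (fun v hv => by linarith [hv.1])
  obtain ⟨hu, g', hg', hgu⟩ := bisectVal_probe hF hconv ho hβ hγ B x (σ := 1) (b := 1) (Or.inl rfl)
    (by simp) (fun v hv => by linarith [hv.2])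
  refine ⟨fun f hf => ⟨?_, ?_⟩, ⟨g, hg, ?_⟩, g', hg', ?_⟩
  · linarith [hl f hf]
  · linarith [hu f hf]
  · dsimp only; linarith
  · dsimp only; linarith

/-! ### Oracle complexity -/

theorem OracleProg.calls_bind_pure {α' : Type w} (o : WeightedSample X → X → ℝ) (p : OracleProg X α)
    (g : α → α') : (p.bind fun a => .pure (g a)).calls o = p.calls o := by
  induction p with
  | pure a => rfl
  | call S k ih => simp only [OracleProg.bind, OracleProg.calls, ih]

theorem OracleProg.run_bind_pure {α' : Type w} (o : WeightedSample X → X → ℝ) (p : OracleProg X α)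
    (g : α → α') : (p.bind fun a => .pure (g a)).run o = g (p.run o) := by
  induction p with
  | pure a => rfl
  | call S k ih => simp only [OracleProg.bind, OracleProg.run, ih]

theorem calls_round (ci : BoundRoutine X) (o : WeightedSample X → X → ℝ) (β γ : ℝ) (B : Sample X)
    (x : X) : (round ci β γ B x).calls o = (ci β γ B x).calls o + 1 := by
  simp only [round, OracleProg.calls, OracleProg.calls_bind_pure]

theorem run_round (ci : BoundRoutine X) (o : WeightedSample X → X → ℝ) (β γ : ℝ) (B : Sample X)
    (x : X) : (round ci β γ B x).run o =
      (predict γ (o (unitWeights B) x) ((ci β γ B x).run o).1 ((ci β γ B x).run o).2,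
        queryRule γ (o (unitWeights B) x) ((ci β γ B x).run o).1 ((ci β γ B x).run o).2) := by
  simp only [round, OracleProg.run, OracleProg.run_bind_pure]

theorem callsBounded_of_round {K : ℝ → ℝ} {F : Set (X → ℝ)} {ci : BoundRoutine X}
    (h : ∀ o β γ, 0 < γ → γ < 1 / 2 → ∀ B z, ((round ci β γ B z).calls o : ℝ) ≤ K γ) :
    CallsBounded K F ci := by
  intro o _ β γ _ hγ hγ'
  refine ⟨h o β γ hγ hγ', fun x y T => ?_⟩
  rw [numCalls, Nat.cast_sum]
  calc _ ≤ ∑ _t ∈ Finset.range T, K γ := Finset.sum_le_sum fun t _ => h o β γ hγ hγ' _ _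
    _ = T * K γ := by simp

theorem log_two_le_log_one_div {γ : ℝ} (hγ : 0 < γ) (hγ' : γ < 1 / 2) :
    Real.log 2 ≤ Real.log (1 / γ) := by
  apply Real.log_le_log two_pos
  rw [le_div_iff₀ hγ]
  linarith

theorem callsBounded_gridRoutine (F : Set (X → ℝ)) {C : ℝ} (hC : 50 ≤ C) :
    CallsBounded (fun γ => C * (1 / γ ^ 2 * Real.log (1 / γ))) F (gridRoutine X) := by
  refine callsBounded_of_round fun o β γ hγ hγ' B z => ?_
  have hlog : 1 / 2 ≤ Real.log (1 / γ) := by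
    linarith [log_two_le_log_one_div hγ hγ', Real.log_two_gt_d9]
  have hinv : 2 ≤ 1 / γ := by rw [le_div_iff₀ hγ]; linarith
  -- Besides `⌈20 / γ⌉₊` probes there are the extra grid end point and two calls for the empirical
  -- minimizer, one in `round` and one in the routine. The count is only of order `1 / γ`, well
  -- within the claimed bound.
  have hcalls : (round (gridRoutine X) β γ B z).calls o = ⌈20 / γ⌉₊ + 3 := by
    simp [calls_round, gridRoutine, OracleProg.calls, calls_scan]
  have hceil : (⌈20 / γ⌉₊ : ℝ) < 20 / γ + 1 := Nat.ceil_lt_add_one (by positivity)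
  have h1 : (25 : ℝ) ≤ C * Real.log (1 / γ) := by nlinarith
  have h2 : 20 / γ = 20 * (1 / γ) := by ring
  rw [hcalls]
  push_cast
  calc (⌈20 / γ⌉₊ : ℝ) + 3 ≤ 25 * (1 / γ) ^ 2 := by nlinarith
    _ ≤ C * Real.log (1 / γ) * (1 / γ) ^ 2 := by gcongr
    _ = _ := by ring

theorem callsBounded_bisectionRoutine (F : Set (X → ℝ)) {C : ℝ} (hC : 50 ≤ C) :
    CallsBounded (fun γ => C * Real.log (1 / γ)) F (bisectionRoutine X) := by
  refine callsBounded_of_round fun o β γ hγ hγ' B z => ?_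
  have h2 := Real.log_two_gt_d9
  have hlog := log_two_le_log_one_div hγ hγ'
  have hcalls : (round (bisectionRoutine X) β γ B z).calls o = 2 * bisectionSteps γ + 2 := by
    simp only [calls_round, bisectionRoutine, OracleProg.calls, calls_bisect]
    omega
  have h20 : Real.log (20 / γ) ≤ 6 * Real.log (1 / γ) := by
    -- Since `20 ≤ 2 ^ 5` and `log 2 ≤ log (1 / γ)`, the constant `20` costs five further copies of
    -- `log (1 / γ)`.
    have h32 : Real.log 20 ≤ 5 * Real.log 2 := by
      rw [show (5 : ℝ) = ((5 : ℕ) : ℝ) by norm_num, ← Real.log_pow]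
      exact Real.log_le_log (by norm_num) (by norm_num)
    rw [show 20 / γ = 20 * (1 / γ) by ring, Real.log_mul (by norm_num) (by positivity)]
    linarith
  have h0 : 0 ≤ Real.log (20 / γ) := Real.log_nonneg (by rw [le_div_iff₀ hγ]; linarith)
  have hceil : (bisectionSteps γ : ℝ) < Real.log (20 / γ) / Real.log 2 + 1 :=
    Nat.ceil_lt_add_one (by positivity)
  have h4 : Real.log (20 / γ) / Real.log 2 ≤ 12 * Real.log (1 / γ) := by
    rw [div_le_iff₀ (by linarith)]
    nlinarith
  rw [hcalls]
  push_cast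
  nlinarith

/-! ### Samples and rounds in coordinates -/

theorem sqLoss_ofFn {n : ℕ} (f : X → ℝ) (s : Fin n → X × Bool) :
    sqLoss f (List.ofFn s) = ∑ i, (f (s i).1 - labelValue (s i).2) ^ 2 := by
  simp [sqLoss_eq, List.map_ofFn, List.sum_ofFn]

theorem unitWeights_ofFn {n : ℕ} (s : Fin n → X × Bool) :
    unitWeights (List.ofFn s) = List.ofFn fun i => (1, (s i).1, (s i).2) := by
  simp [unitWeights, List.map_ofFn, Function.comp_def]

theorem probeSample_ofFn {n : ℕ} (w : ℝ) (s : Fin n → X × Bool) (x : X) (c : ℝ) :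
    probeSample w (List.ofFn s) x c =
      List.ofFn (Fin.cons (Real.toNNReal (w * c), x, true)
        (Fin.cons (Real.toNNReal (w * (1 - c)), x, false) fun i => (1, (s i).1, (s i).2))
          : Fin (n + 1 + 1) → ℝ≥0 × X × Bool) := by
  simp only [probeSample, unitWeights_ofFn, List.ofFn_cons]

theorem predict_eq_none_iff {γ p l r : ℝ} :
    predict γ p l r = none ↔ r < l ∨ (1 / 2 - γ ≤ l ∧ r ≤ 1 / 2 + γ) := by
  unfold predict
  rcases lt_or_ge r l with h | h
  · simp [h]
  · rw [Set.Icc_subset_Icc_iff h]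
    simp [not_lt.2 h]

theorem predict_of_ne_none {γ p l r : ℝ} (h : predict γ p l r ≠ none) :
    predict γ p l r = some (signLabel p) := by
  unfold predict at h ⊢
  split_ifs at h ⊢ <;> simp_all

/-- The rounds before round `t` in which the label is queried. -/
noncomputable def queriedRounds (ci : BoundRoutine X) (o : WeightedSample X → X → ℝ) (β γ : ℝ)
    (x : ℕ → X) (y : ℕ → Bool) (t : ℕ) : List ℕ :=
  (List.range t).filter fun i => ((round ci β γ (queriedSample ci o β γ x y i) (x i)).run o).2

theorem queriedRounds_succ (ci : BoundRoutine X) (o : WeightedSample X → X → ℝ) (β γ : ℝ)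
    (x : ℕ → X) (y : ℕ → Bool) (t : ℕ) :
    queriedRounds ci o β γ x y (t + 1) =
      if ((round ci β γ (queriedSample ci o β γ x y t) (x t)).run o).2 = true then
        queriedRounds ci o β γ x y t ++ [t] else queriedRounds ci o β γ x y t := by
  unfold queriedRounds
  rw [List.range_succ, List.filter_append]
  split_ifs with h <;> simp [h]

theorem queriedSample_eq_map (ci : BoundRoutine X) (o : WeightedSample X → X → ℝ) (β γ : ℝ)
    (x : ℕ → X) (y : ℕ → Bool) (t : ℕ) :
    queriedSample ci o β γ x y t = (queriedRounds ci o β γ x y t).map fun i => (x i, y i) := by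
  induction t with
  | zero => simp [queriedSample, queriedRounds]
  | succ t ih =>
    rw [queriedSample, queriedRounds_succ]
    split_ifs <;> simp [ih]

end Probe

/-! ### Measurability of the routines -/

section Measurability

variable {X : Type u} [MeasurableSpace X] {F : Set (X → ℝ)} {o : WeightedSample X → X → ℝ}
  {Ω : Type w} [MeasurableSpace Ω]

theorem measurable_labelValue : Measurable labelValue := measurable_from_top

/-- Over a finite class the oracle has finitely many answers, each on a measurable set of samples,
so measurability may be checked with the answer frozen to a fixed `f`. -/
theorem measurable_oracle_comp (hfin : F.Finite) (ho : IsRegressionOracle F o)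
    (hm : IsMeasurableOracle F o) {n : ℕ} {s : Ω → Fin n → ℝ≥0 × X × Bool} (hs : Measurable s)
    {E : Type v} [MeasurableSpace E] {Ψ : (X → ℝ) → Ω → E} (hΨ : ∀ f ∈ F, Measurable (Ψ f)) :
    Measurable fun ω => Ψ (o (List.ofFn (s ω))) ω := by
  intro A hA
  have : (fun ω => Ψ (o (List.ofFn (s ω))) ω) ⁻¹' A =
      ⋃ f ∈ F, (s ⁻¹' {z | o (List.ofFn z) = f}) ∩ Ψ f ⁻¹' A := by
    ext ω
    simp only [Set.mem_preimage, Set.mem_iUnion, Set.mem_inter_iff, Set.mem_ofPred_eq,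
      exists_prop]
    constructor
    · intro h
      exact ⟨_, (ho _).1, rfl, h⟩
    · rintro ⟨f, _, rfl, h⟩
      exact h
  rw [this]
  exact hfin.measurableSet_biUnion fun f hf => (hs (hm n f hf)).inter (hΨ f hf hA)

theorem measurable_sqLoss_ofFn {f : X → ℝ} (hf : Measurable f) {n : ℕ}
    {s : Ω → Fin n → X × Bool} (hs : Measurable s) :
    Measurable fun ω => sqLoss f (List.ofFn (s ω)) := by
  simp only [sqLoss_ofFn]
  refine Finset.measurable_sum _ fun i _ => ?_
  have hi : Measurable fun ω => s ω i := (measurable_pi_apply i).comp hs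
  exact ((hf.comp hi.fst).sub (measurable_labelValue.comp hi.snd)).pow_const 2

theorem measurable_unit {n : ℕ} {s : Ω → Fin n → X × Bool} (hs : Measurable s) :
    Measurable fun ω => (fun i => (1, (s ω i).1, (s ω i).2) : Fin n → ℝ≥0 × X × Bool) := by
  refine measurable_pi_lambda _ fun i => ?_
  have hi : Measurable fun ω => s ω i := (measurable_pi_apply i).comp hs
  exact measurable_const.prodMk (hi.fst.prodMk hi.snd)

theorem measurable_oracle_unitWeights (hfin : F.Finite) (ho : IsRegressionOracle F o)
    (hm : IsMeasurableOracle F o) {n : ℕ} {s : Ω → Fin n → X × Bool} (hs : Measurable s)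
    {E : Type v} [MeasurableSpace E] {Ψ : (X → ℝ) → Ω → E} (hΨ : ∀ f ∈ F, Measurable (Ψ f)) :
    Measurable fun ω => Ψ (o (unitWeights (List.ofFn (s ω)))) ω := by
  simp only [unitWeights_ofFn]
  exact measurable_oracle_comp hfin ho hm (measurable_unit hs) hΨ

theorem measurableSet_probeAccepts (hfin : F.Finite) (hmeas : ∀ f ∈ F, Measurable f)
    (ho : IsRegressionOracle F o) (hm : IsMeasurableOracle F o) (β w : ℝ) {n : ℕ}
    {s : Ω → Fin n → X × Bool} (hs : Measurable s) {x : Ω → X} (hx : Measurable x) {f : X → ℝ}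
    (hf : f ∈ F) {c : Ω → ℝ} (hc : Measurable c) :
    MeasurableSet {ω | ProbeAccepts o β w (List.ofFn (s ω)) (x ω) f (c ω)} := by
  rw [measurableSet_setOfPred]
  simp only [ProbeAccepts, probeSample_ofFn]
  refine measurable_oracle_comp hfin ho hm (s := fun ω => Fin.cons _ (Fin.cons _ _)) ?_
    (Ψ := fun g ω => Accepts β w (List.ofFn (s ω)) (x ω) f g (c ω)) fun g hg => ?_
  · refine measurable_pi_lambda _ fun i => ?_
    refine Fin.cases ?_ (fun i => ?_) i
    · simp only [Fin.cons_zero]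
      exact (measurable_const.mul hc).real_toNNReal.prodMk (hx.prodMk measurable_const)
    · simp only [Fin.cons_succ]
      refine Fin.cases ?_ (fun i => ?_) i
      · simp only [Fin.cons_zero]
        exact (measurable_const.mul (measurable_const.sub hc)).real_toNNReal.prodMk
          (hx.prodMk measurable_const)
      · simp only [Fin.cons_succ]
        exact (measurable_pi_apply i).comp (measurable_unit hs)
  · rw [← measurableSet_setOfPred]
    simp only [Accepts]
    exact measurableSet_le
      ((measurable_sqLoss_ofFn (hmeas g hg) hs).add
        (measurable_const.mul ((((hmeas g hg).comp hx).sub hc).pow_const 2)))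
      ((measurable_sqLoss_ofFn (hmeas f hf) hs).add measurable_const)

theorem measurable_bisectVal {t : Ω → ℝ → Prop}
    (ht : ∀ c : Ω → ℝ, Measurable c → MeasurableSet {ω | t ω (c ω)}) (n : ℕ) {a b : Ω → ℝ}
    (ha : Measurable a) (hb : Measurable b) : Measurable fun ω => bisectVal (t ω) n (a ω) (b ω) := by
  induction n generalizing a b with
  | zero => exact hb
  | succ n ih =>
    have hc : Measurable fun ω => (a ω + b ω) / 2 := (ha.add hb).div_const 2
    exact Measurable.ite (ht _ hc) (ih hc hb) (ih ha hc)

theorem measurable_scanVal {t : Ω → ℝ → Prop}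
    (ht : ∀ c : Ω → ℝ, Measurable c → MeasurableSet {ω | t ω (c ω)}) (ρ : ℝ) (cs : List ℝ)
    {I : Ω → ℝ × ℝ} (hI : Measurable I) : Measurable fun ω => scanVal (t ω) ρ cs (I ω) := by
  induction cs generalizing I with
  | nil => exact hI
  | cons c cs ih =>
    exact ih (Measurable.ite (ht _ measurable_const)
      ((hI.fst.min measurable_const).prodMk (hI.snd.max measurable_const)) hI)

/-- The computed interval is a measurable function of the queried points, their labels and the
new point. -/
def MeasurableBounds (o : WeightedSample X → X → ℝ) (ci : BoundRoutine X) : Prop :=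
  ∀ (β γ : ℝ) (n : ℕ),
    Measurable fun p : (Fin n → X × Bool) × X => (ci β γ (List.ofFn p.1) p.2).run o

theorem measurableBounds_gridRoutine (hfin : F.Finite) (hmeas : ∀ f ∈ F, Measurable f)
    (ho : IsRegressionOracle F o) (hm : IsMeasurableOracle F o) :
    MeasurableBounds o (gridRoutine X) := by
  intro β γ n
  simp only [run_gridRoutine]
  refine measurable_oracle_unitWeights hfin ho hm measurable_fst
    (Ψ := fun f (p : (Fin n → X × Bool) × X) =>
      scanVal (ProbeAccepts o β (β / (γ / 20) ^ 2) (List.ofFn p.1) p.2 f) (γ / 10)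
        ((List.range (⌈20 / γ⌉₊ + 1)).map fun i : ℕ => (i : ℝ) / ⌈20 / γ⌉₊)
        (f p.2 - γ / 10, f p.2 + γ / 10)) fun f hf => ?_
  have hfx : Measurable fun p : (Fin n → X × Bool) × X => f p.2 := (hmeas f hf).comp measurable_snd
  exact measurable_scanVal (fun c hc => measurableSet_probeAccepts hfin hmeas ho hm _ _
    measurable_fst measurable_snd hf hc) _ _
    ((hfx.sub measurable_const).prodMk (hfx.add measurable_const))

theorem measurableBounds_bisectionRoutine (hfin : F.Finite) (hmeas : ∀ f ∈ F, Measurable f)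
    (ho : IsRegressionOracle F o) (hm : IsMeasurableOracle F o) :
    MeasurableBounds o (bisectionRoutine X) := by
  intro β γ n
  simp only [run_bisectionRoutine]
  refine measurable_oracle_unitWeights hfin ho hm measurable_fst
    (Ψ := fun f (p : (Fin n → X × Bool) × X) =>
      (bisectVal (ProbeAccepts o β (β / (γ / 20) ^ 2) (List.ofFn p.1) p.2 f) (bisectionSteps γ)
          (f p.2) 0 - γ / 20,
        bisectVal (ProbeAccepts o β (β / (γ / 20) ^ 2) (List.ofFn p.1) p.2 f) (bisectionSteps γ)
          (f p.2) 1 + γ / 20)) fun f hf => ?_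
  have hfx : Measurable fun p : (Fin n → X × Bool) × X => f p.2 := (hmeas f hf).comp measurable_snd
  have ht : ∀ c : (Fin n → X × Bool) × X → ℝ, Measurable c → MeasurableSet
      {p : (Fin n → X × Bool) × X |
        ProbeAccepts o β (β / (γ / 20) ^ 2) (List.ofFn p.1) p.2 f (c p)} := fun c hc =>
    measurableSet_probeAccepts hfin hmeas ho hm _ _ measurable_fst measurable_snd hf hc
  exact ((measurable_bisectVal ht _ hfx measurable_const).sub measurable_const).prodMk
    ((measurable_bisectVal ht _ hfx measurable_const).add measurable_const)

/-! ### Measurability of the rounds -/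

instance instMeasurableSpacePrediction : MeasurableSpace (Option Bool) := ⊤

instance instDiscretePrediction : DiscreteMeasurableSpace (Option Bool) := ⟨fun _ => trivial⟩

theorem measurable_signLabel : Measurable signLabel := by
  classical
  have h : signLabel = fun p : ℝ => if p ∈ Set.Ici (1 / 2 : ℝ) then true else false := by
    funext p
    by_cases h : 1 / 2 ≤ p <;> simp [signLabel]
  rw [h]
  exact Measurable.ite measurableSet_Ici measurable_const measurable_const

theorem measurableSet_predict_eq_none {γ : ℝ} {p l r : Ω → ℝ} (hl : Measurable l)
    (hr : Measurable r) : MeasurableSet {ω | predict γ (p ω) (l ω) (r ω) = none} := by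
  simp only [predict_eq_none_iff]
  exact (measurableSet_lt hr hl).union
    ((measurableSet_le measurable_const hl).inter (measurableSet_le hr measurable_const))

theorem measurable_predict {γ : ℝ} {p l r : Ω → ℝ} (hp : Measurable p) (hl : Measurable l)
    (hr : Measurable r) : Measurable fun ω => predict γ (p ω) (l ω) (r ω) := by
  classical
  have h : Measurable fun ω => some (signLabel (p ω)) :=
    (measurable_from_top (f := (some : Bool → Option Bool))).comp (measurable_signLabel.comp hp)
  have h' : (fun ω => predict γ (p ω) (l ω) (r ω)) = fun ω =>
      if predict γ (p ω) (l ω) (r ω) = none then none else some (signLabel (p ω)) := by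
    funext ω
    by_cases h : predict γ (p ω) (l ω) (r ω) = none
    · simp [h]
    · simp [predict_of_ne_none h]
  rw [h']
  exact Measurable.ite (measurableSet_predict_eq_none hl hr) measurable_const h

theorem measurable_queryRule {γ : ℝ} {p l r : Ω → ℝ} (hl : Measurable l)
    (hr : Measurable r) : Measurable fun ω => queryRule γ (p ω) (l ω) (r ω) := by
  refine measurable_to_bool ?_
  have : (fun ω => queryRule γ (p ω) (l ω) (r ω)) ⁻¹' {true} =
      ({ω | l ω < 1 / 2} ∩ {ω | 1 / 2 < r ω}) ∩ {ω | predict γ (p ω) (l ω) (r ω) = none}ᶜ := by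
    ext ω
    simp [queryRule]
  rw [this]
  exact ((measurableSet_lt hl measurable_const).inter (measurableSet_lt measurable_const hr)).inter
    (measurableSet_predict_eq_none hl hr).compl

theorem measurable_round (hfin : F.Finite) (hmeas : ∀ f ∈ F, Measurable f)
    (ho : IsRegressionOracle F o) (hm : IsMeasurableOracle F o) {ci : BoundRoutine X}
    (hci : MeasurableBounds o ci) (β γ : ℝ) {n : ℕ} {s : Ω → Fin n → X × Bool} (hs : Measurable s)
    {z : Ω → X} (hz : Measurable z) :
    Measurable fun ω => (round ci β γ (List.ofFn (s ω)) (z ω)).run o := by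
  simp only [run_round]
  have hb : Measurable fun ω => (ci β γ (List.ofFn (s ω)) (z ω)).run o :=
    (hci β γ n).comp (hs.prodMk hz)
  have hp : Measurable fun ω => o (unitWeights (List.ofFn (s ω))) (z ω) :=
    measurable_oracle_unitWeights hfin ho hm hs (Ψ := fun f ω => f (z ω))
      fun f hf => (hmeas f hf).comp hz
  exact (measurable_predict hp hb.fst hb.snd).prodMk (measurable_queryRule hb.fst hb.snd)

/-- The queried sample has random length, so the space is cut according to the list of queried
rounds, which takes countably many values; on each piece the sample is a tuple of fixed length.
Measurability is asked only of the data before round `t` and of `z`, so that the lemma applies to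
the σ-algebra of the history. -/
theorem measurable_round_queriedSample (hfin : F.Finite) (hmeas : ∀ f ∈ F, Measurable f)
    (ho : IsRegressionOracle F o) (hm : IsMeasurableOracle F o) {ci : BoundRoutine X}
    (hci : MeasurableBounds o ci) (β γ : ℝ) (t : ℕ) {x : ℕ → Ω → X} {y : ℕ → Ω → Bool}
    (hx : ∀ i < t, Measurable (x i)) (hy : ∀ i < t, Measurable (y i))
    {z : Ω → X} (hz : Measurable z) :
    Measurable fun ω =>
      (round ci β γ (queriedSample ci o β γ (fun i => x i ω) (fun i => y i ω) t) (z ω)).run o := by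
  let _ : MeasurableSpace (List ℕ) := ⊤
  have key : ∀ s ≤ t, Measurable (fun ω =>
      queriedRounds ci o β γ (fun i => x i ω) (fun i => y i ω) s) → ∀ {z : Ω → X}, Measurable z →
      Measurable fun ω =>
        (round ci β γ (queriedSample ci o β γ (fun i => x i ω) (fun i => y i ω) s) (z ω)).run o := by
    intro s hst hs z hz A hA
    have : (fun ω => (round ci β γ (queriedSample ci o β γ (fun i => x i ω) (fun i => y i ω) s)
        (z ω)).run o) ⁻¹' A = ⋃ l ∈ {l : List ℕ | ∀ i ∈ l, i < s},
        ((fun ω => queriedRounds ci o β γ (fun i => x i ω) (fun i => y i ω) s) ⁻¹' {l}) ∩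
          (fun ω => (round ci β γ (List.ofFn fun k : Fin l.length => (x l[k] ω, y l[k] ω))
            (z ω)).run o) ⁻¹' A := by
      ext ω
      simp only [Set.mem_preimage, Set.mem_iUnion, Set.mem_inter_iff, Set.mem_singleton_iff,
        exists_prop, queriedSample_eq_map]
      have hmap : ∀ l : List ℕ, (List.ofFn fun k : Fin l.length => (x l[k] ω, y l[k] ω)) =
          l.map fun i => (x i ω, y i ω) := by
        intro l
        apply List.ext_getElem <;> simp
      constructor
      · intro h
        refine ⟨_, ?_, rfl, ?_⟩
        · intro i hi
          exact List.mem_range.1 (List.mem_of_mem_filter hi)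
        · rwa [hmap]
      · rintro ⟨l, _, h, h'⟩
        rw [hmap, ← h] at h'
        exact h'
    rw [this]
    refine MeasurableSet.biUnion (Set.to_countable _) fun l hl => ?_
    refine (hs trivial).inter (measurable_round hfin hmeas ho hm hci β γ ?_ hz hA)
    refine measurable_pi_lambda _ fun k => ?_
    have hk : l[k] < t := lt_of_lt_of_le (hl _ (List.getElem_mem _)) hst
    exact (hx _ hk).prodMk (hy _ hk)
  refine key t le_rfl ?_ hz
  have : ∀ s ≤ t, Measurable (fun ω =>
      queriedRounds ci o β γ (fun i => x i ω) (fun i => y i ω) s) := by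
    intro s hst
    induction s with
    | zero => exact measurable_const
    | succ s ih =>
      have ih := ih (by omega)
      simp only [queriedRounds_succ]
      refine Measurable.ite ?_ ((measurable_from_top (f := (· ++ [s]))).comp ih) ih
      exact (key s (by omega) ih (hx s (by omega))).snd (measurableSet_singleton true)
  exact this t le_rfl

end Measurability

/-! ### The regret of one round -/

section Regret

variable {X : Type u} {F : Set (X → ℝ)}

/-- The expectation of Chow's loss of the action `a` if the label is `+1` with probability `p`. -/
noncomputable def expectedLoss (γ : ℝ) (a : Option Bool) (p : ℝ) : ℝ :=
  match a with
  | none => 1 / 2 - γ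
  | some b => if b then 1 - p else p

/-- The expected loss of `a` in excess of that of the Bayes action. -/
noncomputable def regret (γ : ℝ) (a : Option Bool) (p : ℝ) : ℝ :=
  expectedLoss γ a p - expectedLoss γ (some (signLabel p)) p

/-- Three cases. Under abstention `q` lies in the band around `1 / 2`, where the Bayes loss is at
least `1 / 2 - γ`. With neither abstention nor query, `1 / 2` is outside the open interval and `p`,
`q` lie strictly on the same side of it, up to the tie convention. With a query the interval
contains `1 / 2` and leaves the band, so it is longer than `γ`, and a wrong sign costs `2 * |q - 1 /
2|`. -/
theorem regret_predict {γ p q l r : ℝ} (hp : l < p ∧ p < r) (hq : l < q ∧ q < r) :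
    (queryRule γ p l r = false → regret γ (predict γ p l r) q ≤ 0) ∧
    (queryRule γ p l r = true →
      γ < r - l ∧ regret γ (predict γ p l r) q ≤ 2 * (r - l)) := by
  have hlr : ¬ r < l := by linarith
  by_cases hn : predict γ p l r = none
  · have hquery : queryRule γ p l r = false := by simp [queryRule, hn]
    refine ⟨fun _ => ?_, fun h => by simp [hquery] at h⟩
    rw [hn]
    rw [predict_eq_none_iff] at hn
    have hn := hn.resolve_left hlr
    unfold regret expectedLoss signLabel
    by_cases h : 1 / 2 ≤ q
    · simp only [h, decide_true, if_true]; linarith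
    · simp only [h, decide_false]
      simp
      linarith
  · have hquery : queryRule γ p l r = true ↔ l < 1 / 2 ∧ 1 / 2 < r := by
      simp [queryRule, hn]
    rw [predict_of_ne_none hn]
    rw [predict_eq_none_iff, not_or, not_and_or, not_le, not_le] at hn
    constructor
    · intro h
      have h' : ¬ (l < 1 / 2 ∧ 1 / 2 < r) := by rw [← hquery, h]; simp
      have hs : signLabel p = signLabel q := by
        unfold signLabel
        rw [decide_eq_decide]
        by_cases hl : l < 1 / 2
        · have hr : r ≤ 1 / 2 := by
            by_contra! hr
            exact h' ⟨hl, hr⟩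
          constructor <;> intro <;> linarith
        · constructor <;> intro <;> linarith
      rw [hs]
      simp [regret]
    · intro h
      obtain ⟨h1, h2⟩ := hquery.1 h
      refine ⟨by rcases hn.2 with h | h <;> linarith, ?_⟩
      unfold regret expectedLoss
      dsimp only
      split_ifs <;> linarith

/-- The two witnesses of `SharpBounds` satisfy `g' z - g z ≥ (r - l) - γ / 2` for the computed
interval `[l, r]`. The larger of their deviations from `fs z`, say `d`, is at least half of that,
hence above `γ / 4`. Then `2 * (r - l) ≤ 4 * d + γ ≤ 8 * d`. -/
theorem regret_round {ci : BoundRoutine X} (hci : SharpBounds F ci) {o : WeightedSample X → X → ℝ}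
    (ho : IsRegressionOracle F o) {β γ : ℝ} (hβ : 0 < β) (hγ : 0 < γ) (hγ' : γ < 1 / 2)
    (B : Sample X) (z : X) {fs : X → ℝ}
    (hfs : fs ∈ activeSet F (o (unitWeights B)) B β) :
    (((round ci β γ B z).run o).2 = false →
      regret γ ((round ci β γ B z).run o).1 (fs z) ≤ 0) ∧
    (((round ci β γ B z).run o).2 = true →
      ∃ f ∈ activeSet F (o (unitWeights B)) B (2 * β), γ / 4 < |f z - fs z| ∧
        regret γ ((round ci β γ B z).run o).1 (fs z) ≤ 8 * |f z - fs z|) := by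
  obtain ⟨h1, ⟨g, hg, h2⟩, g', hg', h3⟩ := hci o ho β γ hβ hγ hγ' B z
  have h := regret_predict (γ := γ) (h1 _ (ho.mem_activeSet B hβ.le)) (h1 _ hfs)
  rw [run_round]
  refine ⟨h.1, fun hq => ?_⟩
  obtain ⟨h4, h5⟩ := h.2 hq
  rcases le_total (fs z - g z) (g' z - fs z) with h6 | h6
  · have := le_abs_self (g' z - fs z)
    exact ⟨g', hg', by linarith, by dsimp only; linarith⟩
  · have := neg_abs_le (g z - fs z)
    exact ⟨g, hg, by linarith, by dsimp only; linarith⟩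

end Regret

/-! ### Counting with the eluder dimension -/

section Eluder

variable {X : Type u} {F : Set (X → ℝ)} {fs : X → ℝ}

/-- Each point of the list is `ζ`-independent of its tail, with slack `R` instead of `ζ ^ 2`. -/
def IndepList (F : Set (X → ℝ)) (fs : X → ℝ) (ζ R : ℝ) : List X → Prop
  | [] => True
  | z :: l => IndepList F fs ζ R l ∧
      ∃ f ∈ F, ζ < |f z - fs z| ∧ (l.map fun u => (f u - fs u) ^ 2).sum ≤ R

/-- The head of a list is its latest point, hence the reversal by `Fin.snoc`. The statement about
sums serves the induction: it identifies the sum over predecessors with that over the tail. -/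
theorem IndepList.exists_isEluderSeq {ζ : ℝ} {l : List X} (h : IndepList F fs ζ (ζ ^ 2) l) :
    ∃ z : Fin l.length → X, IsEluderSeq F fs ζ z ∧
      ∀ g : X → ℝ, ∑ i, g (z i) = (l.map g).sum := by
  induction l with
  | nil => exact ⟨Fin.elim0, fun i => i.elim0, fun g => by simp⟩
  | cons a l ih =>
    obtain ⟨hl, f, hf, hfa, hsum⟩ := h
    obtain ⟨z, hz, hg⟩ := ih hl
    change ∃ z : Fin (l.length + 1) → X, IsEluderSeq F fs ζ z ∧
      ∀ g : X → ℝ, ∑ i, g (z i) = ((a :: l).map g).sum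
    refine ⟨Fin.snoc (α := fun _ => X) z a, fun i => ?_, fun g => ?_⟩
    · refine Fin.lastCases ?_ (fun i => ?_) i
      · refine ⟨f, hf, by simpa using hfa, ?_⟩
        rw [Finset.sum_filter, Fin.sum_univ_castSucc]
        simpa [Fin.castSucc_lt_last, hg fun u => (f u - fs u) ^ 2] using hsum
      · obtain ⟨f', hf', h1, h2⟩ := hz i
        refine ⟨f', hf', by simpa using h1, ?_⟩
        rw [Finset.sum_filter] at h2 ⊢
        rw [Fin.sum_univ_castSucc]
        simpa [not_lt.2 (Fin.castSucc_lt_last i).le] using h2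
    · rw [Fin.sum_univ_castSucc]
      simp [hg, add_comm]

theorem IndepList.length_le {ζ ζ₀ : ℝ} (hζ : ζ₀ ≤ ζ) {l : List X}
    (h : IndepList F fs ζ (ζ ^ 2) l) : (l.length : ℕ∞) ≤ eluderDim F fs ζ₀ := by
  obtain ⟨z, hz, -⟩ := h.exists_isEluderSeq
  calc (l.length : ℕ∞) ≤ eluderAt F fs ζ :=
        le_iSup₂ (f := fun (m : ℕ) (_ : ∃ z : Fin m → X, IsEluderSeq F fs ζ z) => (m : ℕ∞)) _ ⟨z, hz⟩
    _ ≤ eluderDim F fs ζ₀ := le_iSup₂ (f := fun ζ (_ : ζ₀ ≤ ζ) => eluderAt F fs ζ) ζ hζ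

/-- The points are distributed among `K` lists, each with the slack of the eluder dimension. -/
theorem IndepList.exists_buckets {ζ R : ℝ} {K : ℕ} (hK : R < K * ζ ^ 2) {l : List X}
    (h : IndepList F fs ζ R l) :
    ∃ b : Fin K → List X, (∀ k, IndepList F fs ζ (ζ ^ 2) (b k)) ∧
      ∑ k, (b k).length = l.length ∧ ∀ g : X → ℝ, ∑ k, ((b k).map g).sum = (l.map g).sum := by
  induction l with
  | nil => exact ⟨fun _ => [], fun _ => trivial, by simp, by simp⟩
  | cons a l ih =>
    obtain ⟨hl, f, hf, hfa, hsum⟩ := h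
    obtain ⟨b, hb, hlen, hg⟩ := ih hl
    -- Pigeonhole: if `f` deviated by more than `ζ ^ 2` on every bucket, its total would be at least
    -- `K * ζ ^ 2 > R`. Hence some bucket can take `a`.
    obtain ⟨k, hk⟩ : ∃ k, ((b k).map fun u => (f u - fs u) ^ 2).sum ≤ ζ ^ 2 := by
      by_contra! hcon
      have h1 : ∑ _k : Fin K, ζ ^ 2 ≤ ∑ k, ((b k).map fun u => (f u - fs u) ^ 2).sum :=
        Finset.sum_le_sum fun k _ => (hcon k).le
      rw [hg] at h1
      simp at h1
      linarith
    refine ⟨fun j => if j = k then a :: b j else b j, fun j => ?_, ?_, fun g => ?_⟩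
    · by_cases hj : j = k
      · subst hj
        simp only [if_true]
        exact ⟨hb j, f, hf, hfa, hk⟩
      · simpa only [if_neg hj] using hb j
    · have : ∀ j, (if j = k then a :: b j else b j).length =
          (b j).length + if j = k then 1 else 0 := by intro j; split_ifs <;> simp
      simp [this, Finset.sum_add_distrib, hlen]
    · have : ∀ j, ((if j = k then a :: b j else b j).map g).sum =
          ((b j).map g).sum + if j = k then g a else 0 := by
        intro j; split_ifs <;> simp [add_comm]
      simp only [this, Finset.sum_add_distrib, hg]
      simp [add_comm]

theorem IndepList.length_le_mul {ζ ζ₀ R : ℝ} (hR : 0 ≤ R) (hζ₀ : 0 < ζ₀) (hζ : ζ₀ ≤ ζ) {l : List X}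
    (h : IndepList F fs ζ R l) (htop : eluderDim F fs ζ₀ ≠ ⊤) :
    (l.length : ℝ) ≤ (R / ζ ^ 2 + 1) * (eluderDim F fs ζ₀).toNat := by
  have hζpos : 0 < ζ := hζ₀.trans_le hζ
  have hK : R < (⌊R / ζ ^ 2⌋₊ + 1 : ℕ) * ζ ^ 2 := by
    rw [← div_lt_iff₀ (by positivity)]
    push_cast
    exact Nat.lt_floor_add_one _
  obtain ⟨b, hb, hlen, -⟩ := h.exists_buckets hK
  have h1 : ∀ k, (b k).length ≤ (eluderDim F fs ζ₀).toNat := by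
    intro k
    have := (hb k).length_le hζ
    rw [← ENat.natCast_toNat htop] at this
    exact_mod_cast this
  have h2 : l.length ≤ (⌊R / ζ ^ 2⌋₊ + 1) * (eluderDim F fs ζ₀).toNat := by
    rw [← hlen]
    calc _ ≤ ∑ _k : Fin (⌊R / ζ ^ 2⌋₊ + 1), (eluderDim F fs ζ₀).toNat :=
          Finset.sum_le_sum fun k _ => h1 k
      _ = _ := by simp
  calc (l.length : ℝ) ≤ (⌊R / ζ ^ 2⌋₊ + 1) * (eluderDim F fs ζ₀).toNat := by exact_mod_cast h2
    _ ≤ _ := by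
      gcongr
      exact Nat.floor_le (by positivity)

/-- Few rounds `t` with the property `q` have a deviation `v t` larger than `ζ`, if the deviation is
attained by functions that are close to `fs` on the preceding such rounds. -/
theorem card_deviation_le {ζ ζ₀ R : ℝ} (hR : 0 ≤ R) (hζ₀ : 0 < ζ₀) (hζ : ζ₀ ≤ ζ)
    (htop : eluderDim F fs ζ₀ ≠ ⊤) (T : ℕ) (x : ℕ → X) (q : ℕ → Prop) [DecidablePred q] (v : ℕ → ℝ)
    (h : ∀ t < T, q t → ∃ f ∈ F, v t = |f (x t) - fs (x t)| ∧
      ∑ s ∈ Finset.range t with q s, (f (x s) - fs (x s)) ^ 2 ≤ R) :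
    (((Finset.range T).filter fun t => q t ∧ ζ < v t).card : ℝ) ≤
      (R / ζ ^ 2 + 1) * (eluderDim F fs ζ₀).toNat := by
  have key : ∀ t ≤ T, ∃ l : List X, IndepList F fs ζ R l ∧
      l.length = ((Finset.range t).filter fun t => q t ∧ ζ < v t).card ∧
      ∀ g : X → ℝ, (l.map g).sum = ∑ s ∈ (Finset.range t).filter fun t => q t ∧ ζ < v t, g (x s) := by
    intro t ht
    induction t with
    | zero => exact ⟨[], trivial, by simp, by simp⟩
    | succ t ih =>
      obtain ⟨l, hl, hlen, hg⟩ := ih (by omega)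
      by_cases hq : q t ∧ ζ < v t
      · obtain ⟨f, hf, hv, hsum⟩ := h t (by omega) hq.1
        refine ⟨x t :: l, ⟨hl, f, hf, hv ▸ hq.2, ?_⟩, ?_, fun g => ?_⟩
        · rw [hg]
          -- Only queried rounds with deviation above `ζ` enter the list, whereas the hypothesis
          -- controls all queried rounds; the squares are nonnegative.
          refine le_trans (Finset.sum_le_sum_of_subset_of_nonneg ?_ fun _ _ _ => sq_nonneg _) hsum
          exact Finset.monotone_filter_right _ fun s _ hs => hs.1
        · rw [Finset.range_add_one, Finset.filter_insert, if_pos hq,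
            Finset.card_insert_of_notMem (by simp), List.length_cons, hlen]
        · rw [Finset.range_add_one, Finset.filter_insert, if_pos hq,
            Finset.sum_insert (by simp), List.map_cons, List.sum_cons, hg]
      · refine ⟨l, hl, ?_, fun g => ?_⟩
        · rw [Finset.range_add_one, Finset.filter_insert, if_neg hq, hlen]
        · rw [Finset.range_add_one, Finset.filter_insert, if_neg hq, hg]
  obtain ⟨l, hl, hlen, -⟩ := key T le_rfl
  rw [← hlen]
  exact hl.length_le_mul hR hζ₀ hζ htop

open Classical in
-- For the largest `k` with `2 ^ k * ζ₀ < v`, the single term `2 * (2 ^ k * ζ₀)` already dominates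
-- `v`.
theorem le_sum_dyadic {ζ₀ v : ℝ} (hζ₀ : 0 < ζ₀) (hv : ζ₀ < v) (m : ℕ) (hm : v ≤ 2 ^ m * ζ₀) :
    v ≤ ∑ k ∈ Finset.range m, if 2 ^ k * ζ₀ < v then 2 * (2 ^ k * ζ₀) else 0 := by
  induction m with
  | zero => simp at hm; linarith
  | succ m ih =>
    rw [Finset.sum_range_succ]
    by_cases h : 2 ^ m * ζ₀ < v
    · rw [if_pos h]
      have : 0 ≤ ∑ k ∈ Finset.range m, if 2 ^ k * ζ₀ < v then 2 * (2 ^ k * ζ₀) else 0 :=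
        Finset.sum_nonneg fun k _ => by split_ifs <;> positivity
      rw [pow_succ] at hm
      linarith
    · rw [if_neg h, add_zero]
      exact ih (not_lt.1 h)

open Classical in
/-- If at each scale `ζ ≥ ζ₀` at most `A / ζ ^ 2` deviations exceed `ζ`, then deviations between `ζ₀`
and `1` have a sum of at most `4 * A / ζ₀`. -/
theorem sum_deviation_le {ι : Type*} (S : Finset ι) {v : ι → ℝ} {ζ₀ A : ℝ} (hζ₀ : 0 < ζ₀)
    (hA : 0 ≤ A) (hv : ∀ t ∈ S, ζ₀ < v t) (hv1 : ∀ t ∈ S, v t ≤ 1)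
    (hcard : ∀ ζ, ζ₀ ≤ ζ → ((S.filter fun t => ζ < v t).card : ℝ) ≤ A / ζ ^ 2) :
    ∑ t ∈ S, v t ≤ 4 * A / ζ₀ := by
  obtain ⟨m, hm⟩ := pow_unbounded_of_one_lt (1 / ζ₀) (one_lt_two (α := ℝ))
  rw [div_lt_iff₀ hζ₀] at hm
  calc ∑ t ∈ S, v t
      ≤ ∑ t ∈ S, ∑ k ∈ Finset.range m, if 2 ^ k * ζ₀ < v t then 2 * (2 ^ k * ζ₀) else 0 :=
        Finset.sum_le_sum fun t ht =>
          le_sum_dyadic hζ₀ (hv t ht) m ((hv1 t ht).trans hm.le)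
    _ = ∑ k ∈ Finset.range m, ((S.filter fun t => 2 ^ k * ζ₀ < v t).card : ℝ) *
          (2 * (2 ^ k * ζ₀)) := by
        rw [Finset.sum_comm]
        refine Finset.sum_congr rfl fun k _ => ?_
        rw [← Finset.sum_filter, Finset.sum_const, nsmul_eq_mul]
    -- At scale `ζ = 2 ^ k * ζ₀` the count `A / ζ ^ 2` times `2 * ζ` is `2 * A / ζ`. This decays
    -- geometrically, so the smallest scale dominates.
    _ ≤ ∑ k ∈ Finset.range m, 2 * A / ζ₀ * (1 / 2) ^ k := by
        refine Finset.sum_le_sum fun k _ => ?_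
        have h1 : (1 : ℝ) ≤ 2 ^ k := one_le_pow₀ one_le_two
        calc _ ≤ A / (2 ^ k * ζ₀) ^ 2 * (2 * (2 ^ k * ζ₀)) := by
              gcongr
              exact hcard _ (by nlinarith)
          _ = _ := by
              rw [one_div, inv_pow]
              field_simp
    _ = 2 * A / ζ₀ * ∑ k ∈ Finset.range m, (1 / 2 : ℝ) ^ k := by rw [Finset.mul_sum]
    _ ≤ 2 * A / ζ₀ * 2 := by
        gcongr
        exact sum_geometric_two_le m
    _ = _ := by ring

end Eluder

/-! ### The guarantees on the event that all confidence sets are accurate -/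

section Deterministic

variable {X : Type u} {F : Set (X → ℝ)}

/-- In the first `T` rounds, the active set of radius `β` contains `fs`, and the elements of that of
radius `2 * β` are close to `fs` on the queried points. -/
def AccurateSets (F : Set (X → ℝ)) (ci : BoundRoutine X) (o : WeightedSample X → X → ℝ) (β γ : ℝ)
    (fs : X → ℝ) (x : ℕ → X) (y : ℕ → Bool) (T : ℕ) : Prop :=
  ∀ t < T,
    fs ∈ activeSet F (o (unitWeights (queriedSample ci o β γ x y t)))
      (queriedSample ci o β γ x y t) β ∧
    ∀ f ∈ activeSet F (o (unitWeights (queriedSample ci o β γ x y t)))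
      (queriedSample ci o β γ x y t) (2 * β),
      ∑ s ∈ Finset.range t with ((round ci β γ (queriedSample ci o β γ x y s) (x s)).run o).2 = true,
        (f (x s) - fs (x s)) ^ 2 ≤ 8 * β

/-- Accuracy supplies the slack `R = 8 * β` to the eluder count. The count at scale `γ / 4` bounds
the queries; the dyadic sum of the deviations, times `8`, bounds the regret. -/
theorem AccurateSets.bounds {ci : BoundRoutine X} (hci : SharpBounds F ci)
    (hF : ∀ f ∈ F, ∀ x, f x ∈ Set.Icc (0 : ℝ) 1) {o : WeightedSample X → X → ℝ}
    (ho : IsRegressionOracle F o) {β γ : ℝ} (hβ : 0 < β) (hγ : 0 < γ) (hγ' : γ < 1 / 2)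
    {fs : X → ℝ} (hfs : fs ∈ F) {x : ℕ → X} {y : ℕ → Bool} {T : ℕ}
    (htop : eluderDim F fs (γ / 4) ≠ ⊤) (h : AccurateSets F ci o β γ fs x y T) :
    (numQueries ci o β γ x y T : ℝ) ≤
      16 * ((8 * β + 1) * (eluderDim F fs (γ / 4)).toNat) / γ ^ 2 ∧
    ∑ t ∈ Finset.range T, max 0 (regret γ (classifier ci o β γ x y t (x t)) (fs (x t))) ≤
      128 * ((8 * β + 1) * (eluderDim F fs (γ / 4)).toNat) / γ := by
  classical
  set q : ℕ → Prop := fun t => ((round ci β γ (queriedSample ci o β γ x y t) (x t)).run o).2 = true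
    with hq
  have hex : ∀ t, ∃ f, t < T → q t →
      f ∈ activeSet F (o (unitWeights (queriedSample ci o β γ x y t)))
        (queriedSample ci o β γ x y t) (2 * β) ∧ γ / 4 < |f (x t) - fs (x t)| ∧
        regret γ (classifier ci o β γ x y t (x t)) (fs (x t)) ≤ 8 * |f (x t) - fs (x t)| := by
    intro t
    by_cases ht : t < T ∧ q t
    · obtain ⟨f, hf⟩ := (regret_round hci ho hβ hγ hγ' _ (x t) (h t ht.1).1).2 ht.2
      exact ⟨f, fun _ _ => hf⟩
    · exact ⟨fs, fun h1 h2 => absurd ⟨h1, h2⟩ ht⟩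
  choose f hf using hex
  set v : ℕ → ℝ := fun t => |f t (x t) - fs (x t)| with hv
  set e := (eluderDim F fs (γ / 4)).toNat
  have hcard : ∀ ζ, γ / 4 ≤ ζ →
      (((Finset.range T).filter fun t => q t ∧ ζ < v t).card : ℝ) ≤
        (8 * β / ζ ^ 2 + 1) * e := fun ζ hζ =>
    card_deviation_le (R := 8 * β) (by positivity) (by positivity) hζ htop T x q v fun t ht hqt =>
      ⟨f t, (hf t ht hqt).1.1, rfl, by convert (h t ht).2 _ (hf t ht hqt).1⟩
  have hv1 : ∀ t < T, q t → v t ≤ 1 := by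
    intro t ht hqt
    have h1 := hF _ (hf t ht hqt).1.1 (x t)
    have h2 := hF _ hfs (x t)
    exact abs_le.2 ⟨by linarith [h1.1, h2.2], by linarith [h1.2, h2.1]⟩
  have hcard' : ∀ ζ, γ / 4 ≤ ζ →
      (((Finset.range T).filter fun t => q t ∧ ζ < v t).card : ℝ) ≤
        (8 * β + 1) * e / ζ ^ 2 := by
    intro ζ hζ
    have hζ0 : 0 < ζ := lt_of_lt_of_le (by positivity) hζ
    -- Deviations are at most `1`, so larger scales contribute nothing. For `ζ ≤ 1` the summand `1`
    -- is absorbed into `1 / ζ ^ 2`.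
    rcases le_or_gt ζ 1 with h1 | h1
    · refine (hcard ζ hζ).trans ?_
      have h2 : 1 ≤ 1 / ζ ^ 2 := by
        rw [le_div_iff₀ (by positivity)]
        nlinarith
      calc (8 * β / ζ ^ 2 + 1) * e ≤ (8 * β / ζ ^ 2 + 1 / ζ ^ 2) * e := by gcongr
        _ = _ := by ring
    · have : (Finset.range T).filter (fun t => q t ∧ ζ < v t) = ∅ := by
        refine Finset.filter_eq_empty_iff.2 fun t ht hqt => ?_
        linarith [hv1 t (Finset.mem_range.1 ht) hqt.1, hqt.2]
      rw [this]
      simp only [Finset.card_empty, Nat.cast_zero]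
      positivity
  constructor
  · have h1 := hcard' (γ / 4) le_rfl
    have h2 : (numQueries ci o β γ x y T : ℝ) =
        (((Finset.range T).filter fun t => q t ∧ γ / 4 < v t).card : ℝ) := by
      rw [numQueries, Finset.card_filter]
      congr 1
      refine Finset.sum_congr rfl fun t ht => ?_
      -- Every queried round has a deviation above `γ / 4`, so the count at this scale is the number
      -- of queries.
      have : (q t ∧ γ / 4 < v t) ↔ q t :=
        ⟨fun h => h.1, fun h => ⟨h, (hf t (Finset.mem_range.1 ht) h).2.1⟩⟩
      rw [if_congr this rfl rfl]
    rw [h2]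
    refine h1.trans (le_of_eq ?_)
    field_simp
    ring
  · calc ∑ t ∈ Finset.range T, max 0 (regret γ (classifier ci o β γ x y t (x t)) (fs (x t)))
        ≤ ∑ t ∈ Finset.range T, if q t then 8 * v t else 0 := by
          refine Finset.sum_le_sum fun t ht => ?_
          have ht := Finset.mem_range.1 ht
          split_ifs with hqt
          · exact max_le (by positivity) (hf t ht hqt).2.2
          · refine max_le le_rfl ?_
            exact (regret_round hci ho hβ hγ hγ' _ (x t) (h t ht).1).1 (by simpa [hq] using hqt)
      _ = 8 * ∑ t ∈ Finset.range T with q t, v t := by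
          rw [← Finset.sum_filter, Finset.mul_sum]
      _ ≤ 8 * (4 * ((8 * β + 1) * e) / (γ / 4)) := by
          gcongr
          refine sum_deviation_le _ (by positivity) (by positivity) ?_ ?_ ?_
          · intro t ht
            have ht := Finset.mem_filter.1 ht
            exact (hf t (Finset.mem_range.1 ht.1) ht.2).2.1
          · intro t ht
            have ht := Finset.mem_filter.1 ht
            exact hv1 t (Finset.mem_range.1 ht.1) ht.2
          · intro ζ hζ
            rw [Finset.filter_filter]
            exact hcard' ζ hζ
      _ = _ := by field_simp; ring

/-- A positive eluder dimension needs two functions. -/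
theorem two_le_ncard_of_eluderDim {fs : X → ℝ} (hfin : F.Finite) (hfs : fs ∈ F) {ζ₀ : ℝ}
    (hζ₀ : 0 < ζ₀) (h : (eluderDim F fs ζ₀).toNat ≠ 0) : 2 ≤ F.ncard := by
  by_contra! hlt
  apply h
  have hsub : ∀ f ∈ F, f = fs := fun f hf =>
    (Set.ncard_le_one hfin).1 (by omega) f hf fs hfs
  have : eluderDim F fs ζ₀ = 0 := by
    refine le_antisymm (iSup₂_le fun ζ hζ => iSup₂_le ?_) bot_le
    rintro m ⟨z, hz⟩
    rcases m with _ | m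
    · simp
    · obtain ⟨f, hf, h1, -⟩ := hz 0
      rw [hsub f hf] at h1
      simp at h1
      linarith
  simp [this]

/-- A single point with a larger deviation would already be an eluder sequence of length one. -/
theorem deviation_le_of_eluderDim_eq_zero {fs f : X → ℝ} (hf : f ∈ F) {ζ₀ : ℝ}
    (htop : eluderDim F fs ζ₀ ≠ ⊤) (h : (eluderDim F fs ζ₀).toNat = 0) (z : X) :
    |f z - fs z| ≤ ζ₀ := by
  by_contra! hlt
  have h1 : IndepList F fs ζ₀ (ζ₀ ^ 2) [z] := ⟨trivial, f, hf, hlt, by simp; positivity⟩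
  have h2 := h1.length_le le_rfl
  rw [← ENat.natCast_toNat htop, h] at h2
  simp at h2

end Deterministic

/-! ### A maximal inequality for sums of centred binary variables -/

section Concentration

/-- Hoeffding's lemma for a centred Bernoulli variable. -/
theorem bernoulli_mgf_le {p : ℝ} (hp : p ∈ Set.Icc (0 : ℝ) 1) (s : ℝ) :
    p * Real.exp (s * (1 - p)) + (1 - p) * Real.exp (-(s * p)) ≤ Real.exp (s ^ 2 / 8) := by
  have hp' : 0 ≤ 1 - p := by linarith [hp.2]
  -- The inequality is Hoeffding's lemma for the two-point law on `{0, 1}`: an interval of length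
  -- `1` has variance proxy `1 / 4`, hence the exponent `s ^ 2 / 8`.
  let μ : Measure ℝ := ENNReal.ofReal p • Measure.dirac 1 + ENNReal.ofReal (1 - p) • Measure.dirac 0
  have : IsProbabilityMeasure μ := by
    constructor
    simp only [μ, Measure.add_apply, Measure.smul_apply, measure_univ, smul_eq_mul, mul_one]
    rw [← ENNReal.ofReal_add hp.1 hp']
    simp
  have hint : ∀ g : ℝ → ℝ, ∫ z, g z ∂μ = p * g 1 + (1 - p) * g 0 := by
    intro g
    have h1 : ∀ a : ℝ, Integrable g (Measure.dirac a) := fun a =>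
      (integrable_dirac (by simp))
    rw [integral_add_measure ((h1 1).smul_measure (by simp)) ((h1 0).smul_measure (by simp)),
      integral_smul_measure, integral_smul_measure, integral_dirac, integral_dirac,
      ENNReal.toReal_ofReal hp.1, ENNReal.toReal_ofReal hp']
    simp
  have hmem : ∀ᵐ z ∂μ, z ∈ Set.Icc (0 : ℝ) 1 := by
    simp only [μ, ae_add_measure_iff]
    constructor <;> refine Measure.ae_smul_measure ?_ _ <;>
      · rw [ae_dirac_iff (p := fun z : ℝ => z ∈ Set.Icc (0 : ℝ) 1) measurableSet_Icc]; simp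
  have h := (hasSubgaussianMGF_of_mem_Icc (X := fun z : ℝ => z) aemeasurable_id' hmem).mgf_le s
  simp only [mgf, hint] at h
  have h' : (((‖(1 : ℝ) - 0‖₊ / 2) ^ 2 : ℝ≥0) : ℝ) * s ^ 2 / 2 = s ^ 2 / 8 := by
    simp
    ring
  rw [h'] at h
  refine le_trans (le_of_eq ?_) h
  congr 3 <;> ring_nf

variable {Ω : Type w}

theorem integrable_of_abs_le {mΩ : MeasurableSpace Ω} {P : Measure Ω} [IsFiniteMeasure P]
    {f : Ω → ℝ} (hf : Measurable f) {C : ℝ} (hC : ∀ ω, |f ω| ≤ C) : Integrable f P :=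
  Integrable.of_bound hf.aestronglyMeasurable C (ae_of_all _ hC)

theorem integral_mul_condExp_eq {m mΩ : MeasurableSpace Ω} {P : Measure Ω} [IsFiniteMeasure P]
    (hm : m ≤ mΩ)
    {G Y p : Ω → ℝ} (hG : Measurable[m] G) {C : ℝ} (hC : ∀ ω, |G ω| ≤ C) (hY : Integrable Y P)
    (hp : P[Y | m] =ᵐ[P] p) : ∫ ω, G ω * Y ω ∂P = ∫ ω, G ω * p ω ∂P := by
  have h := condExp_stronglyMeasurable_mul_of_bound hm hG.stronglyMeasurable hY C (ae_of_all _ hC)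
  calc ∫ ω, G ω * Y ω ∂P = ∫ ω, (P[fun ω => G ω * Y ω | m]) ω ∂P := (integral_condExp hm).symm
    _ = ∫ ω, G ω * p ω ∂P := by
      refine integral_congr_ae ?_
      filter_upwards [h, hp] with ω h1 h2
      rw [← h2]
      exact h1

/-- The exponential of a conditionally centred binary variable, compensated by Hoeffding's lemma,
does not increase expectations. -/
theorem integral_exp_step_le {m mΩ : MeasurableSpace Ω} {P : Measure Ω} [IsFiniteMeasure P]
    (hm : m ≤ mΩ)
    {G s Y p : Ω → ℝ} (hG : Measurable[m] G) (hG0 : ∀ ω, 0 ≤ G ω) {C : ℝ} (hC : ∀ ω, G ω ≤ C)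
    (hs : Measurable[m] s) {M : ℝ} (hM : ∀ ω, |s ω| ≤ M) (hYm : Measurable Y)
    (hY : ∀ ω, Y ω = 0 ∨ Y ω = 1) (hpm : Measurable[m] p) (hp01 : ∀ ω, p ω ∈ Set.Icc (0 : ℝ) 1)
    (hp : P[Y | m] =ᵐ[P] p) :
    ∫ ω, G ω * Real.exp (s ω * (Y ω - p ω) - s ω ^ 2 / 8) ∂P ≤ ∫ ω, G ω ∂P := by
  set a : Ω → ℝ := fun ω => Real.exp (s ω * (1 - p ω) - s ω ^ 2 / 8) with ha
  set b : Ω → ℝ := fun ω => Real.exp (-(s ω * p ω) - s ω ^ 2 / 8) with hb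
  have ham : Measurable[m] a := ((hs.mul (measurable_const.sub hpm)).sub
    ((hs.pow_const 2).div_const 8)).exp
  have hbm : Measurable[m] b := ((hs.mul hpm).neg.sub ((hs.pow_const 2).div_const 8)).exp
  have hsp : ∀ ω, ∀ r : ℝ, 0 ≤ r → r ≤ 1 → |s ω * r| ≤ M := fun ω r h0 h1 => by
    rw [abs_mul, abs_of_nonneg h0]
    nlinarith [hM ω, abs_nonneg (s ω)]
  have hale : ∀ ω, a ω ≤ Real.exp M := fun ω => Real.exp_le_exp.2 (by
    have := hsp ω (1 - p ω) (by linarith [(hp01 ω).2]) (by linarith [(hp01 ω).1])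
    have := le_abs_self (s ω * (1 - p ω))
    have := sq_nonneg (s ω)
    linarith)
  have hble : ∀ ω, b ω ≤ Real.exp M := fun ω => Real.exp_le_exp.2 (by
    have := hsp ω (p ω) (hp01 ω).1 (hp01 ω).2
    have := neg_abs_le (s ω * p ω)
    have := sq_nonneg (s ω)
    linarith)
  have ha0 : ∀ ω, 0 < a ω := fun ω => Real.exp_pos _
  have hb0 : ∀ ω, 0 < b ω := fun ω => Real.exp_pos _
  have hYi : Integrable Y P := integrable_of_abs_le hYm (C := 1) fun ω => by
    rcases hY ω with h | h <;> rw [h] <;> simp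
  have hGa : ∀ ω, |G ω * (a ω - b ω)| ≤ C * Real.exp M := fun ω => by
    rw [abs_mul, abs_of_nonneg (hG0 ω)]
    refine mul_le_mul (hC ω) ?_ (abs_nonneg _) ((hG0 ω).trans (hC ω))
    exact abs_le.2 ⟨by linarith [ha0 ω, hble ω], by linarith [hb0 ω, hale ω]⟩
  have hGb : ∀ ω, |G ω * b ω| ≤ C * Real.exp M := fun ω => by
    rw [abs_mul, abs_of_nonneg (hG0 ω), abs_of_pos (hb0 ω)]
    exact mul_le_mul (hC ω) (hble ω) (hb0 ω).le ((hG0 ω).trans (hC ω))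
  have hGam : Measurable[m] fun ω => G ω * (a ω - b ω) := hG.mul (ham.sub hbm)
  have hGbi : Integrable (fun ω => G ω * b ω) P :=
    integrable_of_abs_le ((hG.mul hbm).mono hm le_rfl) hGb
  have hYb : ∀ ω, |G ω * (a ω - b ω) * Y ω| ≤ C * Real.exp M := fun ω => by
    rw [abs_mul]
    rcases hY ω with h | h <;> rw [h]
    · simpa using (abs_nonneg _).trans (hGa ω)
    · simpa using hGa ω
  have hpb : ∀ ω, |G ω * (a ω - b ω) * p ω| ≤ C * Real.exp M := fun ω => by
    rw [abs_mul, abs_of_nonneg (hp01 ω).1]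
    exact (mul_le_of_le_one_right (abs_nonneg _) (hp01 ω).2).trans (hGa ω)
  -- Since `Y` is `0` or `1`, the exponential is affine in `Y` with coefficients measurable for `m`.
  -- Conditioning therefore just replaces `Y` by `p`, without conditional laws.
  have e1 : ∀ ω, G ω * Real.exp (s ω * (Y ω - p ω) - s ω ^ 2 / 8) =
      G ω * (a ω - b ω) * Y ω + G ω * b ω := fun ω => by
    rcases hY ω with h | h <;> rw [h] <;> simp only [ha, hb]
    · rw [zero_sub, mul_neg]; ring
    · ring
  calc ∫ ω, G ω * Real.exp (s ω * (Y ω - p ω) - s ω ^ 2 / 8) ∂P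
      = ∫ ω, G ω * (a ω - b ω) * Y ω ∂P + ∫ ω, G ω * b ω ∂P := by
        simp only [e1]
        exact integral_add
          (integrable_of_abs_le ((hGam.mono hm le_rfl).mul hYm) hYb) hGbi
    _ = ∫ ω, G ω * (a ω - b ω) * p ω ∂P + ∫ ω, G ω * b ω ∂P := by
        rw [integral_mul_condExp_eq hm hGam hGa hYi hp]
    _ = ∫ ω, (G ω * (a ω - b ω) * p ω + G ω * b ω) ∂P :=
        (integral_add (integrable_of_abs_le ((hGam.mul hpm).mono hm le_rfl) hpb) hGbi).symm
    _ ≤ ∫ ω, G ω ∂P := by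
        refine integral_mono ((integrable_of_abs_le ((hGam.mul hpm).mono hm le_rfl) hpb).add hGbi)
          (integrable_of_abs_le (C := C) (hG.mono hm le_rfl) fun ω => by
            rw [abs_of_nonneg (hG0 ω)]; exact hC ω) fun ω => ?_
        have h := bernoulli_mgf_le (hp01 ω) (s ω)
        have h1 : p ω * a ω + (1 - p ω) * b ω ≤ 1 := by
          simp only [ha, hb, Real.exp_sub]
          rw [← mul_div_assoc, ← mul_div_assoc, ← add_div, div_le_one (Real.exp_pos _)]
          exact h
        calc G ω * (a ω - b ω) * p ω + G ω * b ω = G ω * (p ω * a ω + (1 - p ω) * b ω) := by ring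
          _ ≤ G ω * 1 := by gcongr; exact hG0 ω
          _ = G ω := mul_one _

open Classical in
/-- The compensated sum `∑ (s ξ - s ^ 2 / 8)`, stopped when it reaches `a`. -/
noncomputable def stoppedSum (a : ℝ) (s ξ : ℕ → Ω → ℝ) : ℕ → Ω → ℝ
  | 0, _ => 0
  | t + 1, ω => stoppedSum a s ξ t ω +
      ((if a ≤ stoppedSum a s ξ t ω then 0 else s t ω) * ξ t ω -
        (if a ≤ stoppedSum a s ξ t ω then 0 else s t ω) ^ 2 / 8)

/-- After reaching `a` all coefficients vanish and the sum is frozen; before that it equals the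
unstopped sum. Whether any partial sum reached `a` can thus be read off at the final time. -/
theorem stoppedSum_spec (a : ℝ) (s ξ : ℕ → Ω → ℝ) (t : ℕ) (ω : Ω) :
    a ≤ stoppedSum a s ξ t ω ∨
      ((∀ j ≤ t, ∑ i ∈ Finset.range j, (s i ω * ξ i ω - s i ω ^ 2 / 8) < a) ∧
        stoppedSum a s ξ t ω = ∑ i ∈ Finset.range t, (s i ω * ξ i ω - s i ω ^ 2 / 8)) := by
  induction t with
  | zero =>
    rcases le_or_gt a 0 with h | h
    · exact Or.inl h
    · refine Or.inr ⟨fun j hj => ?_, by simp [stoppedSum]⟩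
      obtain rfl : j = 0 := by omega
      simpa using h
  | succ t ih =>
    by_cases h : a ≤ stoppedSum a s ξ t ω
    · left
      simp [stoppedSum, h]
    · obtain ⟨h1, h2⟩ := ih.resolve_left h
      have h3 : stoppedSum a s ξ (t + 1) ω =
          ∑ i ∈ Finset.range (t + 1), (s i ω * ξ i ω - s i ω ^ 2 / 8) := by
        rw [Finset.sum_range_succ, ← h2]
        simp [stoppedSum, h]
      rcases le_or_gt a (stoppedSum a s ξ (t + 1) ω) with h4 | h4
      · exact Or.inl h4
      · refine Or.inr ⟨fun j hj => ?_, h3⟩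
        rcases Nat.lt_or_ge j (t + 1) with h5 | h5
        · exact h1 j (by omega)
        · obtain rfl : j = t + 1 := by omega
          rwa [← h3]

theorem measurable_stoppedSum {H : ℕ → MeasurableSpace Ω} (hmono : Monotone H) (a : ℝ)
    {s ξ : ℕ → Ω → ℝ} (hs : ∀ t, Measurable[H t] (s t)) (hξ : ∀ t, Measurable[H (t + 1)] (ξ t))
    (t : ℕ) : Measurable[H t] (stoppedSum a s ξ t) := by
  induction t with
  | zero => exact measurable_const
  | succ t ih =>
    have ih' := ih.mono (hmono t.le_succ) le_rfl
    have hs' : Measurable[H (t + 1)] fun ω => if a ≤ stoppedSum a s ξ t ω then 0 else s t ω :=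
      Measurable.ite (measurableSet_le measurable_const ih') measurable_const
        ((hs t).mono (hmono t.le_succ) le_rfl)
    exact ih'.add ((hs'.mul (hξ t)).sub ((hs'.pow_const 2).div_const 8))

/-- With probability at least `1 - exp (-a)`, no partial sum of the conditionally centred binary
variables `Y t - p t` with predictable coefficients `s t`, compensated by `s t ^ 2 / 8`, reaches
`a`. -/
theorem measureReal_exists_sum_ge_le {mΩ : MeasurableSpace Ω} {P : Measure Ω}
    [IsProbabilityMeasure P] {H : ℕ → MeasurableSpace Ω}
    (hH : ∀ t, H t ≤ mΩ) (hmono : Monotone H) {s Y p : ℕ → Ω → ℝ}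
    (hs : ∀ t, Measurable[H t] (s t)) {M : ℝ} (hM : ∀ t ω, |s t ω| ≤ M)
    (hYm : ∀ t, Measurable[H (t + 1)] (Y t)) (hY : ∀ t ω, Y t ω = 0 ∨ Y t ω = 1)
    (hpm : ∀ t, Measurable[H t] (p t)) (hp01 : ∀ t ω, p t ω ∈ Set.Icc (0 : ℝ) 1)
    (hp : ∀ t, P[Y t | H t] =ᵐ[P] p t) (a : ℝ) (T : ℕ) :
    P.real {ω | ∃ t ≤ T, a ≤ ∑ i ∈ Finset.range t, (s i ω * (Y i ω - p i ω) - s i ω ^ 2 / 8)} ≤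
      Real.exp (-a) := by
  classical
  set N := stoppedSum a s fun t ω => Y t ω - p t ω with hN
  have hNm : ∀ t, Measurable[H t] (N t) := measurable_stoppedSum hmono a hs fun t =>
    (hYm t).sub ((hpm t).mono (hmono t.le_succ) le_rfl)
  have hNle : ∀ t ω, N t ω ≤ t * M := by
    intro t ω
    induction t with
    | zero => simp [hN, stoppedSum]
    | succ t ih =>
      have h0 : |Y t ω - p t ω| ≤ 1 := by
        have := hp01 t ω
        rcases hY t ω with h | h <;> rw [h] <;> exact abs_le.2 ⟨by linarith [this.1, this.2],
          by linarith [this.1, this.2]⟩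
      have hM0 : 0 ≤ M := (abs_nonneg _).trans (hM t ω)
      have h1 : ∀ r : ℝ, |r| ≤ M → r * (Y t ω - p t ω) - r ^ 2 / 8 ≤ M := by
        intro r hr
        have := le_abs_self (r * (Y t ω - p t ω))
        rw [abs_mul] at this
        nlinarith [sq_nonneg r, abs_nonneg r, abs_nonneg (Y t ω - p t ω)]
      have h2 : |if a ≤ N t ω then 0 else s t ω| ≤ M := by
        split_ifs
        · simpa using hM0
        · exact hM t ω
      have h3 := h1 _ h2
      have h4 : N (t + 1) ω = N t ω + ((if a ≤ N t ω then 0 else s t ω) * (Y t ω - p t ω) -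
        (if a ≤ N t ω then 0 else s t ω) ^ 2 / 8) := rfl
      rw [h4]
      push_cast
      linarith
  have hNi : ∀ t, Integrable (fun ω => Real.exp (N t ω)) P := fun t =>
    integrable_of_abs_le (C := Real.exp (t * M)) ((hNm t).mono (hH t) le_rfl).exp fun ω => by
      rw [abs_of_pos (Real.exp_pos _)]
      exact Real.exp_le_exp.2 (hNle t ω)
  have hE : ∀ t, ∫ ω, Real.exp (N t ω) ∂P ≤ 1 := by
    intro t
    induction t with
    | zero => simp [hN, stoppedSum]
    | succ t ih =>
      have hstep := integral_exp_step_le (P := P) (hH t) (G := fun ω => Real.exp (N t ω))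
        (s := fun ω => if a ≤ N t ω then 0 else s t ω)
        (hNm t).exp (fun ω => (Real.exp_pos _).le) (C := Real.exp (t * M))
        (fun ω => Real.exp_le_exp.2 (hNle t ω))
        (Measurable.ite (measurableSet_le measurable_const (hNm t)) measurable_const (hs t))
        (M := M) (fun ω => by
          split_ifs
          · simpa using (abs_nonneg _).trans (hM t ω)
          · exact hM t ω) ((hYm t).mono (hH (t + 1)) le_rfl) (hY t) (hpm t) (hp01 t) (hp t)
      refine le_trans (le_of_eq ?_) (hstep.trans ih)
      refine integral_congr_ae (ae_of_all _ fun ω => ?_)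
      simp only [← Real.exp_add]
      rfl
  have hsub : {ω | ∃ t ≤ T, a ≤ ∑ i ∈ Finset.range t, (s i ω * (Y i ω - p i ω) - s i ω ^ 2 / 8)} ⊆
      {ω | Real.exp a ≤ Real.exp (N T ω)} := by
    -- A crossing at any `t ≤ T` leaves the stopped sum at `a` or above at time `T`, so Markov's
    -- inequality at the single time `T` suffices.
    rintro ω ⟨t, ht, hta⟩
    rcases stoppedSum_spec a s (fun t ω => Y t ω - p t ω) T ω with h | h
    · exact Real.exp_le_exp.2 h
    · exact absurd hta (not_le.2 (h.1 t ht))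
  have hmarkov := mul_meas_ge_le_integral_of_nonneg (μ := P)
    (ae_of_all _ fun ω => (Real.exp_pos (N T ω)).le) (hNi T) (Real.exp a)
  have h1 := (measureReal_mono (μ := P) hsub)
  have h2 : Real.exp a * P.real {ω | Real.exp a ≤ Real.exp (N T ω)} ≤ 1 := hmarkov.trans (hE T)
  rw [Real.exp_neg]
  refine h1.trans ?_
  rwa [← one_div, le_div_iff₀' (Real.exp_pos a)]

end Concentration

/-! ### Adversarial data -/

section Adversarial

variable {X : Type u} {F : Set (X → ℝ)} {o : WeightedSample X → X → ℝ} {ci : BoundRoutine X}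

theorem sqLoss_queriedSample (f : X → ℝ) (β γ : ℝ) (x : ℕ → X) (y : ℕ → Bool) (t : ℕ) :
    sqLoss f (queriedSample ci o β γ x y t) = ∑ i ∈ Finset.range t,
      if ((round ci β γ (queriedSample ci o β γ x y i) (x i)).run o).2 = true then
        (f (x i) - labelValue (y i)) ^ 2 else 0 := by
  induction t with
  | zero => simp [queriedSample, sqLoss_nil]
  | succ t ih =>
    rw [Finset.sum_range_succ, ← ih, queriedSample]
    split_ifs
    · rw [sqLoss_append, sqLoss_singleton]
    · rw [add_zero]

theorem labelValue_eq (y : Bool) : labelValue y = 0 ∨ labelValue y = 1 := by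
  cases y <;> simp [labelValue]

theorem radius_pos {N : ℕ} (hN : 1 ≤ N) {δ : ℝ} (hδ : 0 < δ) (hδ' : δ < 1) : 0 < radius N δ := by
  have h : (1 : ℝ) ≤ N := by exact_mod_cast hN
  have : 0 < Real.log (2 * N / δ) := Real.log_pos (by rw [lt_div_iff₀ hδ]; linarith)
  unfold radius
  linarith

theorem exp_neg_radius {N : ℕ} (hN : 1 ≤ N) {δ : ℝ} (hδ : 0 < δ) :
    Real.exp (-(2 * radius N δ)) = δ / (2 * N) := by
  have h : (1 : ℝ) ≤ N := by exact_mod_cast hN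
  unfold radius
  rw [show 2 * (1 / 2 * Real.log (2 * N / δ)) = Real.log (2 * N / δ) by ring, Real.exp_neg,
    Real.exp_log (by positivity), inv_div]

theorem log_div_nonneg {N : ℕ} (hN : 1 ≤ N) {δ : ℝ} (hδ : 0 < δ) (hδ' : δ < 1) :
    0 ≤ Real.log (N / δ) := by
  have h : (1 : ℝ) ≤ N := by exact_mod_cast hN
  exact Real.log_nonneg (by rw [le_div_iff₀ hδ]; linarith)

theorem log_two_le_log_div {N : ℕ} (hN : 2 ≤ N) {δ : ℝ} (hδ : 0 < δ) (hδ' : δ < 1) :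
    Real.log 2 ≤ Real.log (N / δ) := by
  have h : (2 : ℝ) ≤ N := by exact_mod_cast hN
  exact Real.log_le_log two_pos (by rw [le_div_iff₀ hδ]; nlinarith)

/-- For `e ≠ 0` there are two functions, so `log (N / δ) ≥ log 2 > 1 / 2`. This absorbs both the `2`
inside the radius and the summand `1`; for `e = 0` both sides vanish. -/
theorem radius_mul_le {N e : ℕ} (h : e ≠ 0 → 2 ≤ N) {δ : ℝ} (hδ : 0 < δ) (hδ' : δ < 1) :
    (8 * radius N δ + 1) * e ≤ 10 * (e * Real.log (N / δ)) := by
  rcases eq_or_ne e 0 with rfl | he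
  · simp
  · have hN := h he
    have hN' : (0 : ℝ) < N := by exact_mod_cast (by omega : 0 < N)
    have h1 := log_two_le_log_div hN hδ hδ'
    have h2 : Real.log (2 * N / δ) = Real.log 2 + Real.log (N / δ) := by
      rw [mul_div_assoc, Real.log_mul (by norm_num) (by positivity)]
    have h3 := Real.log_two_gt_d9
    have h4 : 8 * radius N δ + 1 ≤ 10 * Real.log (N / δ) := by
      unfold radius
      rw [h2]
      linarith
    calc (8 * radius N δ + 1) * e ≤ 10 * Real.log (N / δ) * e := by gcongr
      _ = _ := by ring

variable [MeasurableSpace X] {Ω : Type w} [mΩ : MeasurableSpace Ω] {P : Measure Ω}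
  {x : ℕ → Ω → X} {y : ℕ → Ω → Bool}

theorem history_le (hx : ∀ t, Measurable (x t)) (hy : ∀ t, Measurable (y t)) (t : ℕ) :
    history x y t ≤ mΩ :=
  sup_le (iSup_le fun i => sup_le (hx i).comap_le (hy i).comap_le) (hx t).comap_le

omit mΩ in
theorem comap_point_le_history {i t : ℕ} (h : i ≤ t) :
    MeasurableSpace.comap (x i) inferInstance ≤ history x y t := by
  rcases h.lt_or_eq with h | rfl
  · exact le_trans (le_trans le_sup_left
      (le_iSup (fun i : Fin t => MeasurableSpace.comap (x i) inferInstance ⊔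
        MeasurableSpace.comap (y i) inferInstance) ⟨i, h⟩)) le_sup_left
  · exact le_sup_right

omit mΩ in
theorem comap_label_le_history {i t : ℕ} (h : i < t) :
    MeasurableSpace.comap (y i) inferInstance ≤ history x y t :=
  le_trans (le_trans le_sup_right
    (le_iSup (fun i : Fin t => MeasurableSpace.comap (x i) inferInstance ⊔
      MeasurableSpace.comap (y i) inferInstance) ⟨i, h⟩)) le_sup_left

omit mΩ in
theorem measurable_point_history {i t : ℕ} (h : i ≤ t) : Measurable[history x y t] (x i) :=
  (comap_measurable (x i)).mono (comap_point_le_history h) le_rfl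

omit mΩ in
theorem measurable_label_history {i t : ℕ} (h : i < t) : Measurable[history x y t] (y i) :=
  (comap_measurable (y i)).mono (comap_label_le_history h) le_rfl

omit mΩ in
theorem history_mono : Monotone (history x y) := fun _ _ h =>
  sup_le (iSup_le fun i => sup_le (comap_point_le_history (i.2.le.trans h))
    (comap_label_le_history (i.2.trans_le h))) (comap_point_le_history h)

omit mΩ in
theorem measurable_round_history (hfin : F.Finite) (hmeas : ∀ f ∈ F, Measurable f)
    (ho : IsRegressionOracle F o) (hm : IsMeasurableOracle F o) (hci : MeasurableBounds o ci)
    (β γ : ℝ) (t : ℕ) :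
    Measurable[history x y t] fun ω =>
      (round ci β γ (queriedSample ci o β γ (fun i => x i ω) (fun i => y i ω) t) (x t ω)).run o :=
  @measurable_round_queriedSample X _ F o Ω (history x y t) hfin hmeas ho hm ci hci β γ t x y
    (fun _ hi => measurable_point_history hi.le) (fun _ hi => measurable_label_history hi)
    (x t) (measurable_point_history le_rfl)

theorem one_sub_le_measureReal [IsProbabilityMeasure P] {A B : Ω → Prop} {δ : ℝ}
    (hA : P.real {ω | ¬ A ω} ≤ δ) (h : ∀ᵐ ω ∂P, A ω → B ω) : 1 - δ ≤ P.real {ω | B ω} := by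
  have h1 : P.real {ω | B ω}ᶜ ≤ P.real {ω | ¬ A ω} := by
    refine ENNReal.toReal_mono (measure_ne_top _ _) (measure_mono_ae ?_)
    filter_upwards [h] with ω hω hB hA
    exact hB (hω hA)
  have h2 : P.real ({ω | B ω} ∪ {ω | B ω}ᶜ) ≤ _ := measureReal_union_le _ _
  rw [Set.union_compl_self, probReal_univ] at h2
  linarith

/-- With `d = f - fs` and `ξ = y - fs` at a queried point, the loss of `fs` minus that of `f` is `2
* d * ξ - d ^ 2`. The maximal inequality with coefficient `c * d` gives `c * d * ξ - c ^ 2 * d ^ 2 /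
8`: for `c = 4` this is twice the loss difference, for `c = 2` it is the loss difference plus `d ^ 2
/ 2`. Each of the `2 * |F|` events at level `2 * β` has probability at most `exp (-(2 * β)) = δ / (2
* |F|)`. -/
theorem measureReal_not_accurateSets_le [IsProbabilityMeasure P] (hfin : F.Finite)
    (hF : ∀ f ∈ F, ∀ x, f x ∈ Set.Icc (0 : ℝ) 1) (hmeas : ∀ f ∈ F, Measurable f)
    (ho : IsRegressionOracle F o) (hm : IsMeasurableOracle F o) (hci : MeasurableBounds o ci)
    {fs : X → ℝ} (hfs : fs ∈ F) (hstream : IsAdversarialStream P fs x y) {γ δ : ℝ}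
    (hδ : 0 < δ) (T : ℕ) :
    P.real {ω | ¬ AccurateSets F ci o (radius F.ncard δ) γ fs (fun i => x i ω) (fun i => y i ω) T}
      ≤ δ := by
  classical
  set β := radius F.ncard δ with hβ
  have hN : 1 ≤ F.ncard := (Set.ncard_pos hfin).2 ⟨fs, hfs⟩
  set q : ℕ → Ω → ℝ := fun t ω => if ((round ci β γ
    (queriedSample ci o β γ (fun i => x i ω) (fun i => y i ω) t) (x t ω)).run o).2 = true
      then 1 else 0 with hq
  have hqm : ∀ t, Measurable[history x y t] (q t) := fun t =>
    Measurable.ite ((measurable_round_history hfin hmeas ho hm hci β γ t).snd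
      (measurableSet_singleton true)) measurable_const measurable_const
  have hq01 : ∀ t ω, q t ω = 0 ∨ q t ω = 1 := fun t ω => by
    simp only [hq]
    split_ifs <;> simp
  set S : ℝ → (X → ℝ) → ℕ → Ω → ℝ := fun c f t ω => ∑ i ∈ Finset.range t,
    (c * (q i ω * (f (x i ω) - fs (x i ω))) * (labelValue (y i ω) - fs (x i ω)) -
      (c * (q i ω * (f (x i ω) - fs (x i ω)))) ^ 2 / 8) with hS
  have hmax : ∀ c : ℝ, 0 ≤ c → ∀ f ∈ F, P.real {ω | ∃ t ≤ T, 2 * β ≤ S c f t ω} ≤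
      δ / (2 * F.ncard) := by
    intro c hc f hf
    rw [← exp_neg_radius hN hδ]
    refine measureReal_exists_sum_ge_le (P := P)
      (history_le hstream.measurable_point hstream.measurable_label) history_mono
      (s := fun i ω => c * (q i ω * (f (x i ω) - fs (x i ω)))) (M := c)
      (Y := fun i ω => labelValue (y i ω)) (p := fun i ω => fs (x i ω)) ?_ ?_ ?_ ?_ ?_ ?_ ?_ _ T
    · intro t
      have hxt : Measurable[history x y t] (x t) := measurable_point_history le_rfl
      exact measurable_const.mul ((hqm t).mul
        (((hmeas f hf).comp hxt).sub ((hmeas fs hfs).comp hxt)))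
    · intro t ω
      have h1 := hF f hf (x t ω)
      have h2 := hF fs hfs (x t ω)
      have h3 : |q t ω * (f (x t ω) - fs (x t ω))| ≤ 1 := by
        rcases hq01 t ω with h | h <;> rw [h]
        · simp
        · rw [one_mul]
          exact abs_le.2 ⟨by linarith [h1.1, h2.2], by linarith [h1.2, h2.1]⟩
      rw [abs_mul, abs_of_nonneg hc]
      exact mul_le_of_le_one_right hc h3
    · exact fun t => measurable_labelValue.comp (measurable_label_history t.lt_succ_self)
    · exact fun t ω => labelValue_eq _
    · exact fun t => (hmeas fs hfs).comp (measurable_point_history le_rfl)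
    · exact fun t ω => hF fs hfs _
    · exact hstream.condExp_label
  have hsub : {ω | ¬ AccurateSets F ci o β γ fs (fun i => x i ω) (fun i => y i ω) T} ⊆
      ⋃ f ∈ hfin.toFinset, {ω | ∃ t ≤ T, 2 * β ≤ S 4 f t ω} ∪ {ω | ∃ t ≤ T, 2 * β ≤ S 2 f t ω} := by
    intro ω hω
    by_contra hcon
    simp only [Set.mem_iUnion, Set.mem_union, Set.mem_ofPred_eq, not_exists, not_or, not_and,
      not_le, Set.Finite.mem_toFinset] at hcon
    apply hω
    intro t ht
    set B := queriedSample ci o β γ (fun i => x i ω) (fun i => y i ω) t with hB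
    have hS4 : ∀ f, S 4 f t ω = 2 * (sqLoss fs B - sqLoss f B) := by
      intro f
      rw [hB, sqLoss_queriedSample, sqLoss_queriedSample, ← Finset.sum_sub_distrib, Finset.mul_sum]
      refine Finset.sum_congr rfl fun i _ => ?_
      simp only [hq]
      split_ifs <;> ring
    have hS2 : ∀ f, S 2 f t ω = sqLoss fs B - sqLoss f B + 1 / 2 *
        ∑ i ∈ Finset.range t with ((round ci β γ (queriedSample ci o β γ (fun i => x i ω)
          (fun i => y i ω) i) (x i ω)).run o).2 = true, (f (x i ω) - fs (x i ω)) ^ 2 := by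
      intro f
      rw [hB, sqLoss_queriedSample, sqLoss_queriedSample, ← Finset.sum_sub_distrib,
        Finset.sum_filter, Finset.mul_sum, ← Finset.sum_add_distrib]
      refine Finset.sum_congr rfl fun i _ => ?_
      simp only [hq]
      split_ifs <;> ring
    refine ⟨⟨hfs, ?_⟩, fun f hf => ?_⟩
    -- The empirical minimizer is random, but the event covers all of `F` at once, so it may be
    -- taken as `f`.
    · have := (hcon _ (ho (unitWeights B)).1).1 t ht.le
      rw [hS4] at this
      linarith
    -- Since `f` exceeds the loss of `fs` by at most `2 * β`, half the squared deviation is below `2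
    -- * β + 2 * β`; this is the source of `8 * β`.
    · have h1 := (hcon f hf.1).2 t ht.le
      rw [hS2] at h1
      have h2 := hf.2
      have h3 := ho.sqLoss_le B hfs
      linarith
  calc _ ≤ _ := measureReal_mono hsub (measure_ne_top _ _)
    _ ≤ ∑ f ∈ hfin.toFinset, P.real ({ω | ∃ t ≤ T, 2 * β ≤ S 4 f t ω} ∪
          {ω | ∃ t ≤ T, 2 * β ≤ S 2 f t ω}) := measureReal_biUnion_finset_le _ _
    _ ≤ ∑ _f ∈ hfin.toFinset, δ / F.ncard := by
        refine Finset.sum_le_sum fun f hf => ?_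
        have hf' : f ∈ F := hfin.mem_toFinset.1 hf
        refine (measureReal_union_le _ _).trans ?_
        calc _ ≤ δ / (2 * F.ncard) + δ / (2 * F.ncard) :=
              add_le_add (hmax 4 (by norm_num) f hf') (hmax 2 (by norm_num) f hf')
          _ = δ / F.ncard := by ring
    _ = δ := by
        have : (0 : ℝ) < F.ncard := by exact_mod_cast hN
        rw [Finset.sum_const, ← Set.ncard_eq_toFinset_card F hfin, nsmul_eq_mul]
        field_simp

/-! ### Conditional expectation of Chow's loss and the adversarial bound -/

theorem chowLoss_eq (γ : ℝ) (a : Option Bool) (b : Bool) :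
    chowLoss γ a b = expectedLoss γ a (labelValue b) := by
  rcases a with _ | a
  · rfl
  · cases a <;> cases b <;> simp [chowLoss, expectedLoss, labelValue]

theorem expectedLoss_affine (γ : ℝ) (a : Option Bool) (p : ℝ) :
    expectedLoss γ a p = expectedLoss γ a 0 + (expectedLoss γ a 1 - expectedLoss γ a 0) * p := by
  rcases a with _ | a
  · simp [expectedLoss]
  · cases a <;> simp [expectedLoss]; ring

/-- The loss difference is affine in the label with coefficients known from the history, so
conditioning replaces the label by `fs (x t)`. -/
theorem condExp_chowLoss [IsProbabilityMeasure P] {fs : X → ℝ} (hfs : Measurable fs)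
    (hstream : IsAdversarialStream P fs x y) (γ : ℝ) (t : ℕ) {a : Ω → Option Bool}
    (ha : Measurable[history x y t] a) :
    P[fun ω => chowLoss γ (a ω) (y t ω) - chowLoss γ (some (signLabel (fs (x t ω)))) (y t ω) |
      history x y t] =ᵐ[P] fun ω => regret γ (a ω) (fs (x t ω)) := by
  have hle := history_le hstream.measurable_point hstream.measurable_label t
  have hxt : Measurable[history x y t] fun ω => fs (x t ω) :=
    hfs.comp (measurable_point_history le_rfl)
  have hs : Measurable[history x y t] fun ω => some (signLabel (fs (x t ω))) :=
    (measurable_from_top (f := (some : Bool → Option Bool))).comp (measurable_signLabel.comp hxt)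
  have hcomp : ∀ (g : Option Bool → ℝ) {b : Ω → Option Bool}, Measurable[history x y t] b →
      Measurable[history x y t] fun ω => g (b ω) := fun g b hb =>
    (measurable_from_top (f := g)).comp hb
  have hbdd : ∃ C, ∀ b : Option Bool, ∀ p, p = 0 ∨ p = 1 → |expectedLoss γ b p| ≤ C := by
    refine ⟨|1 / 2 - γ| + 1, fun b p hp => ?_⟩
    rcases b with _ | b
    · simp [expectedLoss]
    · have := abs_nonneg (1 / 2 - γ)
      rcases hp with rfl | rfl <;> cases b <;> simp [expectedLoss] <;> linarith
  obtain ⟨C, hC⟩ := hbdd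
  set A : Ω → ℝ := fun ω => expectedLoss γ (a ω) 0 -
    expectedLoss γ (some (signLabel (fs (x t ω)))) 0 with hA
  set K : Ω → ℝ := fun ω => (expectedLoss γ (a ω) 1 - expectedLoss γ (a ω) 0) -
    (expectedLoss γ (some (signLabel (fs (x t ω)))) 1 -
      expectedLoss γ (some (signLabel (fs (x t ω)))) 0) with hK
  have hAm : Measurable[history x y t] A :=
    (hcomp (fun b => expectedLoss γ b 0) ha).sub (hcomp (fun b => expectedLoss γ b 0) hs)
  have hKm : Measurable[history x y t] K :=
    (hcomp (fun b => expectedLoss γ b 1 - expectedLoss γ b 0) ha).sub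
      (hcomp (fun b => expectedLoss γ b 1 - expectedLoss γ b 0) hs)
  have hAb : ∀ ω, |A ω| ≤ C + C := fun ω =>
    (abs_sub _ _).trans (add_le_add (hC _ 0 (Or.inl rfl)) (hC _ 0 (Or.inl rfl)))
  have hKb : ∀ ω, |K ω| ≤ (C + C) + (C + C) := fun ω =>
    (abs_sub _ _).trans (add_le_add
      ((abs_sub _ _).trans (add_le_add (hC _ 1 (Or.inr rfl)) (hC _ 0 (Or.inl rfl))))
      ((abs_sub _ _).trans (add_le_add (hC _ 1 (Or.inr rfl)) (hC _ 0 (Or.inl rfl)))))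
  have hYm : Measurable fun ω => labelValue (y t ω) :=
    measurable_labelValue.comp (hstream.measurable_label t)
  have hYi : Integrable (fun ω => labelValue (y t ω)) P :=
    integrable_of_abs_le hYm (C := 1) fun ω => by
      rcases labelValue_eq (y t ω) with h | h <;> rw [h] <;> simp
  have hAi : Integrable A P := integrable_of_abs_le (hAm.mono hle le_rfl) hAb
  have hKYi : Integrable (fun ω => K ω * labelValue (y t ω)) P :=
    hYi.bdd_mul (hKm.mono hle le_rfl).aestronglyMeasurable (ae_of_all _ hKb)
  have e1 : (fun ω => chowLoss γ (a ω) (y t ω) -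
      chowLoss γ (some (signLabel (fs (x t ω)))) (y t ω)) =
      A + fun ω => K ω * labelValue (y t ω) := by
    funext ω
    rw [Pi.add_apply, chowLoss_eq, chowLoss_eq, expectedLoss_affine γ (a ω),
      expectedLoss_affine γ (some _)]
    simp only [hA, hK]
    ring
  have h1 := condExp_add hAi hKYi (history x y t)
  have h2 : P[A | history x y t] = A :=
    condExp_of_stronglyMeasurable hle hAm.stronglyMeasurable hAi
  have h3 := condExp_stronglyMeasurable_mul_of_bound hle hKm.stronglyMeasurable hYi _
    (ae_of_all P hKb)
  rw [e1]
  filter_upwards [h1, h3, hstream.condExp_label t] with ω h1 h3 h4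
  rw [h1, Pi.add_apply, h2]
  have h5 : (P[fun ω => K ω * labelValue (y t ω) | history x y t]) ω = K ω * fs (x t ω) := by
    rw [← h4]
    exact h3
  rw [h5, regret, expectedLoss_affine γ (a ω), expectedLoss_affine γ (some _) (fs (x t ω))]
  simp only [hA, hK]
  ring

omit mΩ [MeasurableSpace X] in
theorem eluderDim_le_eluderSup {fs : X → ℝ} (hfs : fs ∈ F) (ζ₀ : ℝ) :
    eluderDim F fs ζ₀ ≤ eluderSup F ζ₀ :=
  le_iSup₂ (f := fun fs (_ : fs ∈ F) => eluderDim F fs ζ₀) fs hfs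

omit mΩ [MeasurableSpace X] in
theorem eluderDim_ne_top (hfin : F.Finite) {fs : X → ℝ} (hfs : fs ∈ F) {ζ₀ : ℝ} (h : 0 < ζ₀) :
    eluderDim F fs ζ₀ ≠ ⊤ :=
  ne_top_of_le_ne_top (eluderSup_ne_top hfin h) (eluderDim_le_eluderSup hfs ζ₀)

omit mΩ [MeasurableSpace X] in
/-- The deterministic bounds in terms of `log (N / δ)`. -/
theorem AccurateSets.log_bounds (hci : SharpBounds F ci) (hfin : F.Finite)
    (hF : ∀ f ∈ F, ∀ x, f x ∈ Set.Icc (0 : ℝ) 1) (ho : IsRegressionOracle F o) {γ δ : ℝ}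
    (hγ : 0 < γ) (hγ' : γ < 1 / 2) (hδ : 0 < δ) (hδ' : δ < 1)
    {fs : X → ℝ} (hfs : fs ∈ F) {x : ℕ → X} {y : ℕ → Bool} {T : ℕ}
    (h : AccurateSets F ci o (radius F.ncard δ) γ fs x y T) :
    (numQueries ci o (radius F.ncard δ) γ x y T : ℝ) ≤
      160 * ((eluderDim F fs (γ / 4)).toNat * Real.log (F.ncard / δ) / γ ^ 2) ∧
    ∑ t ∈ Finset.range T,
      max 0 (regret γ (classifier ci o (radius F.ncard δ) γ x y t (x t)) (fs (x t))) ≤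
      1280 * ((eluderDim F fs (γ / 4)).toNat * Real.log (F.ncard / δ) / γ) := by
  have hN : 1 ≤ F.ncard := (Set.ncard_pos hfin).2 ⟨fs, hfs⟩
  obtain ⟨h1, h2⟩ := h.bounds hci hF ho (radius_pos hN hδ hδ') hγ hγ' hfs
    (eluderDim_ne_top hfin hfs (by positivity))
  have h3 := radius_mul_le (two_le_ncard_of_eluderDim hfin hfs (ζ₀ := γ / 4) (by positivity))
    hδ hδ'
  constructor
  · refine h1.trans ?_
    calc _ ≤ 16 * (10 * ((eluderDim F fs (γ / 4)).toNat * Real.log (F.ncard / δ))) / γ ^ 2 := by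
          gcongr
      _ = _ := by ring
  · refine h2.trans ?_
    calc _ ≤ 128 * (10 * ((eluderDim F fs (γ / 4)).toNat * Real.log (F.ncard / δ))) / γ := by
          gcongr
      _ = _ := by ring

omit mΩ in
-- Almost surely, in every round, the conditional regret is the pointwise regret at `x t`. The
-- deterministic bounds then hold on the event of accurate sets, with no further loss of
-- probability.
theorem adversarialGuarantee (hci : SharpBounds F ci) (hfin : F.Finite)
    (hF : ∀ f ∈ F, ∀ x, f x ∈ Set.Icc (0 : ℝ) 1) (hmeas : ∀ f ∈ F, Measurable f)
    (hcim : ∀ o, IsRegressionOracle F o → IsMeasurableOracle F o → MeasurableBounds o ci)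
    {C : ℝ} (hC : 1280 ≤ C) : AdversarialGuarantee.{u, w} C F ci := by
  intro o ho hm Ω _ P _ fs hfs x y hstream γ δ hγ hγ' hδ hδ' e β T he hβ
  subst he hβ
  have hN : 1 ≤ F.ncard := (Set.ncard_pos hfin).2 ⟨fs, hfs⟩
  have hlog := log_div_nonneg hN hδ hδ'
  refine one_sub_le_measureReal
    (measureReal_not_accurateSets_le (γ := γ) hfin hF hmeas ho hm (hcim o ho hm) hfs hstream hδ T) ?_
  have hcond : ∀ t, P[fun ω' =>
      chowLoss γ (classifier ci o (radius F.ncard δ) γ (fun i => x i ω') (fun i => y i ω') t (x t ω'))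
        (y t ω') - chowLoss γ (some (signLabel (fs (x t ω')))) (y t ω') | history x y t] =ᵐ[P]
      fun ω => regret γ (classifier ci o (radius F.ncard δ) γ (fun i => x i ω) (fun i => y i ω) t
        (x t ω)) (fs (x t ω)) := fun t =>
    condExp_chowLoss (hmeas fs hfs) hstream γ t
      (measurable_round_history hfin hmeas ho hm (hcim o ho hm) _ γ t).fst
  filter_upwards [ae_all_iff.2 hcond] with ω hω hacc
  obtain ⟨h1, h2⟩ := hacc.log_bounds hci hfin hF ho hγ hγ' hδ hδ' hfs
  constructor
  · rw [Finset.sum_congr rfl fun t _ => hω t]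
    refine (Finset.sum_le_sum fun t _ => le_max_right 0 _).trans (h2.trans ?_)
    gcongr
  · refine h1.trans ?_
    gcongr
    linarith

end Adversarial

/-! ### Independent data -/

section IID

variable {X : Type u} {F : Set (X → ℝ)} {o : WeightedSample X → X → ℝ} {ci : BoundRoutine X}

theorem queriedSample_congr {β γ : ℝ} {x x' : ℕ → X} {y y' : ℕ → Bool} {t : ℕ}
    (hx : ∀ i < t, x i = x' i) (hy : ∀ i < t, y i = y' i) :
    queriedSample ci o β γ x y t = queriedSample ci o β γ x' y' t := by
  induction t with
  | zero => rfl
  | succ t ih =>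
    simp only [queriedSample, ih (fun i hi => hx i (by omega)) (fun i hi => hy i (by omega)),
      hx t (by omega), hy t (by omega)]

/-- The stream of points that begins with those of `h`, followed by `z`. -/
def extendPoints {t : ℕ} (h : Fin t → X × Bool) (z : X) (i : ℕ) : X :=
  if hi : i < t then (h ⟨i, hi⟩).1 else z

/-- A stream of labels that begins with those of `h`. -/
def extendLabels {t : ℕ} (h : Fin t → X × Bool) (i : ℕ) : Bool :=
  if hi : i < t then (h ⟨i, hi⟩).2 else true

/-- The classifier of round `t` as a function of the preceding data `h`. -/
noncomputable def classifierOf (ci : BoundRoutine X) (o : WeightedSample X → X → ℝ) (β γ : ℝ)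
    {t : ℕ} (h : Fin t → X × Bool) (z : X) : Option Bool :=
  classifier ci o β γ (extendPoints h z) (extendLabels h) t z

theorem classifierOf_eq (β γ : ℝ) (x : ℕ → X) (y : ℕ → Bool) (t : ℕ) (z : X) :
    classifierOf ci o β γ (fun i : Fin t => (x i, y i)) z = classifier ci o β γ x y t z := by
  unfold classifierOf classifier
  rw [queriedSample_congr (x' := x) (y' := y)]
  · intro i hi
    simp [extendPoints, hi]
  · intro i hi
    simp [extendLabels, hi]

theorem regret_le_one {γ p : ℝ} (hγ : 0 < γ) (hp : p ∈ Set.Icc (0 : ℝ) 1) (a : Option Bool) :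
    regret γ a p ≤ 1 := by
  have h1 : expectedLoss γ a p ≤ 1 := by
    rcases a with _ | a
    · simp only [expectedLoss]; linarith
    · cases a <;> simp [expectedLoss] <;> linarith [hp.1, hp.2]
  have h2 : 0 ≤ expectedLoss γ (some (signLabel p)) p := by
    simp only [expectedLoss]
    split_ifs <;> linarith [hp.1, hp.2]
  unfold regret
  linarith

variable [MeasurableSpace X] {Ω : Type w} [MeasurableSpace Ω] {P : Measure Ω}
  {D : Measure (X × Bool)} {x : ℕ → Ω → X} {y : ℕ → Ω → Bool} {fs : X → ℝ}

theorem measurable_classifierOf (hfin : F.Finite) (hmeas : ∀ f ∈ F, Measurable f)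
    (ho : IsRegressionOracle F o) (hm : IsMeasurableOracle F o) (hci : MeasurableBounds o ci)
    (β γ : ℝ) (t : ℕ) :
    Measurable fun p : (Fin t → X × Bool) × X => classifierOf ci o β γ p.1 p.2 := by
  have hpi : ∀ i : Fin t, Measurable fun p : (Fin t → X × Bool) × X => p.1 i := fun i =>
    (measurable_pi_apply i).comp measurable_fst
  refine (measurable_round_queriedSample hfin hmeas ho hm hci β γ t
    (x := fun i (p : (Fin t → X × Bool) × X) => extendPoints p.1 p.2 i)
    (y := fun i p => extendLabels p.1 i) ?_ ?_ measurable_snd).fst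
  · intro i hi
    simpa only [extendPoints, dif_pos hi] using (hpi ⟨i, hi⟩).fst
  · intro i hi
    simpa only [extendLabels, dif_pos hi] using (hpi ⟨i, hi⟩).snd

theorem measurable_expectedLoss (γ : ℝ) {a : Ω → Option Bool} (ha : Measurable a) {p : Ω → ℝ}
    (hp : Measurable p) : Measurable fun ω => expectedLoss γ (a ω) (p ω) := by
  have h : ∀ q : ℝ, Measurable fun ω => expectedLoss γ (a ω) q := fun q =>
    (measurable_from_top (f := fun b => expectedLoss γ b q)).comp ha
  simp only [expectedLoss_affine γ _ (p _)]
  exact (h 0).add (((h 1).sub (h 0)).mul hp)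

theorem measurable_regret (γ : ℝ) {a : Ω → Option Bool} (ha : Measurable a) {p : Ω → ℝ}
    (hp : Measurable p) : Measurable fun ω => regret γ (a ω) (p ω) :=
  (measurable_expectedLoss γ ha hp).sub (measurable_expectedLoss γ
    ((measurable_from_top (f := (some : Bool → Option Bool))).comp (measurable_signLabel.comp hp))
    hp)

theorem abs_expectedLoss_le (γ : ℝ) (a : Option Bool) {p : ℝ} (hp : p ∈ Set.Icc (0 : ℝ) 1) :
    |expectedLoss γ a p| ≤ |1 / 2 - γ| + 1 := by
  have h0 := abs_nonneg (1 / 2 - γ)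
  rcases a with _ | a
  · simp [expectedLoss]
  · have h : |expectedLoss γ (some a) p| ≤ 1 := by
      simp only [expectedLoss]
      split_ifs <;> exact abs_le.2 ⟨by linarith [hp.1, hp.2], by linarith [hp.1, hp.2]⟩
    linarith

theorem labelValue_mem_Icc (b : Bool) : labelValue b ∈ Set.Icc (0 : ℝ) 1 := by
  rcases labelValue_eq b with h | h <;> rw [h] <;> simp

/-- Labels may be replaced by their conditional means. -/
theorem IsConditionalProb.integral_mul_labelValue [IsFiniteMeasure D]
    (hD : IsConditionalProb D fs) (hfs : Measurable fs) (hfs0 : ∀ z, 0 ≤ fs z)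
    {g : X → ℝ} (hg : Measurable g) :
    ∫ p, g p.1 * labelValue p.2 ∂D = ∫ p, g p.1 * fs p.1 ∂D := by
  have hS : MeasurableSet {p : X × Bool | p.2 = true} :=
    measurable_snd (measurableSet_singleton true)
  have hmap : (D.restrict {p : X × Bool | p.2 = true}).map Prod.fst =
      (D.map Prod.fst).withDensity fun z => ENNReal.ofReal (fs z) := by
    ext A hA
    rw [Measure.map_apply measurable_fst hA, Measure.restrict_apply (measurable_fst hA),
      withDensity_apply _ hA, ← hD A hA]
    congr 1
  calc ∫ p, g p.1 * labelValue p.2 ∂D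
      = ∫ p, Set.indicator {p : X × Bool | p.2 = true} (fun p => g p.1) p ∂D := by
        congr 1
        funext p
        rcases p with ⟨z, b⟩
        cases b <;> simp [labelValue]
    _ = ∫ p, g p.1 ∂(D.restrict {p : X × Bool | p.2 = true}) := integral_indicator hS
    _ = ∫ z, g z ∂((D.restrict {p : X × Bool | p.2 = true}).map Prod.fst) :=
        (integral_map measurable_fst.aemeasurable hg.aestronglyMeasurable).symm
    _ = ∫ z, (ENNReal.ofReal (fs z)).toReal • g z ∂(D.map Prod.fst) := by
        rw [hmap, integral_withDensity_eq_integral_toReal_smul hfs.ennreal_ofReal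
          (ae_of_all _ fun z => ENNReal.ofReal_lt_top)]
    _ = ∫ z, g z * fs z ∂(D.map Prod.fst) := by
        simp only [ENNReal.toReal_ofReal (hfs0 _), smul_eq_mul, mul_comm]
    _ = ∫ p, g p.1 * fs p.1 ∂D :=
        integral_map measurable_fst.aemeasurable (hg.mul hfs).aestronglyMeasurable

/-- Chow's error is the mean of a loss affine in the label, and under `D` the label may be replaced
by its conditional mean `fs`. -/
theorem chowError_eq_integral [IsProbabilityMeasure D] (hD : IsConditionalProb D fs)
    (hfs : Measurable fs) (hfs01 : ∀ z, fs z ∈ Set.Icc (0 : ℝ) 1) (γ : ℝ) {h : X → Option Bool}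
    (hh : Measurable h) :
    chowError γ D h = ∫ p, expectedLoss γ (h p.1) (fs p.1) ∂D := by
  have hh1 : Measurable fun p : X × Bool => h p.1 := hh.comp measurable_fst
  have hy : Measurable fun p : X × Bool => some p.2 :=
    (measurable_from_top (f := (some : Bool → Option Bool))).comp measurable_snd
  have hN : MeasurableSet {p : X × Bool | h p.1 = none} := hh1 (measurableSet_singleton none)
  have hE : MeasurableSet {p : X × Bool | h p.1 ≠ some p.2 ∧ h p.1 ≠ none} :=
    (measurableSet_eq_fun hh1 hy).compl.inter hN.compl
  have hc : ∀ q : ℝ, Measurable fun z => expectedLoss γ (h z) q := fun q =>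
    (measurable_from_top (f := fun b => expectedLoss γ b q)).comp hh
  have hK : Measurable fun z => expectedLoss γ (h z) 1 - expectedLoss γ (h z) 0 :=
    (hc 1).sub (hc 0)
  have h01 : (0 : ℝ) ∈ Set.Icc (0 : ℝ) 1 ∧ (1 : ℝ) ∈ Set.Icc (0 : ℝ) 1 := by simp
  have hi0 : Integrable (fun p : X × Bool => expectedLoss γ (h p.1) 0) D :=
    integrable_of_abs_le ((hc 0).comp measurable_fst) fun p => abs_expectedLoss_le γ _ h01.1
  have hiK : ∀ {u : X × Bool → ℝ}, Measurable u → (∀ p, u p ∈ Set.Icc (0 : ℝ) 1) →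
      Integrable (fun p => (expectedLoss γ (h p.1) 1 - expectedLoss γ (h p.1) 0) * u p) D := by
    intro u hu hu01
    refine integrable_of_abs_le (C := (|1 / 2 - γ| + 1) + (|1 / 2 - γ| + 1))
      ((hK.comp measurable_fst).mul hu) fun p => ?_
    rw [abs_mul, abs_of_nonneg (hu01 p).1]
    refine (mul_le_of_le_one_right (abs_nonneg _) (hu01 p).2).trans ?_
    exact (abs_sub _ _).trans (add_le_add (abs_expectedLoss_le γ _ h01.2)
      (abs_expectedLoss_le γ _ h01.1))
  calc chowError γ D h
      = ∫ p, expectedLoss γ (h p.1) (labelValue p.2) ∂D := by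
        have e : ∀ p : X × Bool, expectedLoss γ (h p.1) (labelValue p.2) =
            Set.indicator {p : X × Bool | h p.1 ≠ some p.2 ∧ h p.1 ≠ none} (fun _ => (1 : ℝ)) p +
            (1 / 2 - γ) * Set.indicator {p : X × Bool | h p.1 = none} (fun _ => (1 : ℝ)) p := by
          intro p
          rw [← chowLoss_eq]
          simp only [Set.indicator_apply, Set.mem_ofPred_eq]
          by_cases hp : h p.1 = none
          · simp [hp, chowLoss]
          · obtain ⟨b, hb⟩ := Option.ne_none_iff_exists'.1 hp
            by_cases hbp : b = p.2 <;> simp [chowLoss, hb, hbp]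
        simp only [e]
        rw [integral_add ((integrable_const _).indicator hE)
          (((integrable_const _).indicator hN).const_mul _), integral_const_mul,
          integral_indicator_const _ hE, integral_indicator_const _ hN]
        simp [chowError]
    _ = ∫ p, expectedLoss γ (h p.1) 0 ∂D +
          ∫ p, (expectedLoss γ (h p.1) 1 - expectedLoss γ (h p.1) 0) * labelValue p.2 ∂D := by
        simp only [expectedLoss_affine γ _ (labelValue _)]
        exact integral_add hi0 (hiK (measurable_labelValue.comp measurable_snd)
          fun p => labelValue_mem_Icc _)
    _ = ∫ p, expectedLoss γ (h p.1) 0 ∂D +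
          ∫ p, (expectedLoss γ (h p.1) 1 - expectedLoss γ (h p.1) 0) * fs p.1 ∂D := by
        rw [hD.integral_mul_labelValue hfs (fun z => (hfs01 z).1) hK]
    _ = ∫ p, expectedLoss γ (h p.1) (fs p.1) ∂D := by
        simp only [expectedLoss_affine γ _ (fs _)]
        exact (integral_add hi0 (hiK (hfs.comp measurable_fst) fun p => hfs01 _)).symm

theorem chowError_sub_stdError [IsProbabilityMeasure D] (hD : IsConditionalProb D fs)
    (hfs : Measurable fs) (hfs01 : ∀ z, fs z ∈ Set.Icc (0 : ℝ) 1) (γ : ℝ) {h : X → Option Bool}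
    (hh : Measurable h) :
    chowError γ D h - stdError D (fun z => signLabel (fs z)) =
      ∫ p, regret γ (h p.1) (fs p.1) ∂D := by
  have hs : Measurable fun z => some (signLabel (fs z)) :=
    (measurable_from_top (f := (some : Bool → Option Bool))).comp (measurable_signLabel.comp hfs)
  have h1 : stdError D (fun z => signLabel (fs z)) =
      chowError γ D fun z => some (signLabel (fs z)) := by
    simp [stdError, chowError]
  have hi : ∀ {k : X → Option Bool}, Measurable k →
      Integrable (fun p : X × Bool => expectedLoss γ (k p.1) (fs p.1)) D := fun {k} hk =>
    integrable_of_abs_le (measurable_expectedLoss γ (hk.comp measurable_fst)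
      (hfs.comp measurable_fst)) fun p => abs_expectedLoss_le γ _ (hfs01 _)
  rw [h1, chowError_eq_integral hD hfs hfs01 γ hh, chowError_eq_integral hD hfs hfs01 γ hs,
    ← integral_sub (hi hh) (hi hs)]
  rfl

/-- The labelled points before round `t`. -/
def past (x : ℕ → Ω → X) (y : ℕ → Ω → Bool) (t : ℕ) (ω : Ω) : Fin t → X × Bool :=
  fun i => (x i ω, y i ω)

theorem IsIIDStream.measurable_past (hs : IsIIDStream P D x y) (t : ℕ) :
    Measurable (past x y t) :=
  measurable_pi_lambda _ fun i => (hs.measurable_point i).prodMk (hs.measurable_label i)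

theorem IsIIDStream.map_past_prod [IsProbabilityMeasure P] (hs : IsIIDStream P D x y) (t : ℕ) :
    P.map (fun ω => (past x y t ω, (x t ω, y t ω))) = (P.map (past x y t)).prod D := by
  have hm : ∀ i, Measurable fun ω => (x i ω, y i ω) := fun i =>
    (hs.measurable_point i).prodMk (hs.measurable_label i)
  have h1 := hs.indep.indepFun_finset (Finset.range t) {t} (by simp) hm
  have hφ : Measurable fun (h : Finset.range t → X × Bool) (i : Fin t) =>
      h ⟨i, Finset.mem_range.2 i.2⟩ := measurable_pi_lambda _ fun i => measurable_pi_apply _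
  have hψ : Measurable fun h : ({t} : Finset ℕ) → X × Bool =>
      h ⟨t, Finset.mem_singleton_self t⟩ := measurable_pi_apply _
  have h2 := h1.comp hφ hψ
  have h3 : IndepFun (past x y t) (fun ω => (x t ω, y t ω)) P := h2
  rw [h3.map_prod_eq_prod_map_map (hs.measurable_past t).aemeasurable (hm t).aemeasurable,
    hs.law t]

/-- Fubini's theorem for the data before round `t` and the data of round `t`. -/
theorem IsIIDStream.integral_past_prod [IsProbabilityMeasure P] [IsProbabilityMeasure D]
    (hs : IsIIDStream P D x y) (t : ℕ) {Φ : (Fin t → X × Bool) × (X × Bool) → ℝ}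
    (hΦ : Measurable Φ) (hint : Integrable (fun ω => Φ (past x y t ω, (x t ω, y t ω))) P) :
    ∫ ω, Φ (past x y t ω, (x t ω, y t ω)) ∂P = ∫ ω, ∫ p, Φ (past x y t ω, p) ∂D ∂P := by
  have hm : Measurable fun ω => (past x y t ω, (x t ω, y t ω)) :=
    (hs.measurable_past t).prodMk ((hs.measurable_point t).prodMk (hs.measurable_label t))
  have : IsProbabilityMeasure (P.map (past x y t)) :=
    Measure.isProbabilityMeasure_map (hs.measurable_past t).aemeasurable
  have h1 : Integrable Φ ((P.map (past x y t)).prod D) := by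
    rw [← hs.map_past_prod t]
    exact (integrable_map_measure hΦ.aestronglyMeasurable hm.aemeasurable).2 hint
  calc ∫ ω, Φ (past x y t ω, (x t ω, y t ω)) ∂P
      = ∫ q, Φ q ∂(P.map fun ω => (past x y t ω, (x t ω, y t ω))) :=
        (integral_map hm.aemeasurable hΦ.aestronglyMeasurable).symm
    _ = ∫ h, ∫ p, Φ (h, p) ∂D ∂(P.map (past x y t)) := by
        rw [hs.map_past_prod t, integral_prod _ h1]
    _ = _ := integral_map (hs.measurable_past t).aemeasurable
        (hΦ.stronglyMeasurable.integral_prod_right' (ν := D)).aestronglyMeasurable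

/-- The conditional expectation is identified through its set integrals: Fubini separates the round
from its past, and under `D` a label integrates like `fs` against functions of the point. -/
theorem IsIIDStream.isAdversarialStream [IsProbabilityMeasure P] [IsProbabilityMeasure D]
    (hs : IsIIDStream P D x y) (hD : IsConditionalProb D fs) (hfs : Measurable fs)
    (hfs01 : ∀ z, fs z ∈ Set.Icc (0 : ℝ) 1) : IsAdversarialStream P fs x y := by
  refine ⟨hs.measurable_point, hs.measurable_label, fun t => ?_⟩
  have hle := history_le hs.measurable_point hs.measurable_label t
  have hYi : Integrable (fun ω => labelValue (y t ω)) P :=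
    integrable_of_abs_le (measurable_labelValue.comp (hs.measurable_label t)) (C := 1) fun ω => by
      rw [abs_of_nonneg (labelValue_mem_Icc _).1]
      exact (labelValue_mem_Icc _).2
  have hpi : Integrable (fun ω => fs (x t ω)) P :=
    integrable_of_abs_le (hfs.comp (hs.measurable_point t)) (C := 1) fun ω => by
      rw [abs_of_nonneg (hfs01 _).1]
      exact (hfs01 _).2
  have hcomap : history x y t ≤
      MeasurableSpace.comap (fun ω => (past x y t ω, x t ω)) inferInstance := by
    have hW : Measurable[MeasurableSpace.comap (fun ω => (past x y t ω, x t ω)) inferInstance]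
        fun ω => (past x y t ω, x t ω) := comap_measurable _
    have hi : ∀ i : Fin t, Measurable[MeasurableSpace.comap
        (fun ω => (past x y t ω, x t ω)) inferInstance] fun ω => past x y t ω i := fun i =>
      (measurable_pi_apply i).comp (measurable_fst.comp hW)
    exact sup_le (iSup_le fun i => sup_le (measurable_fst.comp (hi i)).comap_le
      (measurable_snd.comp (hi i)).comap_le) (measurable_snd.comp hW).comap_le
  refine (ae_eq_condExp_of_forall_setIntegral_eq hle hYi (fun s _ _ => hpi.integrableOn)
    (fun s hs' _ => ?_) (hfs.comp (measurable_point_history le_rfl)).aestronglyMeasurable).symm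
  -- Every event of the history is determined by the past examples and the current point, so its
  -- indicator involves no current label.
  obtain ⟨A, hA, rfl⟩ := hcomap s hs'
  have hsm := hle _ hs'
  have hAp : Measurable fun q : (Fin t → X × Bool) × (X × Bool) =>
      Set.indicator A (fun _ => (1 : ℝ)) (q.1, q.2.1) :=
    (measurable_const.indicator hA).comp
      (measurable_fst.prodMk (measurable_fst.comp measurable_snd))
  have key : ∀ {u : X × Bool → ℝ}, Measurable u → Integrable (fun ω => u (x t ω, y t ω)) P →
      ∫ ω in (fun ω => (past x y t ω, x t ω)) ⁻¹' A, u (x t ω, y t ω) ∂P =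
        ∫ ω, ∫ p, Set.indicator A (fun _ => (1 : ℝ)) (past x y t ω, p.1) * u p ∂D ∂P := by
    intro u hu hui
    have e : ∀ ω, Set.indicator ((fun ω => (past x y t ω, x t ω)) ⁻¹' A)
        (fun ω => u (x t ω, y t ω)) ω =
        Set.indicator A (fun _ => (1 : ℝ)) (past x y t ω, x t ω) * u (x t ω, y t ω) := by
      intro ω
      by_cases h : (past x y t ω, x t ω) ∈ A <;> simp [h]
    rw [← integral_indicator hsm,
      ← hs.integral_past_prod t (Φ := fun q => Set.indicator A (fun _ => (1 : ℝ)) (q.1, q.2.1) *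
        u q.2) (hAp.mul (hu.comp measurable_snd))]
    · exact integral_congr_ae (ae_of_all _ e)
    · simp only [← e]
      exact hui.indicator hsm
  rw [key (u := fun p => fs p.1) (hfs.comp measurable_fst) hpi,
    key (u := fun p => labelValue p.2) (measurable_labelValue.comp measurable_snd) hYi]
  refine integral_congr_ae (ae_of_all _ fun ω => ?_)
  exact (hD.integral_mul_labelValue hfs (fun z => (hfs01 z).1)
    (g := fun z => Set.indicator A (fun _ => (1 : ℝ)) (past x y t ω, z))
    ((measurable_const.indicator hA).comp (measurable_const.prodMk measurable_id))).symm

/-! ### Comparing population sums with observed sums -/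

theorem exp_neg_le {r : ℝ} (h0 : 0 ≤ r) (h1 : r ≤ 1) : Real.exp (-r) ≤ 1 - r / 2 := by
  have h2 := Real.add_one_le_exp r
  rw [Real.exp_neg, inv_le_comm₀ (Real.exp_pos r) (by linarith)]
  have h3 : 1 + r + r ^ 2 / 2 ≤ Real.exp r := Real.quadratic_le_exp_of_nonneg h0
  refine le_trans ?_ h3
  rw [inv_le_iff_one_le_mul₀ (by linarith)]
  -- Indeed `(1 - r / 2) * (1 + r + r ^ 2 / 2) = 1 + r / 2 - r ^ 3 / 4`, which is at least `1` on
  -- `[0, 1]`.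
  nlinarith [mul_nonneg h0 h0, mul_nonneg (mul_nonneg h0 h0) (sub_nonneg.2 h1)]

/-- With probability at least `1 - δ`, the sum of the conditional expectations of `r t` given the
data before round `t` is bounded by twice the observed sum. -/
theorem IsIIDStream.measureReal_sum_integral_le [IsProbabilityMeasure P] [IsProbabilityMeasure D]
    (hs : IsIIDStream P D x y) {r : (t : ℕ) → (Fin t → X × Bool) × X → ℝ}
    (hr : ∀ t, Measurable (r t)) (hr0 : ∀ t q, 0 ≤ r t q) (hr1 : ∀ t q, r t q ≤ 1) {δ : ℝ}
    (hδ : 0 < δ) (T : ℕ) :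
    P.real {ω | ¬ ∑ t ∈ Finset.range T, ∫ p, r t (past x y t ω, p.1) ∂D ≤
      2 * ∑ t ∈ Finset.range T, r t (past x y t ω, x t ω) + 2 * Real.log (1 / δ)} ≤ δ := by
  set R : (t : ℕ) → (Fin t → X × Bool) → ℝ := fun t h => ∫ p, r t (h, p.1) ∂D with hR
  have hrm : ∀ t, Measurable fun q : (Fin t → X × Bool) × (X × Bool) => r t (q.1, q.2.1) :=
    fun t => (hr t).comp (measurable_fst.prodMk (measurable_fst.comp measurable_snd))
  have hrp : ∀ t h, Measurable fun p : X × Bool => r t (h, p.1) := fun t h =>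
    (hr t).comp (measurable_const.prodMk measurable_fst)
  have hRm : ∀ t, Measurable (R t) := fun t =>
    ((hrm t).stronglyMeasurable.integral_prod_right' (ν := D)).measurable
  have hri : ∀ t h, Integrable (fun p : X × Bool => r t (h, p.1)) D := fun t h =>
    integrable_of_abs_le (hrp t h) (C := 1) fun p => by
      rw [abs_of_nonneg (hr0 _ _)]
      exact hr1 _ _
  have hR0 : ∀ t h, 0 ≤ R t h := fun t h => integral_nonneg fun p => hr0 _ _
  have hR1 : ∀ t h, R t h ≤ 1 := fun t h => by
    calc R t h ≤ ∫ _p, (1 : ℝ) ∂D := integral_mono (hri t h) (integrable_const 1) fun p => hr1 _ _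
      _ = 1 := by simp
  set N : ℕ → Ω → ℝ := fun t ω => ∑ i ∈ Finset.range t,
    (R i (past x y i ω) / 2 - r i (past x y i ω, x i ω)) with hN
  have hNle : ∀ t ω, N t ω ≤ t := by
    intro t ω
    calc N t ω ≤ ∑ i ∈ Finset.range t, (1 : ℝ) := Finset.sum_le_sum fun i _ => by
          linarith [hR1 i (past x y i ω), hr0 i (past x y i ω, x i ω), hR0 i (past x y i ω)]
      _ = t := by simp
  have hNm : ∀ t, Measurable[MeasurableSpace.comap (past x y t) inferInstance] (N t) := by
    intro t
    have hpast : Measurable[MeasurableSpace.comap (past x y t) inferInstance] (past x y t) :=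
      comap_measurable _
    have hco : ∀ j (hj : j < t), Measurable[MeasurableSpace.comap (past x y t) inferInstance]
        fun ω => (x j ω, y j ω) := fun j hj =>
      (measurable_pi_apply (⟨j, hj⟩ : Fin t)).comp hpast
    refine Finset.measurable_sum _ fun i hi => ?_
    have hi := Finset.mem_range.1 hi
    have hrestrict : Measurable fun (h : Fin t → X × Bool) (j : Fin i) =>
        h ⟨j, j.2.trans hi⟩ := measurable_pi_lambda _ fun j => measurable_pi_apply _
    have hpi : Measurable[MeasurableSpace.comap (past x y t) inferInstance] (past x y i) :=
      hrestrict.comp hpast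
    exact (((hRm i).comp hpi).div_const 2).sub ((hr i).comp (hpi.prodMk (hco i hi).fst))
  have hNm' : ∀ t, Measurable (N t) := fun t =>
    (hNm t).mono (hs.measurable_past t).comap_le le_rfl
  have hNi : ∀ t, Integrable (fun ω => Real.exp (N t ω)) P := fun t =>
    integrable_of_abs_le (C := Real.exp t) (hNm' t).exp fun ω => by
      rw [abs_of_pos (Real.exp_pos _)]
      exact Real.exp_le_exp.2 (hNle t ω)
  have hE : ∀ t, ∫ ω, Real.exp (N t ω) ∂P ≤ 1 := by
    intro t
    induction t with
    | zero => simp [hN]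
    | succ t ih =>
      -- Writing `N t` as a function of the past makes the next factor a function of past and
      -- current data, to which Fubini applies.
      obtain ⟨G, hG, hGN⟩ := (hNm t).exists_eq_measurable_comp
      have hGN' : ∀ ω, N t ω = G (past x y t ω) := fun ω => congrFun hGN ω
      have e : ∀ ω, Real.exp (N (t + 1) ω) = Real.exp (G (past x y t ω)) *
          Real.exp (R t (past x y t ω) / 2) * Real.exp (-r t (past x y t ω, x t ω)) := by
        intro ω
        rw [← Real.exp_add, ← Real.exp_add, ← hGN']
        simp only [hN, Finset.sum_range_succ]
        congr 1
        ring
      have hΦ : Measurable fun q : (Fin t → X × Bool) × (X × Bool) => Real.exp (G q.1) *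
          Real.exp (R t q.1 / 2) * Real.exp (-r t (q.1, q.2.1)) :=
        ((hG.comp measurable_fst).exp.mul (((hRm t).comp measurable_fst).div_const 2).exp).mul
          (hrm t).neg.exp
      have hint : Integrable (fun ω => Real.exp (G (past x y t ω)) *
          Real.exp (R t (past x y t ω) / 2) * Real.exp (-r t (past x y t ω, x t ω))) P := by
        simp only [← e]
        exact hNi (t + 1)
      have h1 := hs.integral_past_prod t hΦ hint
      -- The supermartingale step: the mean of `exp (-r)` is at most `1 - R / 2 ≤ exp (-(R / 2))`.
      -- The halving of `R` pays for the linear bound on the exponential and yields the factor `2`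
      -- in the conclusion.
      have hinner : ∀ h, Real.exp (R t h / 2) * ∫ p, Real.exp (-r t (h, p.1)) ∂D ≤ 1 := by
        intro h
        have h2 : ∫ p, Real.exp (-r t (h, p.1)) ∂D ≤ ∫ p, (1 - r t (h, p.1) / 2) ∂D := by
          refine integral_mono ?_ ((integrable_const 1).sub ((hri t h).div_const 2))
            fun p => exp_neg_le (hr0 _ _) (hr1 _ _)
          refine integrable_of_abs_le (C := 1) (hrp t h).neg.exp fun p => ?_
          rw [abs_of_pos (Real.exp_pos _)]
          exact Real.exp_le_one_iff.2 (by linarith [hr0 t (h, p.1)])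
        have h3 : ∫ p, (1 - r t (h, p.1) / 2) ∂D = 1 - R t h / 2 := by
          rw [integral_sub (integrable_const 1) ((hri t h).div_const 2), integral_div]
          simp [hR]
        have h4 : 1 - R t h / 2 ≤ Real.exp (-(R t h / 2)) := by
          linarith [Real.add_one_le_exp (-(R t h / 2))]
        calc _ ≤ Real.exp (R t h / 2) * Real.exp (-(R t h / 2)) := by
              gcongr
              linarith
          _ = 1 := by rw [← Real.exp_add, add_neg_cancel, Real.exp_zero]
      refine le_trans ?_ ih
      calc ∫ ω, Real.exp (N (t + 1) ω) ∂P
          = ∫ ω, Real.exp (G (past x y t ω)) * (Real.exp (R t (past x y t ω) / 2) *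
              ∫ p, Real.exp (-r t (past x y t ω, p.1)) ∂D) ∂P := by
            simp only [e]
            refine h1.trans ?_
            simp only [integral_const_mul, mul_assoc]
        _ ≤ ∫ ω, Real.exp (N t ω) ∂P := by
            refine integral_mono_of_nonneg (ae_of_all _ fun ω => ?_) (hNi t)
              (ae_of_all _ fun ω => ?_)
            · exact mul_nonneg (Real.exp_pos _).le (mul_nonneg (Real.exp_pos _).le
                (integral_nonneg fun p => (Real.exp_pos _).le))
            · simp only [hGN']
              exact mul_le_of_le_one_right (Real.exp_pos _).le (hinner _)
  have hsub : {ω | ¬ ∑ t ∈ Finset.range T, ∫ p, r t (past x y t ω, p.1) ∂D ≤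
      2 * ∑ t ∈ Finset.range T, r t (past x y t ω, x t ω) + 2 * Real.log (1 / δ)} ⊆
      {ω | 1 / δ ≤ Real.exp (N T ω)} := by
    intro ω hω
    have hω : ¬ ∑ t ∈ Finset.range T, R t (past x y t ω) ≤
      2 * ∑ t ∈ Finset.range T, r t (past x y t ω, x t ω) + 2 * Real.log (1 / δ) := hω
    have h2 : N T ω = (∑ t ∈ Finset.range T, R t (past x y t ω)) / 2 -
        ∑ t ∈ Finset.range T, r t (past x y t ω, x t ω) := by
      simp only [hN, Finset.sum_sub_distrib, Finset.sum_div]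
    have h3 : Real.log (1 / δ) ≤ N T ω := by
      rw [h2]
      linarith
    calc 1 / δ = Real.exp (Real.log (1 / δ)) := (Real.exp_log (by positivity)).symm
      _ ≤ _ := Real.exp_le_exp.2 h3
  have hmarkov := mul_meas_ge_le_integral_of_nonneg (μ := P)
    (ae_of_all _ fun ω => (Real.exp_pos (N T ω)).le) (hNi T) (1 / δ)
  refine (measureReal_mono hsub).trans ?_
  have h2 : 1 / δ * P.real {ω | 1 / δ ≤ Real.exp (N T ω)} ≤ 1 := hmarkov.trans (hE T)
  rw [one_div_mul_eq_div, div_le_one hδ] at h2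
  exact h2

end IID

/-! ### The guarantee for independent data -/

section Main

variable {X : Type u} {F : Set (X → ℝ)} {o : WeightedSample X → X → ℝ} {ci : BoundRoutine X}

/-- If the eluder dimension vanishes, then no classifier has a positive regret at any point. -/
theorem regret_nonpos_of_eluderDim_eq_zero (hci : SharpBounds F ci) (ho : IsRegressionOracle F o)
    {β γ : ℝ} (hβ : 0 < β) (hγ : 0 < γ) (hγ' : γ < 1 / 2) {fs : X → ℝ} {B : Sample X}
    (hfs : fs ∈ activeSet F (o (unitWeights B)) B β) (htop : eluderDim F fs (γ / 4) ≠ ⊤)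
    (he : (eluderDim F fs (γ / 4)).toNat = 0) (z : X) :
    regret γ ((round ci β γ B z).run o).1 (fs z) ≤ 0 := by
  have h := regret_round hci ho hβ hγ hγ' B z hfs
  cases hq : ((round ci β γ B z).run o).2
  · exact h.1 hq
  · obtain ⟨f, hf, hlt, -⟩ := h.2 hq
    exact absurd (deviation_le_of_eluderDim_eq_zero hf.1 htop he z) (not_le.2 hlt)

theorem measureReal_not_and_le {Ω : Type w} [MeasurableSpace Ω] {P : Measure Ω}
    [IsFiniteMeasure P] {A B : Ω → Prop} {δ δ' : ℝ} (hA : P.real {ω | ¬ A ω} ≤ δ)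
    (hB : P.real {ω | ¬ B ω} ≤ δ') : P.real {ω | ¬ (A ω ∧ B ω)} ≤ δ + δ' := by
  have hsub : {ω | ¬ (A ω ∧ B ω)} ⊆ {ω | ¬ A ω} ∪ {ω | ¬ B ω} := fun ω hω =>
    not_and_or.1 hω
  exact (measureReal_mono hsub).trans ((measureReal_union_le _ _).trans (add_le_add hA hB))

variable [MeasurableSpace X]

/-- Two events of probability at least `1 - δ` are combined: accurate sets, which bound the regret
at the observed points, and the comparison with population regret. The positive part of the regret
is used since the comparison needs values in `[0, 1]`. The bound on oracle calls is deterministic.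
-/
theorem iidGuarantee (hci : SharpBounds F ci) (hfin : F.Finite)
    (hF : ∀ f ∈ F, ∀ x, f x ∈ Set.Icc (0 : ℝ) 1) (hmeas : ∀ f ∈ F, Measurable f)
    (hcim : ∀ o, IsRegressionOracle F o → IsMeasurableOracle F o → MeasurableBounds o ci)
    {K : ℝ → ℝ} (hK : ∀ γ, 0 < γ → γ < 1 / 2 → 0 ≤ K γ) {C₀ C₁ C : ℝ}
    (hcalls : CallsBounded (fun γ => C₁ * K γ) F ci) (hC₀ : 3000 ≤ C₀) (hC₁ : 1 ≤ C₁)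
    (hC : C₁ * (C₀ + 1) ≤ C) : IIDGuarantee.{u, w} C₀ C K F ci := by
  intro o ho hm Ω _ P _ D _ fs hfs hD x y hs ε γ δ hε hγ hγ' hδ hδ' e β T he hβ hT
  have hN : 1 ≤ F.ncard := (Set.ncard_pos hfin).2 ⟨fs, hfs⟩
  have hlog := log_div_nonneg hN hδ hδ'
  have hβ0 : 0 < β := hβ ▸ radius_pos hN hδ hδ'
  have he0 : 0 ≤ e := he ▸ Nat.cast_nonneg _
  set ℓ := Real.log (F.ncard / δ) with hℓ
  have hq0 : 0 ≤ e / (ε * γ) * ℓ := by positivity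
  have hT1 : 1 ≤ T := by rw [hT]; exact le_max_left _ _
  have hT1' : (1 : ℝ) ≤ T := by exact_mod_cast hT1
  have hfsm := hmeas fs hfs
  have hfs01 := hF fs hfs
  have htop := eluderDim_ne_top hfin hfs (ζ₀ := γ / 4) (by positivity)
  have hle : (((eluderDim F fs (γ / 4)).toNat : ℕ) : ℝ) ≤ e := by
    rw [he]
    exact_mod_cast ENat.toNat_le_toNat (eluderDim_le_eluderSup hfs _)
      (eluderSup_ne_top hfin (by positivity))
  constructor
  · set r : (t : ℕ) → (Fin t → X × Bool) × X → ℝ := fun t q =>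
      max 0 (regret γ (classifierOf ci o β γ q.1 q.2) (fs q.2)) with hr
    have hrm : ∀ t, Measurable (r t) := fun t => measurable_const.max
      (measurable_regret γ (measurable_classifierOf hfin hmeas ho hm (hcim o ho hm) β γ t)
        (hfsm.comp measurable_snd))
    have hr1 : ∀ t q, r t q ≤ 1 := fun t q =>
      max_le zero_le_one (regret_le_one hγ (hfs01 _) _)
    have hfr := hs.measureReal_sum_integral_le hrm (fun t q => le_max_left _ _) hr1 hδ T
    have hacc := measureReal_not_accurateSets_le (P := P) (γ := γ) hfin hF hmeas ho hm
      (hcim o ho hm) hfs (hs.isAdversarialStream hD hfsm hfs01) hδ T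
    rw [← hβ] at hacc
    have hgood : P.real {ω | ¬ (AccurateSets F ci o β γ fs (fun i => x i ω) (fun i => y i ω) T ∧
        ∑ t ∈ Finset.range T, ∫ p, r t (past x y t ω, p.1) ∂D ≤
          2 * ∑ t ∈ Finset.range T, r t (past x y t ω, x t ω) + 2 * Real.log (1 / δ))} ≤ 2 * δ := by
      exact (measureReal_not_and_le hacc hfr).trans (by linarith)
    refine one_sub_le_measureReal hgood (ae_of_all _ fun ω => ?_)
    rintro ⟨hA, hB⟩
    subst hβ
    obtain ⟨h1, h2⟩ := hA.log_bounds hci hfin hF ho hγ hγ' hδ hδ' hfs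
    set β := radius F.ncard δ
    have hcl : ∀ t z, classifierOf ci o β γ (past x y t ω) z =
        classifier ci o β γ (fun i => x i ω) (fun i => y i ω) t z := fun t z =>
      classifierOf_eq β γ (fun i => x i ω) (fun i => y i ω) t z
    have hclm : ∀ t, Measurable (classifier ci o β γ (fun i => x i ω) (fun i => y i ω) t) := by
      intro t
      have := (measurable_classifierOf hfin hmeas ho hm (hcim o ho hm) β γ t).comp
        (measurable_const (a := past x y t ω) |>.prodMk measurable_id)
      exact (funext (hcl t)) ▸ this
    have hex : ∀ t, chowError γ D (classifier ci o β γ (fun i => x i ω) (fun i => y i ω) t) -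
        stdError D (fun z => signLabel (fs z)) =
        ∫ p, regret γ (classifier ci o β γ (fun i => x i ω) (fun i => y i ω) t p.1) (fs p.1) ∂D :=
      fun t => chowError_sub_stdError hD hfsm hfs01 γ (hclm t)
    constructor
    · rw [div_le_iff₀ (by linarith)]
      simp only [hex]
      -- For `e = 0` the horizon is `1` and cannot absorb `log (1 / δ)`; the regret is then
      -- nonpositive everywhere. For `e ≥ 1` this logarithm is at most `e * ℓ / γ`.
      rcases eq_or_ne (eluderSup F (γ / 4)).toNat 0 with h0 | h0
      · have h0' : (eluderDim F fs (γ / 4)).toNat = 0 := by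
          have := ENat.toNat_le_toNat (eluderDim_le_eluderSup hfs (γ / 4))
            (eluderSup_ne_top hfin (by positivity))
          omega
        refine le_trans (Finset.sum_nonpos fun t ht => integral_nonpos fun p => ?_)
          (by positivity)
        exact regret_nonpos_of_eluderDim_eq_zero hci ho hβ0 hγ hγ'
          (hA t (Finset.mem_range.1 ht)).1 htop h0' p.1
      · have he1 : 1 ≤ e := by
          rw [he]
          exact_mod_cast Nat.one_le_iff_ne_zero.2 h0
        have h3 : ∑ t ∈ Finset.range T, ∫ p,
            regret γ (classifier ci o β γ (fun i => x i ω) (fun i => y i ω) t p.1) (fs p.1) ∂D ≤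
            ∑ t ∈ Finset.range T, ∫ p, r t (past x y t ω, p.1) ∂D := by
          refine Finset.sum_le_sum fun t _ => ?_
          simp only [hr, hcl]
          have hm1 : Measurable fun p : X × Bool => regret γ
              (classifier ci o β γ (fun i => x i ω) (fun i => y i ω) t p.1) (fs p.1) :=
            measurable_regret γ ((hclm t).comp measurable_fst) (hfsm.comp measurable_fst)
          refine integral_mono (integrable_of_abs_le
            (C := (|1 / 2 - γ| + 1) + (|1 / 2 - γ| + 1)) hm1 fun p => ?_)
            (integrable_of_abs_le (C := 1) (measurable_const.max hm1) fun p => ?_)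
            fun p => le_max_right _ _
          · exact (abs_sub _ _).trans (add_le_add (abs_expectedLoss_le γ _ (hfs01 _))
              (abs_expectedLoss_le γ _ (hfs01 _)))
          · rw [abs_of_nonneg (le_max_left _ _)]
            exact max_le zero_le_one (regret_le_one hγ (hfs01 _) _)
        have h4 : ∑ t ∈ Finset.range T, r t (past x y t ω, x t ω) ≤
            1280 * (e * ℓ / γ) := by
          simp only [hr, hcl]
          refine h2.trans ?_
          gcongr
        have h5 : Real.log (1 / δ) ≤ ℓ := by
          refine Real.log_le_log (by positivity) ?_
          gcongr
          exact_mod_cast hN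
        have h6 : ℓ ≤ e * ℓ / γ := by
          rw [le_div_iff₀ hγ]
          nlinarith
        have h7 : C₀ * (e / (ε * γ) * ℓ) ≤ T := by
          rw [hT, horizon, ← he]
          exact (Nat.le_ceil _).trans (by exact_mod_cast le_max_right _ _)
        have h8 : C₀ * (e * ℓ / γ) ≤ ε * T := by
          calc C₀ * (e * ℓ / γ) = ε * (C₀ * (e / (ε * γ) * ℓ)) := by field_simp
            _ ≤ ε * T := by gcongr
        have h9 : 3000 * (e * ℓ / γ) ≤ C₀ * (e * ℓ / γ) := by gcongr
        have h10 : 0 ≤ e * ℓ / γ := by positivity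
        -- The sum is at most `(2 * 1280 + 2) * (e * ℓ / γ)`, and `2562 ≤ 3000 ≤ C₀`.
        linarith
    · refine h1.trans ?_
      have h160 : (160 : ℝ) ≤ C := by nlinarith
      gcongr
  · intro ω
    have h1 := (hcalls o ho β γ hβ0 hγ hγ').2 (fun i => x i ω) (fun i => y i ω) T
    refine h1.trans ?_
    have hKγ := hK γ hγ hγ'
    set m := max 1 (e / (ε * γ) * ℓ) with hm'
    have hm1 : 1 ≤ m := le_max_left _ _
    have hmq : e / (ε * γ) * ℓ ≤ m := le_max_right _ _
    -- Rounding up adds at most `1 ≤ m`.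
    have hTm : (T : ℝ) ≤ (C₀ + 1) * m := by
      rw [hT, horizon, ← he, Nat.cast_max, Nat.cast_one]
      refine max_le (by nlinarith) ?_
      have := Nat.ceil_lt_add_one (mul_nonneg (by linarith : 0 ≤ C₀) hq0)
      nlinarith
    calc (T : ℝ) * (C₁ * K γ) ≤ ((C₀ + 1) * m) * (C₁ * K γ) := by gcongr
      _ = C₁ * (C₀ + 1) * m * K γ := by ring
      _ ≤ C * m * K γ := by gcongr

end Main

end ActiveLearning

theorem mainTheorem10 :
    ∃ C₀ C : ℝ, 0 < C₀ ∧ 0 < C ∧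
      ∀ (X : Type u) [MeasurableSpace X],
        -- classes without any convexity
        (∃ ci : ActiveLearning.BoundRoutine X,
          ∀ F : Set (X → ℝ), (∀ f ∈ F, ∀ x, f x ∈ Set.Icc (0 : ℝ) 1) →
            ActiveLearning.ApproximatesBounds F ci ∧
            ActiveLearning.CallsBounded (fun γ => C * (1 / γ ^ 2 * Real.log (1 / γ))) F ci ∧
            (F.Finite → (∀ f ∈ F, Measurable f) →
              ActiveLearning.IIDGuarantee.{u, w} C₀ C
                (fun γ => 1 / γ ^ 2 * Real.log (1 / γ)) F ci ∧
              ActiveLearning.AdversarialGuarantee.{u, w} C F ci)) ∧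
        -- convex classes that are closed under pointwise convergence
        (∃ ci : ActiveLearning.BoundRoutine X,
          ∀ F : Set (X → ℝ), (∀ f ∈ F, ∀ x, f x ∈ Set.Icc (0 : ℝ) 1) →
            Convex ℝ F → IsSeqClosed F →
            ActiveLearning.ApproximatesBounds F ci ∧
            ActiveLearning.CallsBounded (fun γ => C * Real.log (1 / γ)) F ci ∧
            (F.Finite → (∀ f ∈ F, Measurable f) →
              ActiveLearning.IIDGuarantee.{u, w} C₀ C (fun γ => Real.log (1 / γ)) F ci ∧
              ActiveLearning.AdversarialGuarantee.{u, w} C F ci)) := by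
  -- Each round costs at most `50` times the complexity factor, and `50 * (3000 + 1) ≤ 200000`; the
  -- constants `160` and `1280` of the other bounds are smaller.
  refine ⟨3000, 200000, by norm_num, by norm_num, fun X _ => ⟨?_, ?_⟩⟩
  · refine ⟨ActiveLearning.gridRoutine X, fun F hF => ?_⟩
    have hb := ActiveLearning.sharpBounds_gridRoutine hF
    refine ⟨hb.approximatesBounds hF, ActiveLearning.callsBounded_gridRoutine F (by norm_num),
      fun hfin hmeas => ?_⟩
    have hcim := fun o ho hm =>
      ActiveLearning.measurableBounds_gridRoutine (o := o) hfin hmeas ho hm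
    refine ⟨ActiveLearning.iidGuarantee hb hfin hF hmeas hcim (fun γ hγ hγ' => ?_)
      (ActiveLearning.callsBounded_gridRoutine F (le_refl 50)) le_rfl (by norm_num) (by norm_num),
      ActiveLearning.adversarialGuarantee hb hfin hF hmeas hcim (by norm_num)⟩
    have := ActiveLearning.log_two_le_log_one_div hγ hγ'
    have := Real.log_pos one_lt_two
    exact mul_nonneg (by positivity) (by linarith)
  · refine ⟨ActiveLearning.bisectionRoutine X, fun F hF hconv _ => ?_⟩
    have hb := ActiveLearning.sharpBounds_bisectionRoutine hF hconv
    refine ⟨hb.approximatesBounds hF, ActiveLearning.callsBounded_bisectionRoutine F (by norm_num),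
      fun hfin hmeas => ?_⟩
    have hcim := fun o ho hm =>
      ActiveLearning.measurableBounds_bisectionRoutine (o := o) hfin hmeas ho hm
    refine ⟨ActiveLearning.iidGuarantee hb hfin hF hmeas hcim (fun γ hγ hγ' => ?_)
      (ActiveLearning.callsBounded_bisectionRoutine F (le_refl 50)) le_rfl (by norm_num)
        (by norm_num),
      ActiveLearning.adversarialGuarantee hb hfin hF hmeas hcim (by norm_num)⟩
    have := ActiveLearning.log_two_le_log_one_div hγ hγ'
    have := Real.log_pos one_lt_two
    linarith
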